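/- **Setting.** Fix $t$ and real numbers $\rho_l$, $1\le l\le t$. For every $p$ let $n_l=n_l(p)$ and let $X_l,Y_l$ ($1\le l\le t$) be real random $p\times n_l$ matrices, all defined on one probability space; the entries may change with $p$. Assume: (i) for every $p$ the pairs $(X^{(l)}_{ij},Y^{(l)}_{ij})$ are independent across $1\le i\le p$, $1\le j\le n_l$, $1\le l\le t$; (ii) $\mathbb E X^{(l)}_{ij}=\mathbb E Y^{(l)}_{ij}=0$, $\mathbb E (X^{(l)}_{ij})^2=\mathbb E (Y^{(l)}_{ij})^2=1$, $\mathbb E X^{(l)}_{ij}Y^{(l)}_{ij}=\rho_l$; (iii) for all $l$ and $k\ge1$, $\mathbb E(|X^{(l)}_{ij}|^k+|Y^{(l)}_{ij}|^k)$ is bounded uniformly in $p,i,j$; (iv) $n_l\to\infty$ and $p/n_l\to y_l$ as $p\to\infty$, with $0<y_l<\infty$ for every $l$. Let $C_l=n_l^{-1}X_lY_l^{*}$. Let $\mathcal M_p(\mathbb C)$ be the $*$-algebra of random complex $p\times p$ matrices whose entries have finite absolute moments of all orders, and put $\varphi_p(M)=p^{-1}\mathbb E\,\mathrm{Tr}\,M$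 and $\tilde\varphi_p(M)=p^{-1}\mathrm{Tr}\,M$. In a $*$-probability space $(\mathcal A,\varphi)$ the free cumulants are $\kappa_k(a_1,\dots,a_k)=\sum_{\sigma\in NC(k)}\varphi_\sigma[a_1,\dots,a_k]\,\mu(\sigma,\mathbf 1_k)$, where $NC(k)$ is the lattice of non-crossing partitions of $\{1,\dots,k\}$, $\mathbf 1_k$ is the one-block partition, $\mu$ is the Möbius function of $NC(k)$, and $\varphi_\sigma[a_1,\dots,a_k]$ is the product over the blocks $\{i_1<\dots<i_s\}$ of $\sigma$ of $\varphi(a_{i_1}\cdots a_{i_s})$. Variables $c_1,\dots,c_t$ are free if every free cumulant $\kappa_k(c_{\alpha_1}^{\eta_1},\dots,c_{\alpha_k}^{\eta_k})$, $\eta_u\in\{1,*\}$, in which $\alpha_1,\dots,\alpha_k$ are not all equal vanishes. An element $c$ is a cross-covariance variable with parameters $(\rho,y)$ if for all $k\ge1$ and $\eta_1,\dots,\eta_k\in\{1,*\}$ $$\kappa_k(c^{\eta_1},\dots,c^{\eta_k})=\begin{cases}y^{k-1}\rho^{S(\eta)}&\rho\ne0,\\ y^{k-1}\delta_{S(\eta),0}&\rho=0,\end{cases}\qquad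 S(\eta)=\#\{1\le u\le k:\eta_u=\eta_{u+1}\},\quad \eta_{k+1}:=\eta_1 .$$ **Theorem.** There are a $*$-probability space $(\mathcal A,\varphi)$ whose state $\varphi$ is tracial and free elements $c_1,\dots,c_t\in\mathcal A$, where $c_l$ is a cross-covariance variable with parameters $(\rho_l,y_l)$, such that the following hold. (a) For every polynomial $\Pi$ with complex coefficients in non-commuting variables and their adjoints, $\Pi(C_1,\dots,C_t)\in\mathcal M_p(\mathbb C)$ for every $p$ and $\varphi_p(\Pi(C_1,\dots,C_t))\to\varphi(\Pi(c_1,\dots,c_t))$ as $p\to\infty$. Moreover, almost surely, $\tilde\varphi_p(\Pi(C_1,\dots,C_t))\to\varphi(\Pi(c_1,\dots,c_t))$ for all such $\Pi$. (b) Let $\Pi$ be such a polynomial with real coefficients for which, almost surely, the matrix $\Pi(C_1,\dots,C_t)$ is symmetric for all large $p$. Then $\Pi(c_1,\dots,c_t)$ is self-adjoint, there is exactly one probability measure $\mu$ on $\mathbb R$ with $\varphi(\Pi(c_1,\dots,c_t)^k)=\int x^k\,d\mu$ for all $k\ge1$, $\mu$ has compact support, and almost surely the empirical spectral distribution of $\Pi(C_1,\dots,C_t)$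 (mass $p^{-1}$ at each eigenvalue, with multiplicity) converges weakly to $\mu$. -/

import Mathlib

open MeasureTheory ProbabilityTheory Filter Topology
open scoped ENNReal ComplexOrder

noncomputable section

namespace CrossCov

/-! Non-crossing partitions of `{0, …, n-1}`, their lattice order and Moebius function. -/

/-- A partition of `Fin n` is non-crossing if there are no `i < j < k < l` such that `i, k` lie in
one block and `j, l` lie in a different block. -/
def IsNonCrossing {n : ℕ} (π : Finpartition (Finset.univ : Finset (Fin n))) : Prop :=
  ∀ V ∈ π.parts, ∀ W ∈ π.parts, ∀ i j k l : Fin n, i < j → j < k → k < l →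
    i ∈ V → k ∈ V → j ∈ W → l ∈ W → V = W

/-- `NC n`: the non-crossing partitions of `Fin n`, ordered by refinement. -/
abbrev NC (n : ℕ) : Type := {π : Finpartition (Finset.univ : Finset (Fin n)) // IsNonCrossing π}

instance instFintypeNC (n : ℕ) : Fintype (NC n) := by
  classical exact Subtype.fintype _

instance instDecidableEqNC (n : ℕ) : DecidableEq (NC n) := Classical.decEq _

instance instLocallyFiniteOrderNC (n : ℕ) : LocallyFiniteOrder (NC n) := by
  classical exact Fintype.toLocallyFiniteOrder

theorem isNonCrossing_top (n : ℕ) :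
    IsNonCrossing (⊤ : Finpartition (Finset.univ : Finset (Fin n))) := by
  intro V hV W hW i j k l _ _ _ _ _ _ _
  have h1 := Finset.mem_singleton.1 (Finpartition.parts_top_subset _ hV)
  have h2 := Finset.mem_singleton.1 (Finpartition.parts_top_subset _ hW)
  rw [h1, h2]

/-- The partition with a single block. -/
def NC.one (n : ℕ) : NC n := ⟨⊤, isNonCrossing_top n⟩

/-! States, free cumulants, freeness. -/

section Free

variable {A : Type*} [Ring A] [StarRing A] [Algebra ℂ A]

/-- `φ` is a state: unital and positive. -/
def IsState (φ : A →ₗ[ℂ] ℂ) : Prop :=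
  φ 1 = 1 ∧ ∀ a : A, 0 ≤ φ (a * star a)

/-- `φ` is tracial. -/
def IsTracial (φ : A →ₗ[ℂ] ℂ) : Prop :=
  ∀ a b : A, φ (a * b) = φ (b * a)

/-- `φ(V)[a₁, …, aₙ] = φ(a_{i₁} ⋯ a_{iₛ})` for `V = {i₁ < ⋯ < iₛ}`. -/
def blockMoment (φ : A →ₗ[ℂ] ℂ) {n : ℕ} (a : Fin n → A) (V : Finset (Fin n)) : ℂ :=
  φ (((V.sort (· ≤ ·)).map a).prod)

/-- `φ_π[a₁, …, aₙ]`, the multiplicative extension of the moments to `NC n`. -/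
def partitionMoment (φ : A →ₗ[ℂ] ℂ) {n : ℕ} (a : Fin n → A) (π : NC n) : ℂ :=
  ∏ V ∈ π.1.parts, blockMoment φ a V

/-- The joint free cumulant `κₙ(a₁, …, aₙ) = ∑_{σ ∈ NC(n)} φ_σ[a₁, …, aₙ] μ(σ, 1ₙ)`, where `μ` is
the Moebius function of the lattice `NC n`. -/
def freeCumulant (φ : A →ₗ[ℂ] ℂ) {n : ℕ} (a : Fin n → A) : ℂ :=
  ∑ σ : NC n, partitionMoment φ a σ * IncidenceAlgebra.mu ℂ σ (NC.one n)

end Free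

/-- `c^η` for an exponent `η ∈ {1, *}`: `false` stands for `1` and `true` for `*`. -/
def adj {B : Type*} [Star B] (c : B) : Bool → B
  | false => c
  | true => star c

/-- `S(η₁, …, η_k)`: the number of `u` with `η_u = η_{u+1}`, where `η_{k+1} = η₁`. -/
def cyclicAgreements {k : ℕ} (η : Fin k → Bool) : ℕ :=
  ∑ u : Fin k, if η u = η (finRotate k u) then 1 else 0

/-- `c` is a cross-covariance variable with parameters `ρ` and `y`. -/
def IsCrossCovVariable {A : Type*} [Ring A] [StarRing A] [Algebra ℂ A] (φ : A →ₗ[ℂ] ℂ) (c : A)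
    (ρ y : ℝ) : Prop :=
  ∀ k : ℕ, 1 ≤ k → ∀ η : Fin k → Bool,
    freeCumulant φ (fun u => adj c (η u)) =
      if ρ ≠ 0 then (y : ℂ) ^ (k - 1) * (ρ : ℂ) ^ cyclicAgreements η
      else (y : ℂ) ^ (k - 1) * (if cyclicAgreements η = 0 then 1 else 0)

/-- The variables `c_l` are free: all mixed free cumulants in `c_l, c_l^*` vanish. -/
def IsFreeFamily {A : Type*} [Ring A] [StarRing A] [Algebra ℂ A] (φ : A →ₗ[ℂ] ℂ) {t : ℕ}
    (c : Fin t → A) : Prop :=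
  ∀ (k : ℕ) (α : Fin k → Fin t) (η : Fin k → Bool), (∃ u v, α u ≠ α v) →
    freeCumulant φ (fun u => adj (c (α u)) (η u)) = 0

/-- `μ` is the probability law of the self-adjoint variable `a`: the unique probability measure on
`ℝ` with `φ(aⁿ) = ∫ xⁿ dμ` for all `n ≥ 1`. -/
def IsLawOf {A : Type*} [Ring A] [StarRing A] [Algebra ℂ A] (φ : A →ₗ[ℂ] ℂ) (a : A)
    (μ : ProbabilityMeasure ℝ) : Prop :=
  IsSelfAdjoint a ∧
    ∀ ν : ProbabilityMeasure ℝ,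
      (∀ n : ℕ, 1 ≤ n → Integrable (fun x : ℝ => x ^ n) (ν : Measure ℝ) ∧
        φ (a ^ n) = ((∫ x : ℝ, x ^ n ∂(ν : Measure ℝ) : ℝ) : ℂ)) ↔ ν = μ

/-! Polynomials in non-commuting variables and their adjoints. -/

/-- `*`-polynomials with coefficients in `𝕜` in `t` non-commuting variables: the generator
`(l, false)` is the `l`-th variable and `(l, true)` its adjoint. -/
abbrev StarPoly (𝕜 : Type*) [CommSemiring 𝕜] (t : ℕ) : Type _ := FreeAlgebra 𝕜 (Fin t × Bool)

/-- The value `Π({c_l, c_l^*})`. -/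
def StarPoly.eval {𝕜 : Type*} [CommSemiring 𝕜] {t : ℕ} {B : Type*} [Semiring B] [Star B]
    [Algebra 𝕜 B] (Q : StarPoly 𝕜 t) (c : Fin t → B) : B :=
  FreeAlgebra.lift 𝕜 (fun x : Fin t × Bool => adj (c x.1) x.2) Q

/-! Random matrices. -/

/-- Membership in `M_p(ℂ)`: all entries have finite absolute moments of every order. -/
def HasAllMoments {Ω : Type*} [MeasurableSpace Ω] (P : Measure Ω) {p : ℕ}
    (M : Ω → Matrix (Fin p) (Fin p) ℂ) : Prop :=
  ∀ (i j : Fin p) (k : ℕ), MemLp (fun ω => M ω i j) k P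

/-- `φ̃_p(M) = p⁻¹ Tr M`. -/
def normTrace {p : ℕ} (M : Matrix (Fin p) (Fin p) ℂ) : ℂ := (p : ℂ)⁻¹ * M.trace

/-- `φ_p(M) = p⁻¹ E Tr M`. -/
def expTrace {Ω : Type*} [MeasurableSpace Ω] (P : Measure Ω) {p : ℕ}
    (M : Ω → Matrix (Fin p) (Fin p) ℂ) : ℂ := (p : ℂ)⁻¹ * ∫ ω, (M ω).trace ∂P

/-- The empirical spectral distribution: mass `p⁻¹` at each eigenvalue, counted with multiplicity.
It is used for symmetric real matrices, all of whose eigenvalues are real. -/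
def esdMeasure {p : ℕ} (M : Matrix (Fin p) (Fin p) ℝ) : Measure ℝ :=
  (p : ℝ≥0∞)⁻¹ • (M.charpoly.roots.map Measure.dirac).sum

theorem isFiniteMeasure_esdMeasure {p : ℕ} (M : Matrix (Fin p) (Fin p) ℝ) :
    IsFiniteMeasure (esdMeasure M) := by
  have key : ∀ s : Multiset ℝ,
      (s.map (Measure.dirac : ℝ → Measure ℝ)).sum Set.univ = (Multiset.card s : ℝ≥0∞) := by
    intro s
    induction s using Multiset.induction_on with
    | empty => simp
    | cons a s ih => simp [ih, add_comm]
  refine ⟨?_⟩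
  rw [esdMeasure, Measure.smul_apply, key, smul_eq_mul]
  rcases Nat.eq_zero_or_pos p with hp | hp
  · have h : Multiset.card M.charpoly.roots = 0 := by
      have h1 := M.charpoly.card_roots'
      rw [Matrix.charpoly_natDegree_eq_dim, Fintype.card_fin] at h1
      omega
    simp [h]
  · refine ENNReal.mul_lt_top ?_ (ENNReal.natCast_lt_top _)
    rw [ENNReal.inv_lt_top]
    exact_mod_cast hp

/-- The empirical spectral distribution as a finite measure, so that weak convergence is available
as convergence in `FiniteMeasure ℝ`. -/
def esd {p : ℕ} (M : Matrix (Fin p) (Fin p) ℝ) : FiniteMeasure ℝ :=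
  ⟨esdMeasure M, isFiniteMeasure_esdMeasure M⟩

/-- The sample cross-covariance matrix `n⁻¹ X Y^*`. -/
def crossCov {p n : ℕ} (X Y : Matrix (Fin p) (Fin n) ℝ) : Matrix (Fin p) (Fin p) ℝ :=
  (n : ℝ)⁻¹ • (X * Y.conjTranspose)

/-- The assumptions on the entries of `X_l, Y_l`, for `l = 1, …, t` and every `p`; the number
`n_l = n l p` of columns depends on `p`. -/
structure EntryAssumptions {Ω : Type*} [MeasurableSpace Ω] (P : Measure Ω) {t : ℕ}
    (n : Fin t → ℕ → ℕ) (X Y : (l : Fin t) → (p : ℕ) → Ω → Matrix (Fin p) (Fin (n l p)) ℝ)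
    (ρ : Fin t → ℝ) : Prop where
  measurable_X : ∀ l p i j, Measurable fun ω => X l p ω i j
  measurable_Y : ∀ l p i j, Measurable fun ω => Y l p ω i j
  /-- For every `p`, the pairs `(X_{ij}^{(l)}, Y_{ij}^{(l)})` are independent across `i, j, l`. -/
  indep : ∀ p : ℕ, iIndepFun
    (fun (e : (l : Fin t) × (Fin p × Fin (n l p))) (ω : Ω) =>
      (X e.1 p ω e.2.1 e.2.2, Y e.1 p ω e.2.1 e.2.2)) P
  mean_X : ∀ l p i j, ∫ ω, X l p ω i j ∂P = 0
  mean_Y : ∀ l p i j, ∫ ω, Y l p ω i j ∂P = 0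
  var_X : ∀ l p i j, ∫ ω, (X l p ω i j) ^ 2 ∂P = 1
  var_Y : ∀ l p i j, ∫ ω, (Y l p ω i j) ^ 2 ∂P = 1
  corr : ∀ l p i j, ∫ ω, X l p ω i j * Y l p ω i j ∂P = ρ l
  /-- Moments of every order are finite and bounded uniformly in `p`, `n_l`, `i`, `j`. -/
  moments : ∀ l, ∀ k : ℕ, 1 ≤ k → ∃ B : ℝ, ∀ p i j,
    Integrable (fun ω => |X l p ω i j| ^ k) P ∧ Integrable (fun ω => |Y l p ω i j| ^ k) P ∧
      ∫ ω, (|X l p ω i j| ^ k + |Y l p ω i j| ^ k) ∂P < B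

end CrossCov

end

open MeasureTheory ProbabilityTheory Filter Topology
open scoped ENNReal ComplexOrder

noncomputable section

namespace CrossCov

/-! ### Closed walks that use every edge at least twice -/

section Walks

variable {V : Type*}

/-! The proof is the method of moments. The normalized trace of a word of length `k` in the `C_l`
and their adjoints expands into products of entries along closed walks `i₀ j₀ i₁ j₁ … i_k = i₀` of
`2k` steps between the rows and the columns of all `X_l, Y_l`. Entries on different edges are
independent and centred, so a walk contributes to the mean only if it passes each of its edges at
least twice; it then has at most `k` edges and, being connected, at most `k + 1` vertices
(`double_cover`). The normalization is of order `p ^ -(k + 1)`, so only walks with `k + 1` vertices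
survive: their graphs are trees, with each edge passed exactly twice.

In such a walk the level sets of the `j`-steps form a non-crossing partition `τ`, and on leaving a
column for the last time the walk returns to the row from which it first came
(`TreeWalk.noncrossing`, `TreeWalk.last_edge`). Conversely `τ` dictates which steps share an edge:
the step out of the column at `u` and the step into it at the cyclically next element of the block.
That edge contributes `ρ_l` if the exponents of the two letters agree and `1` otherwise. A block of
`s` letters, all of colour `l`, contributes `(n_l / p) (p / n_l) ^ s → y_l ^ (s - 1)`; a block with
two colours contributes nothing. The limit moment is therefore `mom`, a sum over `NC(k)` of products
of `cum`, and Moebius inversion (`freeCumulant_eq`) shows that `cum` is the free cumulant. Freeness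
and the cross-covariance formula are both read off from it.

Two walks with non-zero covariance share an edge and have at most `2k` vertices together
(`card_le_of_two_walks`), so the variance of a normalized trace is `O(p ^ -2)`, which is summable;
this gives almost sure convergence.

The limit space consists of the polynomials in the matrices along one good realization, with the
limiting trace as state, modulo the kernel of that trace (`exists_limit_model`). Dividing by the
kernel is what turns eventual symmetry into self-adjointness. Since `|NC(k)| ≤ 4 ^ k`, moments grow
at most exponentially (`abs_mom_le`, `StarPoly.exists_moment_bound`). A limit point of the spectral
distributions is then a compactly supported law with these moments
(`exists_law_of_tendsto_moments`), and a Taylor expansion of characteristic functions gives both its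
uniqueness and the weak convergence (`tendsto_of_tendsto_moments`). -/

theorem double_cover [Fintype V] {T : Type*} [Fintype T] (e : T → Sym2 V) (hnd : ∀ t, ¬ (e t).IsDiag)
    (hconn : (SimpleGraph.fromEdgeSet (Set.range e)).Connected)
    (hdbl : ∀ t, ∃ t', t' ≠ t ∧ e t' = e t) :
    2 * Fintype.card V ≤ Fintype.card T + 2 ∧
      (Fintype.card T + 2 ≤ 2 * Fintype.card V →
        (∀ a b c, e a = e b → e b = e c → a = b ∨ b = c ∨ a = c) ∧
        ∀ t x y, e t = s(x, y) →
          ¬ ((SimpleGraph.fromEdgeSet (Set.range e)).deleteEdges {e t}).Reachable x y) := by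
  classical
  set G := SimpleGraph.fromEdgeSet (Set.range e) with hG
  have hset : G.edgeSet = Set.range e := by
    rw [hG, SimpleGraph.edgeSet_fromEdgeSet]
    ext x
    simp only [Set.mem_sdiff, Set.mem_range]
    constructor
    · exact fun h => h.1
    · rintro ⟨t, rfl⟩
      exact ⟨⟨t, rfl⟩, hnd t⟩
  have hcardE : Nat.card G.edgeSet = (Finset.univ.image e).card := by
    rw [hset, Nat.card_coe_set_eq, ← Set.ncard_coe_finset]
    congr 1
    simp
  have hfib : ∀ x ∈ Finset.univ.image e, 2 ≤ (Finset.univ.filter fun t => e t = x).card := by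
    intro x hx
    obtain ⟨t, -, rfl⟩ := Finset.mem_image.1 hx
    obtain ⟨t', h1, h2⟩ := hdbl t
    exact Finset.one_lt_card.2 ⟨t, by simp, t', by simp [h2], h1.symm⟩
  have hsum : Fintype.card T
      = ∑ x ∈ Finset.univ.image e, (Finset.univ.filter fun t => e t = x).card :=
    Finset.card_eq_sum_card_image e Finset.univ
  -- Every edge carries at least two indices, while a connected graph has at least `|V| - 1` edges.
  have hle : 2 * (Finset.univ.image e).card ≤ Fintype.card T := by
    rw [hsum, mul_comm, ← smul_eq_mul]
    exact Finset.card_nsmul_le_sum _ _ _ hfib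
  have hV := hconn.card_vert_le_card_edgeSet_add_one
  rw [hcardE, Nat.card_eq_fintype_card] at hV
  refine ⟨by omega, fun heq => ⟨?_, ?_⟩⟩
  · intro a b c hab hbc
    by_contra hne
    push Not at hne
    have h3 : 2 < (Finset.univ.filter fun t => e t = e a).card :=
      Finset.two_lt_card.2 ⟨a, by simp, b, by simp [hab], c, by simp [hab, hbc],
        hne.1, hne.2.2, hne.2.1⟩
    have : ∑ _x ∈ Finset.univ.image e, 2
        < ∑ x ∈ Finset.univ.image e, (Finset.univ.filter fun t => e t = x).card :=
      Finset.sum_lt_sum hfib ⟨e a, by simp, h3⟩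
    rw [← hsum, Finset.sum_const, smul_eq_mul] at this
    omega
  -- In the case of equality the connected graph has exactly `|V| - 1` edges, hence is a tree, and
  -- all edges of a tree are bridges.
  · have htree : G.IsTree := by
      rw [SimpleGraph.isTree_iff_connected_and_card]
      refine ⟨hconn, ?_⟩
      rw [hcardE, Nat.card_eq_fintype_card]
      omega
    intro t x y hxy
    have h := SimpleGraph.isAcyclic_iff_forall_isBridge.1 htree.isAcyclic
      (e := e t) (by rw [hset]; exact ⟨t, rfl⟩)
    rw [hxy, SimpleGraph.isBridge_iff] at h
    rw [hxy]
    exact h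

theorem reachable_of_steps (H : SimpleGraph V) (w : ℕ → V) {a b : ℕ} (hab : a ≤ b)
    (h : ∀ s, a ≤ s → s < b → H.Adj (w s) (w (s + 1))) : H.Reachable (w a) (w b) := by
  induction b, hab using Nat.le_induction with
  | base => exact SimpleGraph.Reachable.refl _
  | succ b hab ih =>
    exact (ih fun s h1 h2 => h s h1 (by omega)).trans (h b hab (by omega)).reachable

/-- A closed walk of length `L` through all vertices that passes each of its edges at least
twice. -/
structure DoubleWalk (w : ℕ → V) (L : ℕ) : Prop where
  closed : w L = w 0
  ne : ∀ s, s < L → w s ≠ w (s + 1)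
  surj : ∀ v, ∃ s, s ≤ L ∧ w s = v
  dbl : ∀ s, s < L → ∃ s', s' < L ∧ s' ≠ s ∧ s(w s', w (s' + 1)) = s(w s, w (s + 1))

/-- The conclusions in the extremal case: every edge is passed exactly twice, and is a bridge. -/
structure TreeWalk (w : ℕ → V) (L : ℕ) : Prop extends DoubleWalk w L where
  twice : ∀ a b c, a < L → b < L → c < L → s(w a, w (a + 1)) = s(w b, w (b + 1)) →
    s(w b, w (b + 1)) = s(w c, w (c + 1)) → a = b ∨ b = c ∨ a = c
  bridge : ∃ G : SimpleGraph V, (∀ s, s < L → G.Adj (w s) (w (s + 1))) ∧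
    ∀ s x y, s < L → s(w s, w (s + 1)) = s(x, y) →
      ¬ (G.deleteEdges {s(w s, w (s + 1))}).Reachable x y

theorem DoubleWalk.card_le [Fintype V] {w : ℕ → V} {L : ℕ} (h : DoubleWalk w L) :
    2 * Fintype.card V ≤ L + 2 ∧ (L + 2 ≤ 2 * Fintype.card V → TreeWalk w L) := by
  have hadj : ∀ s, s < L → (SimpleGraph.fromEdgeSet
      (Set.range fun s : Fin L => s(w s, w (s + 1)))).Adj (w s) (w (s + 1)) := by
    intro s hs
    rw [SimpleGraph.fromEdgeSet_adj]
    exact ⟨⟨⟨s, hs⟩, rfl⟩, h.ne s hs⟩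
  have key := double_cover (fun s : Fin L => s(w s, w (s + 1)))
    (fun t => by simpa using h.ne t t.2)
    (by
      have : Nonempty V := ⟨w 0⟩
      refine SimpleGraph.Connected.mk fun x y => ?_
      have : ∀ v, (SimpleGraph.fromEdgeSet
          (Set.range fun s : Fin L => s(w s, w (s + 1)))).Reachable (w 0) v := by
        intro v
        obtain ⟨s, hs, rfl⟩ := h.surj v
        exact reachable_of_steps _ w (Nat.zero_le s) fun u _ hu => hadj u (by omega)
      exact (this x).symm.trans (this y))
    (fun t => by
      obtain ⟨s', h1, h2, h3⟩ := h.dbl t t.2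
      exact ⟨⟨s', h1⟩, fun hh => h2 (congrArg Fin.val hh), h3⟩)
  rw [Fintype.card_fin] at key
  refine ⟨key.1, fun heq => ?_⟩
  obtain ⟨k1, k2⟩ := key.2 heq
  refine { h with twice := ?_, bridge := ⟨_, hadj, ?_⟩ }
  · intro a b c ha hb hc hab hbc
    have := k1 ⟨a, ha⟩ ⟨b, hb⟩ ⟨c, hc⟩ hab hbc
    simpa using this
  · intro s x y hs hxy
    exact k2 ⟨s, hs⟩ x y hxy

variable {w : ℕ → V} {L : ℕ}

theorem adj_deleteEdges {G : SimpleGraph V} {e : Sym2 V} {x y : V} (h : G.Adj x y)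
    (hne : s(x, y) ≠ e) : (G.deleteEdges {e}).Adj x y := by
  rw [SimpleGraph.deleteEdges_adj]
  exact ⟨h, by simpa using hne⟩

/-- The walk leaves a vertex for the last time by the edge by which it first reached it. -/
theorem TreeWalk.last_edge (h : TreeWalk w L) {m M : ℕ} (hm : m < M) (hM : M < L)
    (hw : w (m + 1) = w M) (hmin : ∀ s, s ≤ m → w s ≠ w M) (hmax : ∀ s, M < s → s ≤ L → w s ≠ w M) :
    w (M + 1) = w m := by
  obtain ⟨G, hG, hbr⟩ := h.bridge
  -- Otherwise the edge left at time `M` is used neither after `M`, as the walk never returns to `w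
  -- M`, nor up to time `m + 1`. These two stretches, glued at `w L = w 0`, join the ends of a
  -- bridge without using it.
  by_contra hne
  refine hbr M (w (M + 1)) (w M) (by omega) Sym2.eq_swap ?_
  have h1 : (G.deleteEdges {s(w M, w (M + 1))}).Reachable (w (M + 1)) (w L) := by
    refine reachable_of_steps _ w (by omega) fun s hs1 hs2 =>
      adj_deleteEdges (hG s (by omega)) ?_
    rw [Ne, Sym2.eq_iff, not_or]
    exact ⟨fun hh => hmax s (by omega) (by omega) hh.1,
      fun hh => hmax (s + 1) (by omega) (by omega) hh.2⟩
  have h2 : (G.deleteEdges {s(w M, w (M + 1))}).Reachable (w 0) (w (m + 1)) := by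
    refine reachable_of_steps _ w (by omega) fun s hs1 hs2 =>
      adj_deleteEdges (hG s (by omega)) ?_
    rw [Ne, Sym2.eq_iff, not_or]
    refine ⟨fun hh => hmin s (by omega) hh.1, fun hh => ?_⟩
    rcases Nat.lt_or_ge s m with hsb | hsb
    · exact hmin (s + 1) (by omega) hh.2
    · have : s = m := by omega
      subst this
      exact hne hh.1.symm
  rw [h.closed] at h1
  have := h1.trans h2
  rwa [hw] at this

/-- The edge by which the walk leaves `w a` for the last time before `b` is a bridge separating `w
a` from `w b`. It must be crossed again between `b` and `c` and once more between `c` and `d`, so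
three times in all. -/
theorem TreeWalk.noncrossing (h : TreeWalk w L) {a b c d : ℕ} (hab : a < b) (hbc : b < c)
    (hcd : c < d) (hd : d ≤ L) (hac : w a = w c) (hbd : w b = w d) : w a = w b := by
  classical
  obtain ⟨G, hG, hbr⟩ := h.bridge
  by_contra hne
  -- the last visit to `w a` before time `b`
  obtain ⟨a', ⟨ha1, ha2, ha3⟩, hmax⟩ :
      ∃ a', (a ≤ a' ∧ a' < b ∧ w a' = w a) ∧ ∀ s, a' < s → s < b → w s ≠ w a := by
    let S := (Finset.range b).filter fun s => a ≤ s ∧ w s = w a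
    have hS : S.Nonempty := ⟨a, by simp [S, hab]⟩
    have hm := Finset.mem_filter.1 (S.max'_mem hS)
    rw [Finset.mem_range] at hm
    refine ⟨S.max' hS, ⟨hm.2.1, hm.1, hm.2.2⟩, fun s h1 h2 h3 => ?_⟩
    have : s ∈ S := by
      simp only [S, Finset.mem_filter, Finset.mem_range]
      exact ⟨h2, hm.2.1.trans h1.le, h3⟩
    exact absurd (S.le_max' s this) (not_le.2 h1)
  set e := s(w a', w (a' + 1)) with he
  have hzb : (G.deleteEdges {e}).Reachable (w (a' + 1)) (w b) := by
    refine reachable_of_steps _ w (by omega) fun s hs1 hs2 =>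
      adj_deleteEdges (hG s (by omega)) ?_
    rw [he, Ne, Sym2.eq_iff, not_or, ha3]
    refine ⟨fun hh => hmax s (by omega) (by omega) hh.1, fun hh => ?_⟩
    rcases Nat.lt_or_ge (s + 1) b with hsb | hsb
    · exact hmax (s + 1) (by omega) (by omega) hh.2
    · have : s + 1 = b := by omega
      rw [this] at hh
      exact hne hh.2.symm
  have hsep : ¬ (G.deleteEdges {e}).Reachable (w a) (w b) := by
    intro hr
    have h1 := hr.trans hzb.symm
    rw [← ha3] at h1
    exact hbr a' (w a') (w (a' + 1)) (by omega) rfl h1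
  have huse : ∀ u v, u ≤ v → v ≤ L → ¬ (G.deleteEdges {e}).Reachable (w u) (w v) →
      ∃ s, u ≤ s ∧ s < v ∧ e = s(w s, w (s + 1)) := by
    intro u v huv hv hnr
    by_contra hcon
    push Not at hcon
    exact hnr (reachable_of_steps _ w huv fun s hs1 hs2 =>
      adj_deleteEdges (hG s (by omega)) (hcon s hs1 hs2).symm)
  obtain ⟨s1, h11, h12, h13⟩ := huse b c hbc.le (by omega) fun hr => hsep (by
    rw [hac]; exact hr.symm)
  obtain ⟨s2, h21, h22, h23⟩ := huse c d hcd.le (by omega) fun hr => hsep (by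
    rw [hac, hbd]; exact hr)
  have := h.twice a' s1 s2 (by omega) (by omega) (by omega) (he ▸ h13) (h13 ▸ h23)
  omega

end Walks

/-- Two closed walks that share an edge and together pass every edge at least twice have too few
vertices to form a tree. -/
theorem card_le_of_two_walks {V : Type*} [Fintype V] {w w' : ℕ → V} {L L' : ℕ}
    (hc : w L = w 0) (hne : ∀ s, s < L → w s ≠ w (s + 1))
    (hne' : ∀ s, s < L' → w' s ≠ w' (s + 1))
    (hsurj : ∀ v, (∃ s, s ≤ L ∧ w s = v) ∨ ∃ s, s ≤ L' ∧ w' s = v)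
    (hdbl : ∀ s, s < L → (∃ s', s' < L ∧ s' ≠ s ∧ s(w s', w (s' + 1)) = s(w s, w (s + 1))) ∨
      ∃ s', s' < L' ∧ s(w' s', w' (s' + 1)) = s(w s, w (s + 1)))
    (hdbl' : ∀ s, s < L' →
      (∃ s', s' < L' ∧ s' ≠ s ∧ s(w' s', w' (s' + 1)) = s(w' s, w' (s + 1))) ∨
      ∃ s', s' < L ∧ s(w s', w (s' + 1)) = s(w' s, w' (s + 1)))
    (hshare : ∃ s s', s < L ∧ s' < L' ∧ s(w s, w (s + 1)) = s(w' s', w' (s' + 1))) :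
    2 * Fintype.card V < L + L' + 2 := by
  let e : Fin L ⊕ Fin L' → Sym2 V :=
    Sum.elim (fun s => s(w s, w (s + 1))) (fun s => s(w' s, w' (s + 1)))
  have hadj : ∀ s, s < L →
      (SimpleGraph.fromEdgeSet (Set.range e)).Adj (w s) (w (s + 1)) := by
    intro s hs
    rw [SimpleGraph.fromEdgeSet_adj]
    exact ⟨⟨Sum.inl ⟨s, hs⟩, rfl⟩, hne s hs⟩
  have hadj' : ∀ s, s < L' →
      (SimpleGraph.fromEdgeSet (Set.range e)).Adj (w' s) (w' (s + 1)) := by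
    intro s hs
    rw [SimpleGraph.fromEdgeSet_adj]
    exact ⟨⟨Sum.inr ⟨s, hs⟩, rfl⟩, hne' s hs⟩
  obtain ⟨σ, σ', hσ, hσ', hσσ'⟩ := hshare
  have hr : ∀ s, s ≤ L → (SimpleGraph.fromEdgeSet (Set.range e)).Reachable (w 0) (w s) :=
    fun s hs => reachable_of_steps _ w (Nat.zero_le s) fun u _ hu => hadj u (by omega)
  have hr' : ∀ s, s ≤ L' → (SimpleGraph.fromEdgeSet (Set.range e)).Reachable (w' 0) (w' s) :=
    fun s hs => reachable_of_steps _ w' (Nat.zero_le s) fun u _ hu => hadj' u (by omega)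
  have h00 : (SimpleGraph.fromEdgeSet (Set.range e)).Reachable (w 0) (w' 0) := by
    rcases Sym2.eq_iff.1 hσσ' with ⟨h1, -⟩ | ⟨h1, -⟩
    · exact (hr σ hσ.le).trans (h1 ▸ (hr' σ' hσ'.le).symm)
    · exact (hr σ hσ.le).trans (h1 ▸ (hr' (σ' + 1) hσ').symm)
  have key := double_cover e
    (by rintro (s | s)
        · simpa [e] using hne s s.2
        · simpa [e] using hne' s s.2)
    (by
      have : Nonempty V := ⟨w 0⟩
      refine SimpleGraph.Connected.mk fun x y => ?_
      have : ∀ v, (SimpleGraph.fromEdgeSet (Set.range e)).Reachable (w 0) v := by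
        intro v
        obtain ⟨s, hs, rfl⟩ | ⟨s, hs, rfl⟩ := hsurj v
        · exact hr s hs
        · exact h00.trans (hr' s hs)
      exact (this x).symm.trans (this y))
    (by
      rintro (s | s)
      · obtain ⟨s', h1, h2, h3⟩ | ⟨s', h1, h3⟩ := hdbl s s.2
        · exact ⟨Sum.inl ⟨s', h1⟩, fun hh => h2 (congrArg Fin.val (Sum.inl.inj hh)), h3⟩
        · exact ⟨Sum.inr ⟨s', h1⟩, by simp, h3⟩
      · obtain ⟨s', h1, h2, h3⟩ | ⟨s', h1, h3⟩ := hdbl' s s.2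
        · exact ⟨Sum.inr ⟨s', h1⟩, fun hh => h2 (congrArg Fin.val (Sum.inr.inj hh)), h3⟩
        · exact ⟨Sum.inl ⟨s', h1⟩, by simp, h3⟩)
  rw [Fintype.card_sum, Fintype.card_fin, Fintype.card_fin] at key
  by_contra hcon
  obtain ⟨k1, k2⟩ := key.2 (by omega)
  -- each closed walk passes the shared bridge at least twice
  have h2 : ∃ s, s < L ∧ s ≠ σ ∧ s(w s, w (s + 1)) = s(w σ, w (σ + 1)) := by
    by_contra hno
    push Not at hno
    refine k2 (Sum.inl ⟨σ, hσ⟩) (w (σ + 1)) (w σ) Sym2.eq_swap ?_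
    have r1 : ((SimpleGraph.fromEdgeSet (Set.range e)).deleteEdges {e (Sum.inl ⟨σ, hσ⟩)}).Reachable
        (w (σ + 1)) (w L) :=
      reachable_of_steps _ w (by omega) fun s hs1 hs2 =>
        adj_deleteEdges (hadj s hs2) (hno s hs2 (by omega))
    have r2 : ((SimpleGraph.fromEdgeSet (Set.range e)).deleteEdges {e (Sum.inl ⟨σ, hσ⟩)}).Reachable
        (w 0) (w σ) :=
      reachable_of_steps _ w (by omega) fun s hs1 hs2 =>
        adj_deleteEdges (hadj s (by omega)) (hno s (by omega) (by omega))
    rw [hc] at r1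
    exact r1.trans r2
  obtain ⟨s, hs, hsσ, hse⟩ := h2
  -- Two passages by the first walk and one by the second exceed the two that the extremal case
  -- allows.
  have := k1 (Sum.inl ⟨s, hs⟩) (Sum.inl ⟨σ, hσ⟩) (Sum.inr ⟨σ', hσ'⟩) hse hσσ'
  simp [hsσ] at this

/-! ### Bipartite closed walks `i 0, j 0, i 1, j 1, …, i k = i 0` -/

section Bipartite

variable {I J : Type*} {k k' : ℕ}

/-- The edge between `i u` and `j u` (slot `(u, false)`) or between `j u` and `i (u + 1)`
(slot `(u, true)`). -/
def slotEdge (i : Fin (k + 1) → I) (j : Fin k → J) (σ : Fin k × Bool) : I × J :=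
  (i (if σ.2 then σ.1.succ else σ.1.castSucc), j σ.1)

/-- Every edge of the walk is used by at least two slots. -/
def IsDouble (i : Fin (k + 1) → I) (j : Fin k → J) : Prop :=
  ∀ σ, ∃ σ', σ' ≠ σ ∧ slotEdge i j σ' = slotEdge i j σ

def walkFun (i : Fin (k + 1) → I) (j : Fin k → J) : Fin (k + 1) ⊕ Fin k → I ⊕ J :=
  Sum.map i j

/-- The vertices visited by the walk. -/
def verts [DecidableEq I] [DecidableEq J] (i : Fin (k + 1) → I) (j : Fin k → J) :
    Finset (I ⊕ J) :=
  Finset.univ.image (walkFun i j)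

/-- Time `2u` is at `i u` and time `2u + 1` at `j u`. Values after time `2k` are arbitrary, but are
still vertices of the walk, so that `walkAt_mem` needs no bound on `s`. -/
def walkAt (i : Fin (k + 1) → I) (j : Fin k → J) (s : ℕ) : I ⊕ J :=
  if h : s % 2 = 1 ∧ s / 2 < k then Sum.inr (j ⟨s / 2, h.2⟩)
  else Sum.inl (i (Fin.ofNat (k + 1) (s / 2)))

theorem walkAt_odd (i : Fin (k + 1) → I) (j : Fin k → J) (u : Fin k) :
    walkAt i j (2 * u + 1) = Sum.inr (j u) := by
  have h : (2 * (u : ℕ) + 1) % 2 = 1 ∧ (2 * (u : ℕ) + 1) / 2 < k := by omega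
  rw [walkAt, dif_pos h]
  congr 2
  ext
  simp only
  omega

theorem walkAt_even (i : Fin (k + 1) → I) (j : Fin k → J) (u : Fin (k + 1)) :
    walkAt i j (2 * u) = Sum.inl (i u) := by
  rw [walkAt, dif_neg (by omega)]
  congr 2
  ext
  simp only [Fin.ofNat]
  rw [Nat.mod_eq_of_lt] <;> omega

def slotTime (σ : Fin k × Bool) : ℕ := 2 * σ.1 + (if σ.2 then 1 else 0)

theorem slotTime_lt (σ : Fin k × Bool) : slotTime σ < 2 * k := by
  rcases σ with ⟨u, b⟩
  cases b <;> simp [slotTime] <;> omega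

theorem slotTime_injective : Function.Injective (slotTime (k := k)) := by
  rintro ⟨u, b⟩ ⟨u', b'⟩ h
  cases b <;> cases b' <;> simp [slotTime, Prod.ext_iff, Fin.ext_iff] at h ⊢ <;> omega

theorem exists_slotTime {s : ℕ} (hs : s < 2 * k) : ∃ σ : Fin k × Bool, slotTime σ = s := by
  rcases Nat.mod_two_eq_zero_or_one s with h | h
  · exact ⟨(⟨s / 2, by omega⟩, false), by simp [slotTime]; omega⟩
  · exact ⟨(⟨s / 2, by omega⟩, true), by simp [slotTime]; omega⟩

theorem walkAt_step (i : Fin (k + 1) → I) (j : Fin k → J) (σ : Fin k × Bool) :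
    s(walkAt i j (slotTime σ), walkAt i j (slotTime σ + 1)) =
      s(Sum.inl (slotEdge i j σ).1, Sum.inr (slotEdge i j σ).2) := by
  rcases σ with ⟨u, b⟩
  cases b
  · have h1 := walkAt_even i j u.castSucc
    rw [Fin.val_castSucc] at h1
    simp only [slotTime, Bool.false_eq_true, if_false, add_zero, slotEdge]
    rw [walkAt_odd, h1]
  · have h1 := walkAt_even i j u.succ
    rw [Fin.val_succ, mul_add, mul_one] at h1
    simp only [slotTime, if_true, slotEdge]
    rw [walkAt_odd, show 2 * (u : ℕ) + 1 + 1 = 2 * u + 2 by ring, h1, Sym2.eq_swap]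

theorem walkAt_step_eq_iff (i : Fin (k + 1) → I) (j : Fin k → J) (i' : Fin (k' + 1) → I)
    (j' : Fin k' → J) (σ : Fin k × Bool) (σ' : Fin k' × Bool) :
    s(walkAt i j (slotTime σ), walkAt i j (slotTime σ + 1)) =
      s(walkAt i' j' (slotTime σ'), walkAt i' j' (slotTime σ' + 1)) ↔
    slotEdge i j σ = slotEdge i' j' σ' := by
  rw [walkAt_step, walkAt_step, Sym2.eq_iff]
  simp [Prod.ext_iff]

theorem walkAt_ne (i : Fin (k + 1) → I) (j : Fin k → J) {s : ℕ} (hs : s < 2 * k) :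
    walkAt i j s ≠ walkAt i j (s + 1) := by
  obtain ⟨σ, rfl⟩ := exists_slotTime hs
  intro h
  have h1 := walkAt_step i j σ
  rw [h, Sym2.eq_iff] at h1
  rcases h1 with ⟨h1, h2⟩ | ⟨h1, h2⟩ <;> rw [h1] at h2 <;> simp at h2

theorem walkAt_closed {i : Fin (k + 1) → I} (j : Fin k → J) (h : i (Fin.last k) = i 0) :
    walkAt i j (2 * k) = walkAt i j 0 := by
  have h1 := walkAt_even i j (Fin.last k)
  have h2 := walkAt_even i j 0
  simp only [Fin.val_last, Fin.val_zero, mul_zero] at h1 h2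
  rw [h1, h2, h]

variable [DecidableEq I] [DecidableEq J]

theorem walkAt_mem (i : Fin (k + 1) → I) (j : Fin k → J) (s : ℕ) : walkAt i j s ∈ verts i j := by
  rw [verts, Finset.mem_image, walkAt]
  split_ifs with h
  · exact ⟨Sum.inr _, Finset.mem_univ _, rfl⟩
  · exact ⟨Sum.inl _, Finset.mem_univ _, rfl⟩

theorem exists_walkAt {i : Fin (k + 1) → I} {j : Fin k → J} {v : I ⊕ J} (hv : v ∈ verts i j) :
    ∃ s, s ≤ 2 * k ∧ walkAt i j s = v := by
  obtain ⟨u | u, -, rfl⟩ := Finset.mem_image.1 hv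
  · exact ⟨2 * u, by omega, walkAt_even i j u⟩
  · exact ⟨2 * u + 1, by omega, walkAt_odd i j u⟩

/-- The walk with values in a set of vertices that contains all those it visits. -/
def walkIn {S : Finset (I ⊕ J)} (i : Fin (k + 1) → I) (j : Fin k → J) (h : verts i j ⊆ S)
    (s : ℕ) : {x // x ∈ S} := ⟨walkAt i j s, h (walkAt_mem i j s)⟩

theorem walkIn_step_eq_iff {S : Finset (I ⊕ J)} {i : Fin (k + 1) → I} {j : Fin k → J}
    {i' : Fin (k' + 1) → I} {j' : Fin k' → J} (h : verts i j ⊆ S) (h' : verts i' j' ⊆ S)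
    (σ : Fin k × Bool) (σ' : Fin k' × Bool) :
    s(walkIn i j h (slotTime σ), walkIn i j h (slotTime σ + 1)) =
      s(walkIn i' j' h' (slotTime σ'), walkIn i' j' h' (slotTime σ' + 1)) ↔
    slotEdge i j σ = slotEdge i' j' σ' := by
  rw [← walkAt_step_eq_iff, Sym2.eq_iff, Sym2.eq_iff]
  simp [walkIn, Subtype.ext_iff]

theorem doubleWalk {i : Fin (k + 1) → I} {j : Fin k → J} (hcl : i (Fin.last k) = i 0)
    (hd : IsDouble i j) : DoubleWalk (walkIn i j (Finset.Subset.refl _)) (2 * k) where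
  closed := Subtype.ext (walkAt_closed j hcl)
  ne s hs h := walkAt_ne i j hs (congrArg Subtype.val h)
  surj := by
    rintro ⟨v, hv⟩
    obtain ⟨s, hs, h⟩ := exists_walkAt hv
    exact ⟨s, hs, Subtype.ext h⟩
  dbl s hs := by
    obtain ⟨σ, rfl⟩ := exists_slotTime hs
    obtain ⟨σ', h1, h2⟩ := hd σ
    exact ⟨slotTime σ', slotTime_lt _, fun h => h1 (slotTime_injective h),
      (walkIn_step_eq_iff _ _ _ _).2 h2⟩

/-- With `2k` steps, having more than `k` vertices is the case of equality in `DoubleWalk.card_le`;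
for double walks the condition `k < (verts i j).card` thus singles out the trees. -/
theorem IsDouble.treeWalk {i : Fin (k + 1) → I} {j : Fin k → J}
    (hcl : i (Fin.last k) = i 0) (hd : IsDouble i j) (hk : k < (verts i j).card) :
    TreeWalk (walkIn i j (Finset.Subset.refl _)) (2 * k) :=
  (doubleWalk hcl hd).card_le.2 (by rw [Fintype.card_coe]; omega)

theorem IsDouble.twice {i : Fin (k + 1) → I} {j : Fin k → J}
    (hcl : i (Fin.last k) = i 0) (hd : IsDouble i j) (hk : k < (verts i j).card)
    {a b c : Fin k × Bool} (hab : slotEdge i j a = slotEdge i j b)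
    (hbc : slotEdge i j b = slotEdge i j c) : a = b ∨ b = c ∨ a = c := by
  have := (hd.treeWalk hcl hk).twice (slotTime a) (slotTime b) (slotTime c) (slotTime_lt _)
    (slotTime_lt _) (slotTime_lt _) ((walkIn_step_eq_iff _ _ _ _).2 hab)
    ((walkIn_step_eq_iff _ _ _ _).2 hbc)
  simpa only [slotTime_injective.eq_iff] using this

theorem IsDouble.noncrossing {i : Fin (k + 1) → I} {j : Fin k → J}
    (hcl : i (Fin.last k) = i 0) (hd : IsDouble i j) (hk : k < (verts i j).card)
    {a b c d : Fin k} (hab : a < b) (hbc : b < c) (hcd : c < d) (hac : j a = j c)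
    (hbd : j b = j d) : j a = j b := by
  have := (hd.treeWalk hcl hk).noncrossing (a := 2 * a + 1) (b := 2 * b + 1) (c := 2 * c + 1)
    (d := 2 * d + 1) (by simpa using hab) (by simpa using hbc) (by simpa using hcd) (by omega)
    (Subtype.ext (by simp only [walkIn, walkAt_odd, hac]))
    (Subtype.ext (by simp only [walkIn, walkAt_odd, hbd]))
  simpa [walkIn, walkAt_odd] using this

/-- This is `TreeWalk.last_edge` at the column `j u`, first entered from `i m` at time `2m + 1` and
left for good towards `i (u + 1)` after time `2u + 1`. -/
theorem IsDouble.last_edge {i : Fin (k + 1) → I} {j : Fin k → J}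
    (hcl : i (Fin.last k) = i 0) (hd : IsDouble i j) (hk : k < (verts i j).card)
    {m u : Fin k} (hmu : m ≤ u) (hj : j m = j u) (hmin : ∀ v, v < m → j v ≠ j u)
    (hmax : ∀ v, u < v → j v ≠ j u) : i u.succ = i m.castSucc := by
  have key : ∀ s, walkAt i j s = Sum.inr (j u) → ∃ v : Fin k, s = 2 * v + 1 ∧ j v = j u := by
    intro s hs
    rw [walkAt] at hs
    split_ifs at hs with h
    refine ⟨⟨s / 2, h.2⟩, ?_, Sum.inr.inj hs⟩
    simp only
    omega
  have := (hd.treeWalk hcl hk).last_edge (m := 2 * m) (M := 2 * u + 1)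
    (by have : (m : ℕ) ≤ u := hmu; omega) (by omega)
    (Subtype.ext (by simp only [walkIn, walkAt_odd, hj]))
    (by
      intro s hs h
      have h := congrArg Subtype.val h
      simp only [walkIn, walkAt_odd] at h
      obtain ⟨v, rfl, hv⟩ := key s h
      exact hmin v (by rw [Fin.lt_def]; omega) hv)
    (by
      intro s hs _ h
      have h := congrArg Subtype.val h
      simp only [walkIn, walkAt_odd] at h
      obtain ⟨v, rfl, hv⟩ := key s h
      exact hmax v (by rw [Fin.lt_def]; omega) hv)
  have h := congrArg Subtype.val this
  have h1 := walkAt_even i j u.succ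
  have h2 := walkAt_even i j m.castSucc
  rw [Fin.val_succ, mul_add, mul_one] at h1
  rw [Fin.val_castSucc] at h2
  simp only [walkIn] at h
  rw [show 2 * (u : ℕ) + 1 + 1 = 2 * u + 2 by ring, h1, h2] at h
  exact Sum.inl.inj h

/-- The source of the small variance: two tree walks with no common vertex have `k + k' + 2`
vertices, so sharing an edge costs two powers of the dimension. -/
theorem card_verts_union_le {i : Fin (k + 1) → I} {j : Fin k → J} {i' : Fin (k' + 1) → I}
    {j' : Fin k' → J} (hcl : i (Fin.last k) = i 0)
    (hd : ∀ σ, (∃ σ', σ' ≠ σ ∧ slotEdge i j σ' = slotEdge i j σ) ∨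
      ∃ σ', slotEdge i' j' σ' = slotEdge i j σ)
    (hd' : ∀ σ, (∃ σ', σ' ≠ σ ∧ slotEdge i' j' σ' = slotEdge i' j' σ) ∨
      ∃ σ', slotEdge i j σ' = slotEdge i' j' σ)
    (hs : ∃ σ σ', slotEdge i j σ = slotEdge i' j' σ') :
    (verts i j ∪ verts i' j').card ≤ k + k' := by
  have h1 : verts i j ⊆ verts i j ∪ verts i' j' := Finset.subset_union_left
  have h2 : verts i' j' ⊆ verts i j ∪ verts i' j' := Finset.subset_union_right
  have := card_le_of_two_walks (w := walkIn i j h1) (w' := walkIn i' j' h2)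
    (L := 2 * k) (L' := 2 * k')
    (Subtype.ext (walkAt_closed j hcl))
    (fun s hs h => walkAt_ne i j hs (congrArg Subtype.val h))
    (fun s hs h => walkAt_ne i' j' hs (congrArg Subtype.val h))
    (by
      rintro ⟨v, hv⟩
      rcases Finset.mem_union.1 hv with hv' | hv'
      · obtain ⟨s, hs, h⟩ := exists_walkAt hv'
        exact Or.inl ⟨s, hs, Subtype.ext h⟩
      · obtain ⟨s, hs, h⟩ := exists_walkAt hv'
        exact Or.inr ⟨s, hs, Subtype.ext h⟩)
    (by
      intro s hs
      obtain ⟨σ, rfl⟩ := exists_slotTime hs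
      rcases hd σ with ⟨σ', h1, h2⟩ | ⟨σ', h2⟩
      · exact Or.inl ⟨slotTime σ', slotTime_lt _, fun h => h1 (slotTime_injective h),
          (walkIn_step_eq_iff _ _ _ _).2 h2⟩
      · exact Or.inr ⟨slotTime σ', slotTime_lt _, (walkIn_step_eq_iff _ _ _ _).2 h2⟩)
    (by
      intro s hs
      obtain ⟨σ, rfl⟩ := exists_slotTime hs
      rcases hd' σ with ⟨σ', h1, h2⟩ | ⟨σ', h2⟩
      · exact Or.inl ⟨slotTime σ', slotTime_lt _, fun h => h1 (slotTime_injective h),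
          (walkIn_step_eq_iff _ _ _ _).2 h2⟩
      · exact Or.inr ⟨slotTime σ', slotTime_lt _, (walkIn_step_eq_iff _ _ _ _).2 h2⟩)
    (by
      obtain ⟨σ, σ', h⟩ := hs
      exact ⟨slotTime σ, slotTime σ', slotTime_lt _, slotTime_lt _,
        (walkIn_step_eq_iff _ _ _ _).2 h⟩)
  rw [Fintype.card_coe] at this
  omega

end Bipartite

/-! ### Cyclic successors in blocks -/

section Next

variable {α : Type*} [LinearOrder α]

/-- The cyclic successor of `u` in `V`. -/
def nxtIn (V : Finset α) (u : α) : α :=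
  if h : (V.filter (u < ·)).Nonempty then (V.filter (u < ·)).min' h
  else if h' : V.Nonempty then V.min' h' else u

theorem nxtIn_mem {V : Finset α} {u : α} (hu : u ∈ V) : nxtIn V u ∈ V := by
  rw [nxtIn]
  split_ifs with h h'
  · exact (Finset.mem_filter.1 (Finset.min'_mem _ h)).1
  · exact Finset.min'_mem _ h'
  · exact hu

theorem nxtIn_of_lt {V : Finset α} {u v : α} (hv : v ∈ V) (huv : u < v) :
    u < nxtIn V u ∧ ∀ x ∈ V, u < x → nxtIn V u ≤ x := by
  have h : (V.filter (u < ·)).Nonempty := ⟨v, Finset.mem_filter.2 ⟨hv, huv⟩⟩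
  rw [nxtIn, dif_pos h]
  exact ⟨(Finset.mem_filter.1 (Finset.min'_mem _ h)).2,
    fun x hx hux => Finset.min'_le _ _ (Finset.mem_filter.2 ⟨hx, hux⟩)⟩

theorem nxtIn_of_max {V : Finset α} {u : α} (hu : u ∈ V) (hmax : ∀ x ∈ V, x ≤ u) :
    ∀ x ∈ V, nxtIn V u ≤ x := by
  have h : ¬ (V.filter (u < ·)).Nonempty := by
    rintro ⟨v, hv⟩
    rw [Finset.mem_filter] at hv
    exact absurd (hmax v hv.1) (not_le.2 hv.2)
  rw [nxtIn, dif_neg h, dif_pos ⟨u, hu⟩]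
  exact fun x hx => Finset.min'_le _ _ hx

theorem nxtIn_injOn (V : Finset α) : Set.InjOn (nxtIn V) V := by
  have key : ∀ u ∈ V, ∀ u' ∈ V, u < u' → nxtIn V u ≠ nxtIn V u' := by
    intro u hu u' hu' hlt heq
    -- The successor of `u` lies in `(u, u']`. That of `u'` is either beyond `u'` or, if `u'` is the
    -- maximum, the minimum of `V`, which is at most `u`.
    obtain ⟨h1, h2⟩ := nxtIn_of_lt hu' hlt
    have h3 := h2 u' hu' hlt
    by_cases hx : ∃ x ∈ V, u' < x
    · obtain ⟨x, hx, hux⟩ := hx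
      have := (nxtIn_of_lt hx hux).1
      rw [← heq] at this
      exact absurd h3 (not_le.2 this)
    · push Not at hx
      have := nxtIn_of_max hu' hx u hu
      rw [← heq] at this
      exact absurd this (not_le.2 h1)
  intro u hu u' hu' heq
  rcases lt_trichotomy u u' with h | h | h
  · exact absurd heq (key u hu u' hu' h)
  · exact h
  · exact absurd heq.symm (key u' hu' u hu h)

theorem nxtIn_map {β : Type*} [LinearOrder β] (f : α ↪o β) (V : Finset α) {u : α} (hu : u ∈ V) :
    nxtIn (V.map f.toEmbedding) (f u) = f (nxtIn V u) := by
  have hmem := nxtIn_mem hu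
  have hfu : f u ∈ V.map f.toEmbedding := Finset.mem_map_of_mem f.toEmbedding hu
  have hmem' := nxtIn_mem hfu
  obtain ⟨z, hz, hzeq⟩ := Finset.mem_map.1 hmem'
  have hzeq : f z = nxtIn (V.map f.toEmbedding) (f u) := hzeq
  have hfn : f (nxtIn V u) ∈ V.map f.toEmbedding := Finset.mem_map_of_mem f.toEmbedding hmem
  rw [← hzeq]
  congr 1
  by_cases hx : ∃ x ∈ V, u < x
  · obtain ⟨x, hx, hux⟩ := hx
    obtain ⟨h1, h2⟩ := nxtIn_of_lt hx hux
    obtain ⟨h3, h4⟩ := nxtIn_of_lt (u := f u) (Finset.mem_map_of_mem f.toEmbedding hx)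
      (f.lt_iff_lt.2 hux)
    rw [← hzeq, f.lt_iff_lt] at h3
    have h5 := h4 _ hfn (f.lt_iff_lt.2 h1)
    rw [← hzeq, f.le_iff_le] at h5
    exact le_antisymm h5 (h2 z hz h3)
  · push Not at hx
    have h1 := nxtIn_of_max hu hx
    have h2 := nxtIn_of_max hfu (by
      intro y hy
      obtain ⟨x, hx', rfl⟩ := Finset.mem_map.1 hy
      exact f.le_iff_le.2 (hx x hx'))
    have h3 := h2 _ hfn
    rw [← hzeq, f.le_iff_le] at h3
    exact le_antisymm h3 (h1 z hz)

theorem nxtIn_univ_eq_finRotate {k : ℕ} (u : Fin k) :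
    nxtIn Finset.univ u = finRotate k u := by
  obtain _ | k := k
  · exact u.elim0
  rcases eq_or_ne u (Fin.last k) with rfl | hu
  · rw [finRotate_last]
    exact le_antisymm (nxtIn_of_max (Finset.mem_univ _) (fun x _ => Fin.le_last x) 0
      (Finset.mem_univ _)) (Fin.zero_le _)
  · have hlt : (u : ℕ) < k := by
      have := Fin.val_lt_last hu
      exact this
    have h2 : ((finRotate (k + 1) u : Fin (k + 1)) : ℕ) = u + 1 :=
      coe_finRotate_of_ne_last hu
    have h3 : u < finRotate (k + 1) u := by rw [Fin.lt_def, h2]; omega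
    obtain ⟨h4, h5⟩ := nxtIn_of_lt (Finset.mem_univ _) h3
    have h6 := h5 _ (Finset.mem_univ _) h3
    rw [Fin.lt_def] at h4
    rw [Fin.le_def] at h6
    ext
    omega

end Next

/-! ### Walks attached to a non-crossing partition -/

section Closing

variable {k : ℕ} {I J : Type*}

/-- The next element in the block of `u`. -/
def nxt (τ : Finpartition (Finset.univ : Finset (Fin k))) (u : Fin k) : Fin k :=
  nxtIn (τ.part u) u

variable (τ : Finpartition (Finset.univ : Finset (Fin k)))

theorem mem_part_comm {τ : Finpartition (Finset.univ : Finset (Fin k))} {u v : Fin k} :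
    v ∈ τ.part u ↔ τ.part v = τ.part u :=
  τ.mem_part_iff_part_eq_part (Finset.mem_univ _) (Finset.mem_univ _)

theorem self_mem_part (u : Fin k) : u ∈ τ.part u := mem_part_comm.2 rfl

theorem nxt_mem_part (u : Fin k) : nxt τ u ∈ τ.part u := nxtIn_mem (self_mem_part τ u)

theorem nxt_injective : Function.Injective (nxt τ) := by
  intro u v h
  have h1 := mem_part_comm.1 (nxt_mem_part τ u)
  have h2 := mem_part_comm.1 (nxt_mem_part τ v)
  rw [h, h2] at h1
  have h3 : u ∈ τ.part v := by rw [h1]; exact self_mem_part τ u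
  rw [nxt, nxt, ← h1] at h
  exact nxtIn_injOn _ h3 (self_mem_part τ v) h

theorem nxt_bijective : Function.Bijective (nxt τ) :=
  Finite.injective_iff_bijective.1 (nxt_injective τ)

/-- `i (max V + 1) = i (min V)` for all blocks `V`. -/
def IsClosing (i : Fin (k + 1) → I) : Prop :=
  ∀ m u, m ∈ τ.part u → (∀ v ∈ τ.part u, m ≤ v ∧ v ≤ u) → i u.succ = i m.castSucc

variable {τ}

theorem IsNonCrossing.part_eq (hτ : IsNonCrossing τ) {a b c d : Fin k} (hab : a < b) (hbc : b < c)
    (hcd : c < d) (hac : τ.part a = τ.part c) (hbd : τ.part b = τ.part d) :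
    τ.part a = τ.part b :=
  hτ _ (τ.part_mem.2 (Finset.mem_univ a)) _ (τ.part_mem.2 (Finset.mem_univ b)) a b c d hab hbc hcd
    (self_mem_part τ a) (mem_part_comm.2 hac.symm) (self_mem_part τ b) (mem_part_comm.2 hbd.symm)

/-- The steps in `[a, b)` form a union of blocks. The block of the last step closes at `b` and takes
`i b` back to `i m`, where `m` is its minimum; as blocks do not cross, the steps in `[a, m)` are
again a union of blocks, and induction applies. -/
theorem IsClosing.telescope (hτ : IsNonCrossing τ) {i : Fin (k + 1) → I} (hi : IsClosing τ i) :
    ∀ b a : Fin (k + 1), a ≤ b →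
      (∀ u v : Fin k, τ.part u = τ.part v → a ≤ u.castSucc → u.castSucc < b →
        a ≤ v.castSucc ∧ v.castSucc < b) → i a = i b := by
  intro b
  induction b using WellFoundedLT.induction with
  | ind b ih =>
  intro a hab hcl
  rcases hab.eq_or_lt with rfl | hlt
  · rfl
  obtain ⟨u, rfl⟩ : ∃ u : Fin k, u.succ = b :=
    ⟨b.pred (fun h => by rw [h] at hlt; exact absurd hlt (Fin.not_lt_zero a)), Fin.succ_pred _ _⟩
  have hau : a ≤ u.castSucc := Fin.le_castSucc_iff.2 hlt
  have hne : (τ.part u).Nonempty := ⟨u, self_mem_part τ u⟩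
  set m := (τ.part u).min' hne with hm
  have hmu : m ∈ τ.part u := Finset.min'_mem _ _
  have hblock : ∀ v ∈ τ.part u, a ≤ v.castSucc ∧ v ≤ u := by
    intro v hv
    obtain ⟨h1, h2⟩ := hcl u v (mem_part_comm.1 hv).symm hau Fin.castSucc_lt_succ
    exact ⟨h1, Fin.castSucc_lt_succ_iff.1 h2⟩
  have hiu := hi m u hmu fun v hv => ⟨Finset.min'_le _ _ hv, (hblock v hv).2⟩
  rw [hiu]
  refine ih m.castSucc (Fin.castSucc_lt_succ_iff.2 (hblock m hmu).2) a (hblock m hmu).1 ?_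
  intro x y hxy hax hxm
  rw [Fin.castSucc_lt_castSucc_iff] at hxm
  obtain ⟨h1, h2⟩ := hcl x y hxy hax
    (Fin.castSucc_lt_succ_iff.2 (hxm.le.trans (hblock m hmu).2))
  refine ⟨h1, ?_⟩
  rw [Fin.castSucc_lt_castSucc_iff]
  by_contra hym
  push Not at hym
  have hxV : τ.part x ≠ τ.part u := by
    intro h
    exact absurd (Finset.min'_le _ _ (mem_part_comm.2 h)) (not_le.2 hxm)
  have hym' : m ≠ y := by
    rintro rfl
    exact hxV (hxy.trans (mem_part_comm.1 hmu))
  have hyu : y ≠ u := by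
    rintro rfl
    exact hxV hxy
  have hyu' : y < u := lt_of_le_of_ne (Fin.castSucc_lt_succ_iff.1 h2) hyu
  exact hxV ((hτ.part_eq hxm (lt_of_le_of_ne hym hym') hyu' hxy (mem_part_comm.1 hmu)).trans
    (mem_part_comm.1 hmu))

theorem IsClosing.closed (hτ : IsNonCrossing τ) {i : Fin (k + 1) → I} (hi : IsClosing τ i) :
    i (Fin.last k) = i 0 :=
  (hi.telescope hτ (Fin.last k) 0 (Fin.zero_le _)
    fun _ v _ _ _ => ⟨Fin.zero_le _, Fin.castSucc_lt_last v⟩).symm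

/-- The steps strictly between `u` and its successor in the block form a union of blocks, so
`telescope` applies. At the last element of a block the claim is the closing condition itself. -/
theorem IsClosing.succ_eq_nxt (hτ : IsNonCrossing τ) {i : Fin (k + 1) → I} (hi : IsClosing τ i)
    (u : Fin k) : i u.succ = i (nxt τ u).castSucc := by
  have hN := nxt_mem_part τ u
  by_cases hx : ∃ x ∈ τ.part u, u < x
  · obtain ⟨x, hx, hux⟩ := hx
    obtain ⟨h1, h2⟩ := nxtIn_of_lt hx hux
    change u < nxt τ u at h1
    refine hi.telescope hτ _ _ (Fin.succ_le_castSucc_iff.2 h1) ?_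
    intro x y hxy hux hxN
    rw [Fin.succ_le_castSucc_iff] at hux ⊢
    rw [Fin.castSucc_lt_castSucc_iff] at hxN ⊢
    have hxV : τ.part x ≠ τ.part u := fun h =>
      absurd (h2 x (mem_part_comm.2 h) hux) (not_le.2 hxN)
    have hyV : τ.part y ≠ τ.part u := hxy ▸ hxV
    have hNu := mem_part_comm.1 hN
    constructor
    · by_contra hyu
      push Not at hyu
      have hyu' : y < u := lt_of_le_of_ne hyu fun h => hyV (h ▸ rfl)
      exact hyV (hτ.part_eq hyu' hux hxN hxy.symm hNu.symm)
    · by_contra hyN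
      push Not at hyN
      have hyN' : nxt τ u < y := lt_of_le_of_ne hyN fun h => hyV (h ▸ hNu)
      exact hxV (hτ.part_eq hux hxN hyN' hNu.symm hxy).symm
  · push Not at hx
    exact hi _ u hN fun v hv => ⟨nxtIn_of_max (self_mem_part τ u) hx v hv, hx v hv⟩

/-- The closing condition on `i`, and `j` constant on the blocks of `τ`. -/
def IsAttached (τ : Finpartition (Finset.univ : Finset (Fin k))) (i : Fin (k + 1) → I)
    (j : Fin k → J) : Prop :=
  IsClosing τ i ∧ ∀ u v, v ∈ τ.part u → j v = j u

/-- Since `nxt τ` is a permutation, this matches all `2k` slots in pairs; in the extremal case there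
are no other coincidences of edges. -/
theorem IsAttached.slotEdge_nxt (hτ : IsNonCrossing τ) {i : Fin (k + 1) → I} {j : Fin k → J}
    (h : IsAttached τ i j) (u : Fin k) :
    slotEdge i j (nxt τ u, false) = slotEdge i j (u, true) := by
  simp only [slotEdge, if_true, Bool.false_eq_true, if_false]
  rw [h.1.succ_eq_nxt hτ u, h.2 u _ (nxt_mem_part τ u)]

theorem IsAttached.isDouble (hτ : IsNonCrossing τ) {i : Fin (k + 1) → I} {j : Fin k → J}
    (h : IsAttached τ i j) : IsDouble i j := by
  rintro ⟨u, b⟩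
  cases b
  · obtain ⟨v, rfl⟩ := (nxt_bijective τ).2 u
    exact ⟨(v, true), by simp, (h.slotEdge_nxt hτ v).symm⟩
  · exact ⟨(nxt τ u, false), by simp, h.slotEdge_nxt hτ u⟩

variable [DecidableEq I] [DecidableEq J]

/-- If two of the pairs had the same edge, three different slots would share it, against
`IsDouble.twice`. -/
theorem IsAttached.slotEdge_injective (hτ : IsNonCrossing τ) {i : Fin (k + 1) → I} {j : Fin k → J}
    (h : IsAttached τ i j) (hk : k < (verts i j).card) :
    Function.Injective fun u => slotEdge i j (u, true) := by
  intro u v huv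
  have := (h.isDouble hτ).twice (h.1.closed hτ) hk (a := (nxt τ v, false)) (b := (u, true))
    (c := (v, true)) ((h.slotEdge_nxt hτ v).trans huv.symm) huv
  simpa using this

/-- An extremal walk is attached to the partition of its `j`-steps. -/
theorem IsDouble.exists_isAttached {i : Fin (k + 1) → I} {j : Fin k → J}
    (hcl : i (Fin.last k) = i 0) (hd : IsDouble i j) (hk : k < (verts i j).card) :
    ∃ τ : Finpartition (Finset.univ : Finset (Fin k)), IsNonCrossing τ ∧ IsAttached τ i j := by
  classical
  let τ : Finpartition (Finset.univ : Finset (Fin k)) := Finpartition.ofSetoid (Setoid.ker j)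
  have hrel : ∀ u v, v ∈ τ.part u ↔ j u = j v := fun u v =>
    Finpartition.mem_part_ofSetoid_iff_rel
  refine ⟨τ, ?_, ?_, fun u v h => ((hrel u v).1 h).symm⟩
  · intro V hV W hW a b c d hab hbc hcd haV hcV hbW hdW
    rw [← τ.part_eq_of_mem hV haV, ← τ.part_eq_of_mem hW hbW]
    have h1 : j a = j c := (hrel a c).1 (by rw [τ.part_eq_of_mem hV haV]; exact hcV)
    have h2 : j b = j d := (hrel b d).1 (by rw [τ.part_eq_of_mem hW hbW]; exact hdW)
    exact mem_part_comm.1 ((hrel b a).2 (hd.noncrossing hcl hk hab hbc hcd h1 h2).symm)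
  · intro m u hm hmax
    refine hd.last_edge hcl hk (hmax m hm).2 ((hrel u m).1 hm).symm ?_ ?_
    · intro v hv h
      exact absurd (hmax v ((hrel u v).2 h.symm)).1 (not_le.2 hv)
    · intro v hv h
      exact absurd (hmax v ((hrel u v).2 h.symm)).2 (not_le.2 hv)

end Closing

/-! ### Counting walks -/

section Counting

/-- A map with at most `r` values factors through `Fin r`. Applied to walks, this bounds the number
of those with few vertices. -/
theorem card_filter_card_image_le {S T : Type*} [Fintype S] [DecidableEq S] [Nonempty S]
    [Fintype T] [DecidableEq T] (r : ℕ) :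
    (Finset.univ.filter fun f : S → T => (Finset.univ.image f).card ≤ r).card
      ≤ r ^ Fintype.card S * Fintype.card T ^ r := by
  have hsub : (Finset.univ.filter fun f : S → T => (Finset.univ.image f).card ≤ r) ⊆
      (Finset.univ : Finset ((S → Fin r) × (Fin r → T))).image fun gh => gh.2 ∘ gh.1 := by
    intro f hf
    rw [Finset.mem_filter] at hf
    obtain ⟨s0⟩ := ‹Nonempty S›
    let e := (Finset.univ.image f).equivFin
    have hmem : ∀ s, f s ∈ Finset.univ.image f := fun s =>
      Finset.mem_image_of_mem f (Finset.mem_univ s)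
    -- If the image has fewer than `r` elements, the remaining values are never reached and are
    -- filled with `f s0`; this is why `S` must be nonempty.
    refine Finset.mem_image.2 ⟨(fun s => Fin.castLE hf.2 (e ⟨f s, hmem s⟩),
      fun x => if h : (x : ℕ) < (Finset.univ.image f).card then (e.symm ⟨x, h⟩ : T) else f s0),
      Finset.mem_univ _, ?_⟩
    funext s
    simp
  refine (Finset.card_le_card hsub).trans (Finset.card_image_le.trans ?_)
  simp

/-- When the coordinates are chosen in order, each step in `D` has its value forced by an earlier
coordinate and every other step is free. The product form avoids the exponent `k + 1 - |D|`. -/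
theorem card_filter_determined {α : Type*} [Fintype α] [DecidableEq α] : ∀ (k : ℕ)
    (D : Fin k → Prop) [DecidablePred D] (m : Fin k → Fin (k + 1)), (∀ u, m u ≤ u.castSucc) →
    (Finset.univ.filter fun i : Fin (k + 1) → α => ∀ u, D u → i u.succ = i (m u)).card
      * Fintype.card α ^ (Finset.univ.filter D).card = Fintype.card α ^ (k + 1) := by
  intro k
  induction k with
  | zero =>
    intro D _ m hm
    simp
  | succ k ih =>
    intro D _ m hm
    let m' : Fin k → Fin (k + 1) := fun u => (m u.castSucc).castPred (by
      have h1 := hm u.castSucc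
      intro h2
      rw [h2, Fin.le_def] at h1
      simp at h1
      omega)
    have hm' : ∀ u, (m' u).castSucc = m u.castSucc := fun u => Fin.castSucc_castPred _ _
    let D' : Fin k → Prop := fun u => D u.castSucc
    have h1 := ih D' m' (by
      intro u
      rw [← Fin.castSucc_le_castSucc_iff, hm']
      exact hm u.castSucc)
    obtain ⟨ml, hml⟩ : ∃ ml : Fin (k + 1), ml.castSucc = m (Fin.last k) := by
      refine ⟨(m (Fin.last k)).castPred ?_, Fin.castSucc_castPred _ _⟩
      have h1 := hm (Fin.last k)
      intro h2
      rw [h2, Fin.le_def] at h1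
      simp at h1
    set A := Finset.univ.filter fun i : Fin (k + 1) → α => ∀ u, D' u → i u.succ = i (m' u) with hA
    have hcount : (Finset.univ.filter fun i : Fin (k + 2) → α =>
        ∀ u, D u → i u.succ = i (m u)).card =
        ∑ i ∈ A, (Finset.univ.filter fun x : α => D (Fin.last k) → x = i ml).card := by
      rw [← Finset.card_sigma]
      refine Finset.card_bij' (fun i _ => ⟨fun u => i u.castSucc, i (Fin.last _)⟩)
        (fun p _ => Fin.snoc p.1 p.2) ?_ ?_ ?_ ?_
      · intro i hi
        simp only [Finset.mem_filter, Finset.mem_univ, true_and, Finset.mem_sigma, hA] at hi ⊢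
        refine ⟨fun u hu => ?_, fun hD => ?_⟩
        · have := hi u.castSucc hu
          rw [← hm', Fin.succ_castSucc] at this
          exact this
        · have := hi (Fin.last k) hD
          rwa [← hml] at this
      · rintro ⟨i, x⟩ hp
        simp only [Finset.mem_filter, Finset.mem_univ, true_and, Finset.mem_sigma, hA] at hp ⊢
        intro u
        induction u using Fin.lastCases with
        | last =>
          intro hD
          rw [← hml, Fin.succ_last, Fin.snoc_last, Fin.snoc_castSucc]
          exact hp.2 hD
        | cast u =>
          intro hD
          rw [← hm', Fin.succ_castSucc, Fin.snoc_castSucc, Fin.snoc_castSucc]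
          exact hp.1 u hD
      · intro i _
        funext u
        induction u using Fin.lastCases with
        | last => simp
        | cast u => simp
      · rintro ⟨i, x⟩ _
        simp
    rw [hcount]
    have hcard : (Finset.univ.filter D).card =
        (Finset.univ.filter D').card + if D (Fin.last k) then 1 else 0 := by
      rw [Finset.card_filter, Finset.card_filter, Fin.sum_univ_castSucc]
    by_cases hD : D (Fin.last k)
    · simp only [hD, true_imp_iff, if_true] at hcard ⊢
      simp only [Finset.filter_eq', Finset.mem_univ, if_true, Finset.card_singleton,
        Finset.sum_const, smul_eq_mul, mul_one]
      rw [hcard, pow_succ, ← mul_assoc, h1, ← pow_succ]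
    · simp only [hD, false_imp_iff, if_false, add_zero] at hcard ⊢
      simp only [Finset.filter_true, Finset.card_univ, Finset.sum_const, smul_eq_mul]
      rw [hcard, mul_right_comm, h1, ← pow_succ]

variable {k : ℕ} {I J : Type*} (τ : Finpartition (Finset.univ : Finset (Fin k)))

/-- `u` is the last element of its block. -/
def IsCloser (u : Fin k) : Prop := ∀ v ∈ τ.part u, v ≤ u

instance : DecidablePred (IsCloser τ) := fun _ => Classical.dec _

theorem card_closers : (Finset.univ.filter (IsCloser τ)).card = τ.parts.card := by
  refine Finset.card_bij (fun u _ => τ.part u) (fun u _ => τ.part_mem.2 (Finset.mem_univ u)) ?_ ?_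
  · intro u hu v hv h
    have hu := (Finset.mem_filter.1 hu).2
    have hv := (Finset.mem_filter.1 hv).2
    exact le_antisymm (hv u (mem_part_comm.2 h)) (hu v (mem_part_comm.2 h.symm))
  · intro V hV
    have hne := τ.nonempty_of_mem_parts hV
    refine ⟨V.max' hne, ?_, τ.part_eq_of_mem hV (Finset.max'_mem _ _)⟩
    rw [Finset.mem_filter]
    refine ⟨Finset.mem_univ _, fun v hv => ?_⟩
    rw [τ.part_eq_of_mem hV (Finset.max'_mem _ _)] at hv
    exact Finset.le_max' _ _ hv

def blockMin (u : Fin k) : Fin k := (τ.part u).min' ⟨u, self_mem_part τ u⟩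

theorem blockMin_le {u v : Fin k} (hv : v ∈ τ.part u) : blockMin τ u ≤ v :=
  Finset.min'_le _ _ hv

variable {τ}

theorem isClosing_iff {i : Fin (k + 1) → I} :
    IsClosing τ i ↔ ∀ u, IsCloser τ u → i u.succ = i (blockMin τ u).castSucc := by
  constructor
  · intro h u hu
    exact h _ u (Finset.min'_mem _ _) fun v hv => ⟨blockMin_le τ hv, hu v hv⟩
  · intro h m u hm hmax
    rw [h u fun v hv => (hmax v hv).2]
    have : blockMin τ u = m :=
      le_antisymm (blockMin_le τ hm) (hmax _ (Finset.min'_mem _ _)).1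
    rw [this]

open Classical in
theorem card_isClosing [Fintype I] :
    (Finset.univ.filter fun i : Fin (k + 1) → I => IsClosing τ i).card
      * Fintype.card I ^ τ.parts.card = Fintype.card I ^ (k + 1) := by
  have := card_filter_determined (α := I) k (IsCloser τ) (fun u => (blockMin τ u).castSucc)
    (fun u => Fin.castSucc_le_castSucc_iff.2 (blockMin_le τ (self_mem_part τ u)))
  rw [card_closers] at this
  simp only [isClosing_iff]
  exact this

/-- A step that closes a block repeats an earlier value, so new values can arise only at `i 0` and
after the steps that are not closers. -/
theorem IsClosing.card_image_le [DecidableEq I] {i : Fin (k + 1) → I} (hi : IsClosing τ i) :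
    (Finset.univ.image i).card + τ.parts.card ≤ k + 1 := by
  have hfree : ∀ x, i x ∈ insert (i 0)
      ((Finset.univ.filter fun u => ¬ IsCloser τ u).image fun u => i u.succ) := by
    intro x
    induction x using WellFoundedLT.induction with
    | ind x ih =>
    induction x using Fin.cases with
    | zero => exact Finset.mem_insert_self _ _
    | succ u =>
      by_cases hu : IsCloser τ u
      · rw [isClosing_iff.1 hi u hu]
        exact ih _ (Fin.castSucc_lt_succ_iff.2 (blockMin_le τ (self_mem_part τ u)))
      · exact Finset.mem_insert_of_mem (Finset.mem_image.2
          ⟨u, Finset.mem_filter.2 ⟨Finset.mem_univ _, hu⟩, rfl⟩)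
  have h1 : (Finset.univ.image i).card ≤ (Finset.univ.filter fun u => ¬ IsCloser τ u).card + 1 := by
    have hsub : Finset.univ.image i ⊆ insert (i 0)
        ((Finset.univ.filter fun u => ¬ IsCloser τ u).image fun u => i u.succ) := by
      intro x hx
      obtain ⟨y, -, rfl⟩ := Finset.mem_image.1 hx
      exact hfree y
    exact (Finset.card_le_card hsub).trans
      ((Finset.card_insert_le _ _).trans (Nat.add_le_add_right Finset.card_image_le 1))
  have h2 := Finset.card_filter_add_card_filter_not (s := (Finset.univ : Finset (Fin k)))
    (IsCloser τ)
  rw [card_closers, Finset.card_univ, Fintype.card_fin] at h2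
  omega

theorem card_verts_le [DecidableEq I] [DecidableEq J] (i : Fin (k + 1) → I) (j : Fin k → J) :
    (verts i j).card ≤ (Finset.univ.image i).card + (Finset.univ.image j).card := by
  have hsub : verts i j ⊆ (Finset.univ.image i).disjSum (Finset.univ.image j) := by
    intro x hx
    obtain ⟨u | u, -, rfl⟩ := Finset.mem_image.1 hx
    · simp [walkFun]
    · simp [walkFun]
  exact (Finset.card_le_card hsub).trans (Finset.card_disjSum _ _).le

/-- If an attached walk is extremal, the blocks of `τ` are the level sets of `j`. -/
theorem IsAttached.part_eq [DecidableEq I] [DecidableEq J] {i : Fin (k + 1) → I} {j : Fin k → J}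
    (h : IsAttached τ i j) (hk : k < (verts i j).card) {u v : Fin k} (huv : j u = j v) :
    τ.part u = τ.part v := by
  by_contra hne
  -- Two blocks with the same value of `j` leave fewer columns than blocks, and `i` has at most `k +
  -- 1` minus the number of blocks values: too few vertices.
  have hj : (Finset.univ.image j).card < τ.parts.card := by
    let g : Finset (Fin k) → J := fun V => if h : V.Nonempty then j (V.min' h) else j u
    have hg : ∀ x, g (τ.part x) = j x := by
      intro x
      have hne : (τ.part x).Nonempty := ⟨x, self_mem_part τ x⟩
      simp only [g]
      rw [dif_pos hne]
      exact h.2 x _ (Finset.min'_mem _ _)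
    have himg : Finset.univ.image j ⊆ τ.parts.image g := by
      intro y hy
      obtain ⟨x, -, rfl⟩ := Finset.mem_image.1 hy
      exact Finset.mem_image.2 ⟨τ.part x, τ.part_mem.2 (Finset.mem_univ x), hg x⟩
    refine (Finset.card_le_card himg).trans_lt (lt_of_le_of_ne Finset.card_image_le ?_)
    intro hc
    refine hne (Finset.card_image_iff.1 hc (τ.part_mem.2 (Finset.mem_univ u))
      (τ.part_mem.2 (Finset.mem_univ v)) ?_)
    rw [hg, hg, huv]
  have h1 := h.1.card_image_le
  have h2 := card_verts_le i j
  omega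

theorem ext_of_part {σ σ' : Finpartition (Finset.univ : Finset (Fin k))}
    (h : ∀ u, σ.part u = σ'.part u) : σ = σ' := by
  have hsub : ∀ {σ σ' : Finpartition (Finset.univ : Finset (Fin k))},
      (∀ u, σ.part u = σ'.part u) → σ.parts ⊆ σ'.parts := by
    intro σ σ' hp V hV
    obtain ⟨x, hx⟩ := σ.nonempty_of_mem_parts hV
    rw [← σ.part_eq_of_mem hV hx, hp x]
    exact σ'.part_mem.2 (Finset.mem_univ x)
  exact Finpartition.ext (Finset.Subset.antisymm (hsub h) (hsub fun u => (h u).symm))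

/-- Ensures that a sum over partitions counts each extremal walk only once. -/
theorem IsAttached.unique [DecidableEq I] [DecidableEq J]
    {τ' : Finpartition (Finset.univ : Finset (Fin k))} {i : Fin (k + 1) → I} {j : Fin k → J}
    (h : IsAttached τ i j) (h' : IsAttached τ' i j) (hk : k < (verts i j).card) : τ = τ' := by
  have hpart : ∀ u, τ.part u = τ'.part u := by
    intro u
    ext v
    exact ⟨fun hv => mem_part_comm.2 (h'.part_eq hk (h.2 u v hv)),
      fun hv => mem_part_comm.2 (h.part_eq hk (h'.2 u v hv))⟩
  exact ext_of_part hpart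

open Classical in
theorem card_const_on_blocks [Fintype J] (Q : Fin k → J → Prop) :
    (Finset.univ.filter fun j : Fin k → J =>
      (∀ u, Q u (j u)) ∧ ∀ u v, v ∈ τ.part u → j v = j u).card =
    ∏ V ∈ τ.parts, (Finset.univ.filter fun q : J => ∀ u ∈ V, Q u q).card := by
  rw [← Finset.prod_coe_sort, ← Fintype.card_piFinset]
  have hP : ∀ u, τ.part u ∈ τ.parts := fun u => τ.part_mem.2 (Finset.mem_univ u)
  have hne : ∀ V : τ.parts, V.1.Nonempty := fun V => τ.nonempty_of_mem_parts V.2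
  have hmin : ∀ V : τ.parts, τ.part (V.1.min' (hne V)) = V.1 := fun V =>
    τ.part_eq_of_mem V.2 (Finset.min'_mem _ _)
  refine Finset.card_bij' (fun j _ V => j (V.1.min' (hne V)))
    (fun g _ u => g ⟨τ.part u, hP u⟩) ?_ ?_ ?_ ?_
  · intro j hj
    rw [Finset.mem_filter] at hj
    rw [Fintype.mem_piFinset]
    intro V
    rw [Finset.mem_filter]
    refine ⟨Finset.mem_univ _, fun u hu => ?_⟩
    have : j u = j (V.1.min' (hne V)) := hj.2.2 _ u (by rw [hmin]; exact hu)
    rw [← this]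
    exact hj.2.1 u
  · intro g hg
    rw [Fintype.mem_piFinset] at hg
    rw [Finset.mem_filter]
    refine ⟨Finset.mem_univ _, fun u => ?_, fun u v huv => ?_⟩
    · exact (Finset.mem_filter.1 (hg ⟨τ.part u, hP u⟩)).2 u (self_mem_part τ u)
    · exact congrArg g (Subtype.ext (mem_part_comm.1 huv))
  · intro j hj
    rw [Finset.mem_filter] at hj
    funext u
    exact hj.2.2 u _ (Finset.min'_mem _ _)
  · intro g _
    funext V
    exact congrArg g (Subtype.ext (hmin V))

end Counting

/-! ### Moments of products of entries -/

section Entries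

variable {Ω : Type*} [MeasurableSpace Ω] {P : Measure Ω} {ι : Type*}

/-- Independent pairs `(x e false, x e true)` of normalized variables with correlation `r e` and
absolute moments bounded by `B`. -/
structure PairArray (P : Measure Ω) (x : ι → Bool → Ω → ℝ) (r : ι → ℝ) (B : ℕ → ℝ) : Prop where
  meas : ∀ e b, Measurable (x e b)
  indep : iIndepFun (fun e ω => (x e false ω, x e true ω)) P
  mean : ∀ e b, ∫ ω, x e b ω ∂P = 0
  var : ∀ e b, ∫ ω, x e b ω ^ 2 ∂P = 1
  corr : ∀ e, ∫ ω, x e false ω * x e true ω ∂P = r e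
  integrable : ∀ e b (m : ℕ), Integrable (fun ω => |x e b ω| ^ m) P
  bound : ∀ e b (m : ℕ), ∫ ω, |x e b ω| ^ m ∂P ≤ B m
  bound_nonneg : ∀ m, 0 ≤ B m

def pairSel (b : Bool) (y : ℝ × ℝ) : ℝ := if b then y.2 else y.1

theorem measurable_pairSel (b : Bool) : Measurable (pairSel b) := by
  cases b
  · exact measurable_fst
  · exact measurable_snd

omit [MeasurableSpace Ω] in
theorem pairSel_apply (x : ι → Bool → Ω → ℝ) (i : ι) (b : Bool) (ω : Ω) :
    pairSel b (x i false ω, x i true ω) = x i b ω := by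
  cases b <;> rfl

theorem measurable_prod_pairSel [DecidableEq ι] {T : Type*} [Fintype T] (e : T → ι)
    (b : T → Bool) :
    Measurable fun y : {i // i ∈ Finset.univ.image e} → ℝ × ℝ =>
      ∏ t, pairSel (b t) (y ⟨e t, Finset.mem_image_of_mem e (Finset.mem_univ t)⟩) :=
  Finset.measurable_fun_prod _ fun t _ => (measurable_pairSel (b t)).comp
    (measurable_pi_apply (⟨e t, Finset.mem_image_of_mem e (Finset.mem_univ t)⟩ :
      {i // i ∈ Finset.univ.image e}))

def monomial {T : Type*} [Fintype T] (x : ι → Bool → Ω → ℝ) (e : T → ι) (b : T → Bool) (ω : Ω) :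
    ℝ :=
  ∏ t, x (e t) (b t) ω

/-- The product is at most a power of its largest factor, and the `1` takes care of the empty
product. Monomials in the entries are thus controlled by pure moments. -/
theorem abs_prod_le_one_add_sum {T : Type*} [Fintype T] (a : T → ℝ) :
    |∏ t, a t| ≤ 1 + ∑ t, |a t| ^ Fintype.card T := by
  have hnn : 0 ≤ ∑ t, |a t| ^ Fintype.card T := Finset.sum_nonneg fun t _ => by positivity
  rcases isEmpty_or_nonempty T with h | h
  · simp
  · obtain ⟨t0, -, ht0⟩ := Finset.exists_max_image Finset.univ (fun t => |a t|)
      Finset.univ_nonempty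
    rw [Finset.abs_prod]
    calc ∏ t, |a t| ≤ ∏ _t : T, |a t0| :=
          Finset.prod_le_prod (fun _ _ => abs_nonneg _) fun t ht => ht0 t ht
      _ = |a t0| ^ Fintype.card T := by simp
      _ ≤ ∑ t, |a t| ^ Fintype.card T :=
          Finset.single_le_sum (f := fun t => |a t| ^ Fintype.card T)
            (fun t _ => by positivity) (Finset.mem_univ t0)
      _ ≤ _ := by linarith

variable {x : ι → Bool → Ω → ℝ} {r : ι → ℝ} {B : ℕ → ℝ}

section

variable {T : Type*} [Fintype T] (e : T → ι) (b : T → Bool)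

theorem PairArray.measurable_monomial (h : PairArray P x r B) : Measurable (monomial x e b) := by
  unfold monomial
  exact Finset.measurable_fun_prod _ fun t _ => h.meas _ _

variable [IsProbabilityMeasure P]

theorem PairArray.integrable_dominating (h : PairArray P x r B) :
    Integrable (fun ω => 1 + ∑ t, |x (e t) (b t) ω| ^ Fintype.card T) P :=
  (integrable_const _).add (integrable_finsetSum _ fun _ _ => h.integrable _ _ _)

theorem PairArray.integrable_monomial (h : PairArray P x r B) : Integrable (monomial x e b) P := by
  refine (h.integrable_dominating e b).mono' (h.measurable_monomial e b).aestronglyMeasurable ?_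
  exact ae_of_all _ fun ω => abs_prod_le_one_add_sum _

theorem PairArray.abs_integral_monomial_le (h : PairArray P x r B) :
    |∫ ω, monomial x e b ω ∂P| ≤ 1 + Fintype.card T * B (Fintype.card T) := by
  calc |∫ ω, monomial x e b ω ∂P| ≤ ∫ ω, |monomial x e b ω| ∂P := abs_integral_le_integral_abs
    _ ≤ ∫ ω, (1 + ∑ t, |x (e t) (b t) ω| ^ Fintype.card T) ∂P :=
        integral_mono (h.integrable_monomial e b).abs (h.integrable_dominating e b)
          fun ω => abs_prod_le_one_add_sum _
    _ = 1 + ∑ t, ∫ ω, |x (e t) (b t) ω| ^ Fintype.card T ∂P := by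
        rw [integral_add (integrable_const _)
          (integrable_finsetSum _ fun t _ => h.integrable _ _ _),
          integral_finsetSum _ fun t _ => h.integrable _ _ _]
        simp
    _ ≤ 1 + ∑ _t : T, B (Fintype.card T) := by
        gcongr
        exact h.bound _ _ _
    _ = _ := by simp

omit [IsProbabilityMeasure P] in
theorem PairArray.integral_mul_monomial (h : PairArray P x r B) {T' : Type*} [Fintype T']
    (e' : T' → ι) (b' : T' → Bool) (hd : ∀ t t', e t ≠ e' t') :
    ∫ ω, monomial x e b ω * monomial x e' b' ω ∂P
      = (∫ ω, monomial x e b ω ∂P) * ∫ ω, monomial x e' b' ω ∂P := by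
  classical
  have hdis : Disjoint (Finset.univ.image e) (Finset.univ.image e') := by
    rw [Finset.disjoint_left]
    intro a ha ha'
    obtain ⟨t, -, rfl⟩ := Finset.mem_image.1 ha
    obtain ⟨t', -, ht'⟩ := Finset.mem_image.1 ha'
    exact hd t t' ht'.symm
  have h1 := h.indep.indepFun_finset _ _ hdis fun i => (h.meas i false).prodMk (h.meas i true)
  have h2 := h1.comp (measurable_prod_pairSel e b) (measurable_prod_pairSel e' b')
  have h3 : IndepFun (monomial x e b) (monomial x e' b') P := by
    convert h2 using 1
    · funext ω
      simp [monomial, pairSel_apply]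
    · funext ω
      simp [monomial, pairSel_apply]
  exact h3.integral_fun_mul_eq_mul_integral
    (h.measurable_monomial e b).aestronglyMeasurable
    (h.measurable_monomial e' b').aestronglyMeasurable

omit [IsProbabilityMeasure P] in
-- An entry whose index occurs only once is independent of the other factors and centred.
theorem PairArray.integral_monomial_eq_zero (h : PairArray P x r B) {t0 : T}
    (ht : ∀ t, t ≠ t0 → e t ≠ e t0) : ∫ ω, monomial x e b ω ∂P = 0 := by
  classical
  have h1 := h.integral_mul_monomial (fun _ : Unit => e t0) (fun _ => b t0)
    (fun t : {t // t ≠ t0} => e t) (fun t => b t) (fun _ t => (ht t t.2).symm)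
  have h2 : ∀ ω, monomial x e b ω = monomial x (fun _ : Unit => e t0) (fun _ => b t0) ω
      * monomial x (fun t : {t // t ≠ t0} => e t) (fun t => b t) ω := by
    intro ω
    simp only [monomial]
    rw [Fintype.prod_eq_mul_prod_subtype_ne _ t0]
    simp
  simp only [h2, h1]
  simp [monomial, h.mean]

end

theorem PairArray.integral_pair (h : PairArray P x r B) (e : ι) (b b' : Bool) :
    ∫ ω, x e b ω * x e b' ω ∂P = if b = b' then 1 else r e := by
  cases b <;> cases b'
  · simpa [sq] using h.var e false
  · simpa using h.corr e
  · simpa [mul_comm] using h.corr e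
  · simpa [sq] using h.var e true

theorem PairArray.integral_prod_pairs [IsProbabilityMeasure P] (h : PairArray P x r B)
    {T : Type*} [Fintype T] {e : T → ι} (he : Function.Injective e) (b b' : T → Bool) :
    ∫ ω, ∏ t, (x (e t) (b t) ω * x (e t) (b' t) ω) ∂P
      = ∏ t, if b t = b' t then 1 else r (e t) := by
  have h1 := (h.indep.precomp he).comp (fun t y => pairSel (b t) y * pairSel (b' t) y)
    fun t => (measurable_pairSel _).mul (measurable_pairSel _)
  have h2 := h1.integral_fun_prod_eq_prod_integral fun t =>
    (((measurable_pairSel _).mul (measurable_pairSel _)).comp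
      ((h.meas (e t) false).prodMk (h.meas (e t) true))).aestronglyMeasurable
  simp only [Function.comp, pairSel_apply] at h2
  rw [h2]
  exact Finset.prod_congr rfl fun t _ => h.integral_pair _ _ _

end Entries

/-! ### Expectations along walks -/

section WalkMoments

variable {Ω : Type*} {I J : Type*} {k k' : ℕ} {x : I × J → Bool → Ω → ℝ}

/-- With `false` for `X` and `true` for `Y`, the letter `C = n⁻¹ X Y^*` reads `X` on entering the
column and `Y` on leaving it, and its adjoint does the opposite. -/
def slotLabel (b : Fin k → Bool) (σ : Fin k × Bool) : Bool := if σ.2 then !b σ.1 else b σ.1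

/-- The product of the entries along a walk. -/
def walkTerm (x : I × J → Bool → Ω → ℝ) (b : Fin k → Bool) (i : Fin (k + 1) → I) (j : Fin k → J) :
    Ω → ℝ :=
  monomial x (slotEdge i j) (slotLabel b)

variable (b : Fin k → Bool) (b' : Fin k' → Bool) {i : Fin (k + 1) → I} {j : Fin k → J}
  {i' : Fin (k' + 1) → I} {j' : Fin k' → J}

theorem walkTerm_eq (ω : Ω) : walkTerm x b i j ω =
    ∏ u, (x (slotEdge i j (u, true)) (!b u) ω * x (slotEdge i j (u, false)) (b u) ω) := by
  rw [walkTerm, monomial, Fintype.prod_prod_type]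
  simp [slotLabel]

theorem walkTerm_mul_walkTerm (ω : Ω) : walkTerm x b i j ω * walkTerm x b' i' j' ω
    = monomial x (Sum.elim (slotEdge i j) (slotEdge i' j'))
      (Sum.elim (slotLabel b) (slotLabel b')) ω := by
  simp [walkTerm, monomial]

variable [MeasurableSpace Ω] {P : Measure Ω} [IsProbabilityMeasure P] {r : I × J → ℝ} {B : ℕ → ℝ}

omit [IsProbabilityMeasure P] in
theorem PairArray.integral_walkTerm_eq_zero (h : PairArray P x r B) (hd : ¬ IsDouble i j) :
    ∫ ω, walkTerm x b i j ω ∂P = 0 := by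
  rw [IsDouble] at hd
  push Not at hd
  obtain ⟨σ, hσ⟩ := hd
  exact h.integral_monomial_eq_zero _ _ hσ

variable [DecidableEq I] [DecidableEq J]

/-- The two slots of the edge of `u` carry the labels `!b u` and `b (nxt τ u)`. Equal exponents
therefore pair an `X` with a `Y`, giving the correlation, and different exponents give a second
moment `1`. Different pairs lie on different edges and are independent. -/
theorem PairArray.integral_walkTerm (h : PairArray P x r B)
    {τ : Finpartition (Finset.univ : Finset (Fin k))} (hτ : IsNonCrossing τ)
    (hat : IsAttached τ i j) (hk : k < (verts i j).card) :
    ∫ ω, walkTerm x b i j ω ∂P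
      = ∏ u, if b u = b (nxt τ u) then r (slotEdge i j (u, true)) else 1 := by
  have h1 : ∀ ω, walkTerm x b i j ω = ∏ u, (x (slotEdge i j (u, true)) (!b u) ω *
      x (slotEdge i j (u, true)) (b (nxt τ u)) ω) := by
    intro ω
    rw [walkTerm_eq, Finset.prod_mul_distrib, Finset.prod_mul_distrib]
    congr 1
    rw [← (nxt_bijective τ).prod_comp]
    exact Finset.prod_congr rfl fun u _ => by rw [hat.slotEdge_nxt hτ]
  simp only [h1]
  rw [h.integral_prod_pairs (hat.slotEdge_injective hτ hk)]
  refine Finset.prod_congr rfl fun u _ => ?_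
  cases b u <;> cases b (nxt τ u) <;> rfl

/-- Without a common edge the terms are independent. If some edge is passed only once by the two
walks together, both sides vanish. In the remaining case the union has too few vertices. -/
theorem PairArray.integral_walkTerm_mul (h : PairArray P x r B) (hcl : i (Fin.last k) = i 0)
    (hk : k + k' < (verts i j ∪ verts i' j').card) :
    ∫ ω, walkTerm x b i j ω * walkTerm x b' i' j' ω ∂P
      = (∫ ω, walkTerm x b i j ω ∂P) * ∫ ω, walkTerm x b' i' j' ω ∂P := by
  by_cases hs : ∃ σ σ', slotEdge i j σ = slotEdge i' j' σ'
  swap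
  · push Not at hs
    exact h.integral_mul_monomial _ _ _ _ hs
  simp only [walkTerm_mul_walkTerm]
  by_cases hd : ∀ σ, (∃ σ', σ' ≠ σ ∧ slotEdge i j σ' = slotEdge i j σ) ∨
      ∃ σ', slotEdge i' j' σ' = slotEdge i j σ
  swap
  · push Not at hd
    obtain ⟨σ, h1, h2⟩ := hd
    have h3 : ¬ IsDouble i j := fun hd => by
      obtain ⟨σ', h4, h5⟩ := hd σ
      exact h1 σ' h4 h5
    rw [h.integral_walkTerm_eq_zero b h3, zero_mul]
    refine h.integral_monomial_eq_zero _ _ (t0 := Sum.inl σ) ?_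
    rintro (t | t) ht
    · exact h1 t fun h => ht (by rw [h])
    · exact h2 t
  by_cases hd' : ∀ σ, (∃ σ', σ' ≠ σ ∧ slotEdge i' j' σ' = slotEdge i' j' σ) ∨
      ∃ σ', slotEdge i j σ' = slotEdge i' j' σ
  swap
  · push Not at hd'
    obtain ⟨σ, h1, h2⟩ := hd'
    have h3 : ¬ IsDouble i' j' := fun hd => by
      obtain ⟨σ', h4, h5⟩ := hd σ
      exact h1 σ' h4 h5
    rw [h.integral_walkTerm_eq_zero b' h3, mul_zero]
    refine h.integral_monomial_eq_zero _ _ (t0 := Sum.inr σ) ?_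
    rintro (t | t) ht
    · exact h2 t
    · exact h1 t fun h => ht (by rw [h])
  exact absurd (card_verts_union_le hcl hd hd' hs) (not_le.2 hk)

end WalkMoments

/-! ### Traces of words as sums over walks -/

section Trace

theorem prod_ofFn_apply {I R : Type*} [Fintype I] [DecidableEq I] [CommSemiring R] :
    ∀ (k : ℕ) (M : Fin k → Matrix I I R) (a c : I),
    (List.ofFn M).prod a c = ∑ i : Fin (k + 1) → I,
      if i 0 = a ∧ i (Fin.last k) = c then ∏ u, M u (i u.castSucc) (i u.succ) else 0 := by
  intro k
  induction k with
  | zero =>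
    intro M a c
    rw [List.ofFn_zero, List.prod_nil, Matrix.one_apply,
      Fintype.sum_equiv (Equiv.funUnique (Fin 1) I) _ (fun x => if x = a ∧ x = c then (1 : R) else 0)
        (fun i => by simp [Equiv.funUnique])]
    by_cases h : a = c
    · subst h
      simp
    · rw [if_neg h]
      symm
      refine Finset.sum_eq_zero fun x _ => if_neg ?_
      rintro ⟨rfl, h2⟩
      exact h h2
  | succ k ih =>
    intro M a c
    rw [List.ofFn_succ, List.prod_cons, Matrix.mul_apply,
      ← Fintype.sum_equiv (Fin.consEquiv fun _ => I) (fun p => if p.1 = a ∧ p.2 (Fin.last k) = c then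
        M 0 p.1 (p.2 0) * ∏ u, M (Fin.succ u) (p.2 u.castSucc) (p.2 u.succ) else 0) _ ?_]
    · rw [Fintype.sum_prod_type]
      simp only [ih, Finset.mul_sum]
      rw [Finset.sum_comm, Finset.sum_comm (γ := I)]
      refine Finset.sum_congr rfl fun i _ => ?_
      by_cases hc : i (Fin.last k) = c
      · simp [hc, Finset.sum_ite_eq]
      · simp [hc]
    · rintro ⟨x, i⟩
      have h1 : (Fin.consEquiv fun _ => I) (x, i) (Fin.last (k + 1)) = i (Fin.last k) := by
        rw [← Fin.succ_last]
        simp [Fin.consEquiv]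
      rw [h1, Fin.prod_univ_succ]
      simp [Fin.consEquiv]

variable {I J : Type*} [Fintype I] [Fintype J] [DecidableEq I] [DecidableEq J] {k : ℕ}
  {C : Type*} [DecidableEq C] (color : J → C)

/-- Closed walks whose `u`-th `j`-step has the colour `α u`. -/
def walks (I : Type*) [Fintype I] [DecidableEq I] (α : Fin k → C) :
    Finset ((Fin (k + 1) → I) × (Fin k → J)) :=
  Finset.univ.filter fun w => w.1 (Fin.last k) = w.1 0 ∧ ∀ u, color (w.2 u) = α u

omit [DecidableEq J] in
theorem trace_prod_eq {Ω : Type*} (x : I × J → Bool → Ω → ℝ) (ω : Ω) (α : Fin k → C)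
    (b : Fin k → Bool) (s : Fin k → ℝ) (M : Fin k → Matrix I I ℝ)
    (hM : ∀ u a c, M u a c = s u * ∑ q ∈ Finset.univ.filter fun q => color q = α u,
      x (a, q) (b u) ω * x (c, q) (!b u) ω) :
    (List.ofFn M).prod.trace
      = (∏ u, s u) * ∑ w ∈ walks color I α, walkTerm x b w.1 w.2 ω := by
  have h1 : (List.ofFn M).prod.trace = ∑ i : Fin (k + 1) → I,
      if i (Fin.last k) = i 0 then ∏ u, M u (i u.castSucc) (i u.succ) else 0 := by
    simp only [Matrix.trace, Matrix.diag, prod_ofFn_apply]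
    rw [Finset.sum_comm]
    refine Finset.sum_congr rfl fun i _ => ?_
    by_cases h : i (Fin.last k) = i 0
    · rw [if_pos h, Finset.sum_eq_single (i 0)]
      · simp [h]
      · intro a _ ha
        exact if_neg fun h2 => ha h2.1.symm
      · simp
    · rw [if_neg h]
      refine Finset.sum_eq_zero fun a _ => if_neg ?_
      rintro ⟨h2, h3⟩
      exact h (h3.trans h2.symm)
  rw [h1, ← Finset.sum_filter, Finset.mul_sum]
  have h2 : walks color I α = (Finset.univ.filter fun i : Fin (k + 1) → I =>
      i (Fin.last k) = i 0) ×ˢ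
      Fintype.piFinset fun u => Finset.univ.filter fun q => color q = α u := by
    ext ⟨i, j⟩
    simp [walks]
  rw [h2, Finset.sum_product]
  refine Finset.sum_congr rfl fun i _ => ?_
  rw [← Finset.mul_sum]
  simp only [hM]
  rw [Finset.prod_mul_distrib, Finset.prod_univ_sum]
  congr 1
  refine Finset.sum_congr rfl fun j _ => ?_
  rw [walkTerm_eq]
  refine Finset.prod_congr rfl fun u _ => ?_
  simp [slotEdge, mul_comm]

end Trace

/-! ### The mean and the variance of a walk sum -/

section WalkSums

variable {I J : Type*} [Fintype I] [Fintype J] [DecidableEq I] [DecidableEq J] {k : ℕ}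
  {C : Type*} [DecidableEq C] {color : J → C} {ρ : C → ℝ}

/-- The weight of the partition `τ` for the word with colours `α` and exponents `b`. -/
def weight (ρ : C → ℝ) (α : Fin k → C) (b : Fin k → Bool)
    (τ : Finpartition (Finset.univ : Finset (Fin k))) : ℝ :=
  ∏ u, if b u = b (nxt τ u) then ρ (α u) else 1

/-- The negligible walks: there are `O(N ^ k)` of them, `N` being the number of available vertices,
against a normalization of order `N ^ (k + 1)`. -/
def smallWalks (k : ℕ) (I J : Type*) [Fintype I] [Fintype J] [DecidableEq I] [DecidableEq J] :
    Finset ((Fin (k + 1) → I) × (Fin k → J)) :=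
  Finset.univ.filter fun w => (verts w.1 w.2).card ≤ k

theorem card_smallWalks_le : (smallWalks k I J).card
    ≤ k ^ (2 * k + 1) * (Fintype.card I + Fintype.card J) ^ k := by
  have h := card_filter_card_image_le (S := Fin (k + 1) ⊕ Fin k) (T := I ⊕ J) k
  rw [Fintype.card_sum, Fintype.card_sum, Fintype.card_fin, Fintype.card_fin] at h
  rw [show 2 * k + 1 = k + 1 + k by ring]
  refine le_trans ?_ h
  refine Finset.card_le_card_of_injOn (fun w => walkFun w.1 w.2) ?_ ?_
  · intro w hw
    have hw := (Finset.mem_filter.1 (Finset.mem_coe.1 hw)).2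
    rw [Finset.mem_coe, Finset.mem_filter]
    refine ⟨Finset.mem_univ _, ?_⟩
    rw [verts] at hw
    exact hw
  · rintro ⟨i, j⟩ _ ⟨i', j'⟩ _ h
    have h1 : ∀ u, i u = i' u := fun u => Sum.inl.inj (congrFun h (Sum.inl u))
    have h2 : ∀ u, j u = j' u := fun u => Sum.inr.inj (congrFun h (Sum.inr u))
    rw [Prod.mk.injEq]
    exact ⟨funext h1, funext h2⟩

/-- The only pairs that can be correlated: there are `O(N ^ (2k))` of them, against a normalization
of order `N ^ (2k + 2)` for the variance. -/
def smallPairs (k : ℕ) (I J : Type*) [Fintype I] [Fintype J] [DecidableEq I] [DecidableEq J] :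
    Finset (((Fin (k + 1) → I) × (Fin k → J)) × ((Fin (k + 1) → I) × (Fin k → J))) :=
  Finset.univ.filter fun w => (verts w.1.1 w.1.2 ∪ verts w.2.1 w.2.2).card ≤ k + k

theorem card_smallPairs_le : (smallPairs k I J).card
    ≤ (k + k) ^ (2 * (2 * k + 1)) * (Fintype.card I + Fintype.card J) ^ (k + k) := by
  have h := card_filter_card_image_le (S := (Fin (k + 1) ⊕ Fin k) ⊕ (Fin (k + 1) ⊕ Fin k))
    (T := I ⊕ J) (k + k)
  rw [Fintype.card_sum, Fintype.card_sum, Fintype.card_sum, Fintype.card_fin, Fintype.card_fin] at h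
  rw [show 2 * (2 * k + 1) = k + 1 + k + (k + 1 + k) by ring]
  refine le_trans ?_ h
  refine Finset.card_le_card_of_injOn
    (fun w => Sum.elim (walkFun w.1.1 w.1.2) (walkFun w.2.1 w.2.2)) ?_ ?_
  · intro w hw
    have hw := (Finset.mem_filter.1 (Finset.mem_coe.1 hw)).2
    rw [Finset.mem_coe, Finset.mem_filter]
    refine ⟨Finset.mem_univ _, le_trans (Finset.card_le_card ?_) hw⟩
    intro y hy
    obtain ⟨s | s, -, rfl⟩ := Finset.mem_image.1 hy
    · exact Finset.mem_union_left _ (Finset.mem_image_of_mem _ (Finset.mem_univ s))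
    · exact Finset.mem_union_right _ (Finset.mem_image_of_mem _ (Finset.mem_univ s))
  · rintro ⟨⟨i, j⟩, ⟨i', j'⟩⟩ _ ⟨⟨i₁, j₁⟩, ⟨i₁', j₁'⟩⟩ _ h
    have h1 : ∀ u, i u = i₁ u := fun u => Sum.inl.inj (congrFun h (Sum.inl (Sum.inl u)))
    have h2 : ∀ u, j u = j₁ u := fun u => Sum.inr.inj (congrFun h (Sum.inl (Sum.inr u)))
    have h3 : ∀ u, i' u = i₁' u := fun u => Sum.inl.inj (congrFun h (Sum.inr (Sum.inl u)))
    have h4 : ∀ u, j' u = j₁' u := fun u => Sum.inr.inj (congrFun h (Sum.inr (Sum.inr u)))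
    simp only [Prod.mk.injEq]
    exact ⟨⟨funext h1, funext h2⟩, funext h3, funext h4⟩

open Classical in
/-- The walks attached to `τ`. -/
def attachedWalks (I : Type*) [Fintype I] (color : J → C) (α : Fin k → C)
    (τ : Finpartition (Finset.univ : Finset (Fin k))) :
    Finset ((Fin (k + 1) → I) × (Fin k → J)) :=
  Finset.univ.filter fun w => IsAttached τ w.1 w.2 ∧ ∀ u, color (w.2 u) = α u

omit [DecidableEq I] [DecidableEq J] in
theorem mem_attachedWalks {α : Fin k → C} {τ : Finpartition (Finset.univ : Finset (Fin k))}
    {w : (Fin (k + 1) → I) × (Fin k → J)} : w ∈ attachedWalks I color α τ ↔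
      IsAttached τ w.1 w.2 ∧ ∀ u, color (w.2 u) = α u := by
  simp [attachedWalks]

omit [DecidableEq I] in
-- Rows and columns are chosen independently: the rows obey one closing condition per block, and
-- each block has a single column, of the colour of all its letters.
theorem card_attachedWalks (α : Fin k → C) (τ : Finpartition (Finset.univ : Finset (Fin k))) :
    (attachedWalks I color α τ).card * Fintype.card I ^ τ.parts.card =
      Fintype.card I ^ (k + 1) *
        ∏ V ∈ τ.parts, (Finset.univ.filter fun q : J => ∀ u ∈ V, color q = α u).card := by
  classical
  have h : attachedWalks I color α τ =
      (Finset.univ.filter fun i : Fin (k + 1) → I => IsClosing τ i) ×ˢ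
      (Finset.univ.filter fun j : Fin k → J =>
        (∀ u, color (j u) = α u) ∧ ∀ u v, v ∈ τ.part u → j v = j u) := by
    ext ⟨i, j⟩
    simp only [mem_attachedWalks, IsAttached, Finset.mem_filter, Finset.mem_univ, true_and,
      Finset.mem_product]
    tauto
  have h2 := card_const_on_blocks (τ := τ) (J := J) fun u q => color q = α u
  rw [h, Finset.card_product, mul_right_comm, card_isClosing (I := I) (τ := τ)]
  congr 1
  convert h2

variable {Ω : Type*} [MeasurableSpace Ω] {P : Measure Ω} [IsProbabilityMeasure P]
  {x : I × J → Bool → Ω → ℝ} {B : ℕ → ℝ}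

def termBound (B : ℕ → ℝ) (m : ℕ) : ℝ := 1 + m * B m

omit [Fintype I] [Fintype J] [DecidableEq I] [DecidableEq J] in
theorem PairArray.abs_integral_walkTerm_le {r : I × J → ℝ} (h : PairArray P x r B)
    (b : Fin k → Bool) (i : Fin (k + 1) → I) (j : Fin k → J) :
    |∫ ω, walkTerm x b i j ω ∂P| ≤ termBound B (2 * k) := by
  have := h.abs_integral_monomial_le (slotEdge i j) (slotLabel b)
  rw [Fintype.card_prod, Fintype.card_fin, Fintype.card_bool, mul_comm k 2] at this
  exact this

/-- A double extremal walk is attached to exactly one `τ`. A walk that is not double is attached to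
none, and its expectation vanishes. -/
theorem PairArray.integral_walkTerm_eq_sum (h : PairArray P x (fun e => ρ (color e.2)) B)
    (α : Fin k → C) (b : Fin k → Bool) {w : (Fin (k + 1) → I) × (Fin k → J)}
    (hw : w ∈ walks color I α) (hk : k < (verts w.1 w.2).card) :
    ∫ ω, walkTerm x b w.1 w.2 ω ∂P =
      ∑ τ : NC k, if w ∈ attachedWalks I color α τ.1 then weight ρ α b τ.1 else 0 := by
  classical
  obtain ⟨-, hcl, hcol⟩ := Finset.mem_filter.1 hw
  by_cases hd : IsDouble w.1 w.2
  · obtain ⟨τ, hτ, hat⟩ := hd.exists_isAttached hcl hk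
    rw [Finset.sum_eq_single ⟨τ, hτ⟩]
    · rw [if_pos (mem_attachedWalks.2 ⟨hat, hcol⟩),
        h.integral_walkTerm b hτ hat hk, weight]
      refine Finset.prod_congr rfl fun u _ => ?_
      simp [slotEdge, hcol]
    · intro σ _ hσ
      refine if_neg fun hmem => hσ (Subtype.ext ?_)
      exact (mem_attachedWalks.1 hmem).1.unique hat hk
    · simp
  · rw [h.integral_walkTerm_eq_zero b hd, Finset.sum_eq_zero]
    intro τ _
    exact if_neg fun hmem => hd ((mem_attachedWalks.1 hmem).1.isDouble τ.2)

omit [DecidableEq J] in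
theorem attachedWalks_subset (α : Fin k → C) (τ : NC k) :
    attachedWalks I color α τ.1 ⊆ walks color I α := by
  intro w hw
  obtain ⟨h1, h2⟩ := mem_attachedWalks.1 hw
  exact Finset.mem_filter.2 ⟨Finset.mem_univ _, h1.1.closed τ.2, h2⟩

/-- On extremal walks the two sums agree term by term. Only small walks are left, and each
contributes a bounded error to either sum. -/
theorem PairArray.abs_sum_walks_sub_le (h : PairArray P x (fun e => ρ (color e.2)) B)
    (α : Fin k → C) (b : Fin k → Bool) :
    |(∑ w ∈ walks color I α, ∫ ω, walkTerm x b w.1 w.2 ω ∂P)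
        - ∑ τ : NC k, (attachedWalks I color α τ.1).card * weight ρ α b τ.1|
      ≤ (smallWalks k I J).card * (termBound B (2 * k) + ∑ τ : NC k, |weight ρ α b τ.1|) := by
  classical
  have h1 : ∀ τ : NC k, ((attachedWalks I color α τ.1).card : ℝ) * weight ρ α b τ.1 =
      ∑ w ∈ walks color I α,
        if w ∈ attachedWalks I color α τ.1 then weight ρ α b τ.1 else 0 := by
    intro τ
    rw [← Finset.sum_filter, Finset.sum_const, nsmul_eq_mul, Finset.filter_mem_eq_inter,
      Finset.inter_eq_right.2 (attachedWalks_subset α τ)]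
  simp only [h1]
  rw [Finset.sum_comm, ← Finset.sum_sub_distrib,
    ← Finset.sum_filter_add_sum_filter_not _ fun w : (Fin (k + 1) → I) × (Fin k → J) =>
      (verts w.1 w.2).card ≤ k]
  rw [Finset.sum_eq_zero (s := Finset.filter _ _) (f := _)
    (fun w hw => ?_ : ∀ w ∈ (walks color I α).filter fun w => ¬ (verts w.1 w.2).card ≤ k, _),
    add_zero]
  · refine (Finset.abs_sum_le_sum_abs _ _).trans ?_
    refine (Finset.sum_le_card_nsmul _ _
      (termBound B (2 * k) + ∑ τ : NC k, |weight ρ α b τ.1|) fun w _ => ?_).trans ?_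
    · refine (abs_sub _ _).trans (add_le_add (h.abs_integral_walkTerm_le b _ _) ?_)
      refine (Finset.abs_sum_le_sum_abs _ _).trans (Finset.sum_le_sum fun τ _ => ?_)
      split_ifs
      · exact le_rfl
      · simp
    · rw [nsmul_eq_mul]
      have hnn : 0 ≤ termBound B (2 * k) + ∑ τ : NC k, |weight ρ α b τ.1| := by
        refine add_nonneg ?_ (Finset.sum_nonneg fun _ _ => abs_nonneg _)
        have := h.bound_nonneg (2 * k)
        unfold termBound
        positivity
      refine mul_le_mul_of_nonneg_right ?_ hnn
      exact_mod_cast Finset.card_le_card fun w hw =>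
        Finset.mem_filter.2 ⟨Finset.mem_univ _, (Finset.mem_filter.1 hw).2⟩
  · obtain ⟨hw, hk⟩ := Finset.mem_filter.1 hw
    rw [h.integral_walkTerm_eq_sum α b hw (not_le.1 hk), sub_self]

theorem sum_ite_mem_le {X : Type*} [DecidableEq X] (S T : Finset X) {c : ℝ} (hc : 0 ≤ c) :
    ∑ x ∈ S, (if x ∈ T then c else 0) ≤ T.card * c := by
  rw [← Finset.sum_filter, Finset.sum_const, nsmul_eq_mul]
  refine mul_le_mul_of_nonneg_right ?_ hc
  exact_mod_cast Finset.card_le_card fun w hw => (Finset.mem_filter.1 hw).2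

theorem integral_centered_mul {f g : Ω → ℝ} (hf : Integrable f P) (hg : Integrable g P)
    (hfg : Integrable (fun ω => f ω * g ω) P) :
    ∫ ω, (f ω - ∫ ω, f ω ∂P) * (g ω - ∫ ω, g ω ∂P) ∂P
      = (∫ ω, f ω * g ω ∂P) - (∫ ω, f ω ∂P) * ∫ ω, g ω ∂P := by
  generalize hm : ∫ ω, f ω ∂P = m
  generalize hm' : ∫ ω, g ω ∂P = m'
  have h1 : ∀ ω, (f ω - m) * (g ω - m') = (f ω * g ω - f ω * m') - (m * g ω - m * m') :=
    fun ω => by ring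
  have h2 : Integrable (fun ω => f ω * m') P := hf.mul_const m'
  have h3 : Integrable (fun ω => m * g ω) P := hg.const_mul m
  have h4 : Integrable (fun ω => f ω * g ω - f ω * m') P := hfg.sub h2
  have h5 : Integrable (fun ω => m * g ω - m * m') P := h3.sub (integrable_const _)
  simp only [h1]
  rw [integral_sub h4 h5, integral_sub hfg h2, integral_sub h3 (integrable_const _),
    integral_mul_const, integral_const_mul, hm, hm']
  simp

/-- The expanded square is a double sum of covariances, which vanish outside `smallPairs` and are
bounded on it. -/
theorem PairArray.variance_sum_walks_le {r : I × J → ℝ} (h : PairArray P x r B)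
    (α : Fin k → C) (b : Fin k → Bool) :
    ∫ ω, ((∑ w ∈ walks color I α, walkTerm x b w.1 w.2 ω)
        - ∑ w ∈ walks color I α, ∫ ω, walkTerm x b w.1 w.2 ω ∂P) ^ 2 ∂P
      ≤ (smallPairs k I J).card * (termBound B (2 * k + 2 * k) + termBound B (2 * k) ^ 2) := by
  classical
  have hint : ∀ w : (Fin (k + 1) → I) × (Fin k → J), Integrable (walkTerm x b w.1 w.2) P :=
    fun w => h.integrable_monomial _ _
  have hint2 : ∀ w w' : (Fin (k + 1) → I) × (Fin k → J),
      Integrable (fun ω => walkTerm x b w.1 w.2 ω * walkTerm x b w'.1 w'.2 ω) P := by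
    intro w w'
    simp only [walkTerm_mul_walkTerm]
    exact h.integrable_monomial _ _
  have hB := h.bound_nonneg (2 * k + 2 * k)
  have hcov : ∀ w w' : (Fin (k + 1) → I) × (Fin k → J), w ∈ walks color I α →
      ∫ ω, (walkTerm x b w.1 w.2 ω - ∫ ω, walkTerm x b w.1 w.2 ω ∂P) *
        (walkTerm x b w'.1 w'.2 ω - ∫ ω, walkTerm x b w'.1 w'.2 ω ∂P) ∂P ≤
      if (w, w') ∈ smallPairs k I J then
        termBound B (2 * k + 2 * k) + termBound B (2 * k) ^ 2 else 0 := by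
    intro w w' hw
    have hexp : ∫ ω, (walkTerm x b w.1 w.2 ω - ∫ ω, walkTerm x b w.1 w.2 ω ∂P) *
        (walkTerm x b w'.1 w'.2 ω - ∫ ω, walkTerm x b w'.1 w'.2 ω ∂P) ∂P =
        (∫ ω, walkTerm x b w.1 w.2 ω * walkTerm x b w'.1 w'.2 ω ∂P) -
        (∫ ω, walkTerm x b w.1 w.2 ω ∂P) * ∫ ω, walkTerm x b w'.1 w'.2 ω ∂P := by
      exact integral_centered_mul (hint w) (hint w') (hint2 w w')
    rw [hexp]
    split_ifs with hs
    · have h1 := h.abs_integral_walkTerm_le b w.1 w.2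
      have h2 := h.abs_integral_walkTerm_le b w'.1 w'.2
      have h3 : |∫ ω, walkTerm x b w.1 w.2 ω * walkTerm x b w'.1 w'.2 ω ∂P|
          ≤ termBound B (2 * k + 2 * k) := by
        simp only [walkTerm_mul_walkTerm]
        have := h.abs_integral_monomial_le (Sum.elim (slotEdge w.1 w.2) (slotEdge w'.1 w'.2))
          (Sum.elim (slotLabel b) (slotLabel b))
        rw [Fintype.card_sum, Fintype.card_prod, Fintype.card_fin, Fintype.card_bool,
          mul_comm k 2] at this
        exact this
      have h4 := (mul_le_mul h1 h2 (abs_nonneg _) ((abs_nonneg _).trans h1))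
      rw [← abs_mul] at h4
      have h5 := (abs_le.1 h4).1
      have h6 := (abs_le.1 h3).2
      rw [sq]
      linarith
    · rw [h.integral_walkTerm_mul b b (Finset.mem_filter.1 hw).2.1, sub_self]
      by_contra hle
      exact hs (Finset.mem_filter.2 ⟨Finset.mem_univ _, not_lt.1 hle⟩)
  simp only [← Finset.sum_sub_distrib, sq, Finset.sum_mul_sum]
  have hint3 : ∀ w w' : (Fin (k + 1) → I) × (Fin k → J),
      Integrable (fun ω => (walkTerm x b w.1 w.2 ω - ∫ ω, walkTerm x b w.1 w.2 ω ∂P) *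
        (walkTerm x b w'.1 w'.2 ω - ∫ ω, walkTerm x b w'.1 w'.2 ω ∂P)) P := by
    intro w w'
    refine ((((hint2 w w').sub ((hint w).mul_const (∫ ω, walkTerm x b w'.1 w'.2 ω ∂P))).sub
      ((hint w').const_mul (∫ ω, walkTerm x b w.1 w.2 ω ∂P))).add (integrable_const
      ((∫ ω, walkTerm x b w.1 w.2 ω ∂P) * ∫ ω, walkTerm x b w'.1 w'.2 ω ∂P))).congr
      (ae_of_all _ fun ω => ?_)
    simp only [Pi.add_apply, Pi.sub_apply]
    ring
  rw [integral_finsetSum _ fun w _ => integrable_finsetSum _ fun w' _ => hint3 w w']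
  simp only [integral_finsetSum _ fun w' _ => hint3 _ w']
  refine (Finset.sum_le_sum fun w hw => Finset.sum_le_sum fun w' _ => hcov w w' hw).trans ?_
  rw [← Finset.sum_product']
  refine le_trans (le_of_eq (Finset.sum_congr rfl fun w _ => ?_))
    (sum_ite_mem_le (walks color I α ×ˢ walks color I α) (smallPairs k I J)
      (c := termBound B (2 * k + 2 * k) + termBound B (2 * k) * termBound B (2 * k))
      (add_nonneg (by unfold termBound; positivity) (mul_self_nonneg _)))
  rw [← sq]

end WalkSums

/-! ### The limiting cumulants and moments of words -/

section Cumulants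

variable {t : ℕ} (ρ y : Fin t → ℝ)

/-- The cumulant of the letters of the word `a` with positions in `V`. -/
def cum {α : Type*} [LinearOrder α] (a : α → Fin t × Bool) (V : Finset α) : ℝ :=
  (if ∀ u ∈ V, ∀ v ∈ V, (a u).1 = (a v).1 then 1 else 0) *
    (if h : V.Nonempty then y (a (V.min' h)).1 ^ (V.card - 1) else 1) *
    ∏ u ∈ V, if (a u).2 = (a (nxtIn V u)).2 then ρ (a u).1 else 1

/-- The limiting moment of the word `a`. -/
def mom {k : ℕ} (a : Fin k → Fin t × Bool) : ℝ :=
  ∑ τ : NC k, ∏ V ∈ τ.1.parts, cum ρ y a V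

end Cumulants

theorem prod_parts {α M : Type*} [DecidableEq α] [CommMonoid M] {S : Finset α}
    (τ : Finpartition S) (f : α → M) : ∏ u ∈ S, f u = ∏ V ∈ τ.parts, ∏ u ∈ V, f u := by
  conv_lhs => rw [← τ.biUnion_parts]
  exact Finset.prod_biUnion τ.supIndep.pairwiseDisjoint

/-- The sum of the squares over `p` has finite expectation, so it is almost surely finite and its
terms tend to zero. Nothing is needed about the joint law for different `p`. -/
theorem ae_tendsto_zero_of_summable {Ω : Type*} [MeasurableSpace Ω] {P : Measure Ω}
    {f : ℕ → Ω → ℝ} (hm : ∀ p, Measurable (f p)) (hi : ∀ p, Integrable (fun ω => f p ω ^ 2) P)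
    (hs : Summable fun p => ∫ ω, f p ω ^ 2 ∂P) :
    ∀ᵐ ω ∂P, Tendsto (fun p => f p ω) atTop (𝓝 0) := by
  have h1 : ∫⁻ ω, ∑' p, ENNReal.ofReal (f p ω ^ 2) ∂P ≠ ∞ := by
    rw [lintegral_tsum fun p => ((hm p).pow_const 2).ennreal_ofReal.aemeasurable]
    have : ∀ p, ∫⁻ ω, ENNReal.ofReal (f p ω ^ 2) ∂P = ENNReal.ofReal (∫ ω, f p ω ^ 2 ∂P) :=
      fun p => (ofReal_integral_eq_lintegral_ofReal (hi p) (ae_of_all _ fun ω => sq_nonneg _)).symm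
    simp only [this]
    exact hs.tsum_ofReal_ne_top
  filter_upwards [ae_lt_top' (AEMeasurable.tsum fun p =>
    ((hm p).pow_const 2).ennreal_ofReal.aemeasurable) h1] with ω hω
  have h2 := ENNReal.tendsto_atTop_zero_of_tsum_ne_top hω.ne
  have h3 := (ENNReal.tendsto_toReal ENNReal.zero_ne_top).comp h2
  simp only [Function.comp_def, ENNReal.toReal_ofReal (sq_nonneg _), ENNReal.toReal_zero] at h3
  have h4 := h3.sqrt
  simp only [Real.sqrt_sq_eq_abs, Real.sqrt_zero] at h4
  exact (tendsto_zero_iff_abs_tendsto_zero _).2 h4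

/-! ### The matrices as a coloured array of pairs, and the limits of the normalized walk counts. -/

section Limits

variable {Ω : Type*} [MeasurableSpace Ω] {P : Measure Ω}
    {t : ℕ} {n : Fin t → ℕ → ℕ}
    {X Y : (l : Fin t) → (p : ℕ) → Ω → Matrix (Fin p) (Fin (n l p)) ℝ} {ρ y : Fin t → ℝ}

/-- The columns of all the matrices side by side; the first component `l` is the colour of a column.
-/
abbrev Col (n : Fin t → ℕ → ℕ) (p : ℕ) : Type := (l : Fin t) × Fin (n l p)

def entry (X Y : (l : Fin t) → (p : ℕ) → Ω → Matrix (Fin p) (Fin (n l p)) ℝ) (p : ℕ)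
    (e : Fin p × Col n p) (b : Bool) (ω : Ω) : ℝ :=
  if b then Y e.2.1 p ω e.1 e.2.2 else X e.2.1 p ω e.1 e.2.2

theorem EntryAssumptions.exists_pairArray [IsProbabilityMeasure P]
    (h : EntryAssumptions P n X Y ρ) :
    ∃ B : ℕ → ℝ, ∀ p, PairArray P (entry X Y p) (fun e => ρ e.2.1) B := by
  choose B hB using h.moments
  -- The bound has to be uniform in `p` and `l`, so it sums the bounds over `l`; the `1` covers the
  -- moment of order `0`.
  refine ⟨fun m => 1 + ∑ l, if hm : 1 ≤ m then |B l m hm| else 0, fun p => ?_⟩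
  have hnn : ∀ m, 0 ≤ ∑ l, if hm : 1 ≤ m then |B l m hm| else 0 := fun m =>
    Finset.sum_nonneg fun l _ => by split_ifs <;> positivity
  have hle : ∀ l m (hm : 1 ≤ m), B l m hm ≤ 1 + ∑ l, if hm : 1 ≤ m then |B l m hm| else 0 := by
    intro l m hm
    have h1 := Finset.single_le_sum (f := fun l => if hm : 1 ≤ m then |B l m hm| else 0)
      (fun l _ => by split_ifs <;> positivity) (Finset.mem_univ l)
    simp only [dif_pos hm] at h1 ⊢
    linarith [le_abs_self (B l m hm)]
  refine ⟨?_, ?_, ?_, ?_, ?_, ?_, ?_, ?_⟩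
  · rintro ⟨i, l, j⟩ b
    cases b
    · exact h.measurable_X l p i j
    · exact h.measurable_Y l p i j
  · let g : Fin p × Col n p → (l : Fin t) × (Fin p × Fin (n l p)) := fun e => ⟨e.2.1, e.1, e.2.2⟩
    have hg : Function.Injective g := by
      rintro ⟨i, l, j⟩ ⟨i', l', j'⟩ heq
      simp only [g, Sigma.mk.injEq] at heq
      obtain ⟨rfl, heq⟩ := heq
      have heq := eq_of_heq heq
      rw [Prod.mk.injEq] at heq
      rw [heq.1, heq.2]
    exact (h.indep p).precomp hg
  · rintro ⟨i, l, j⟩ b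
    cases b
    · exact h.mean_X l p i j
    · exact h.mean_Y l p i j
  · rintro ⟨i, l, j⟩ b
    cases b
    · exact h.var_X l p i j
    · exact h.var_Y l p i j
  · rintro ⟨i, l, j⟩
    exact h.corr l p i j
  · rintro ⟨i, l, j⟩ b m
    rcases Nat.eq_zero_or_pos m with rfl | hm
    · simp
    obtain ⟨h1, h2, -⟩ := hB l m hm p i j
    cases b
    · exact h1
    · exact h2
  · rintro ⟨i, l, j⟩ b m
    rcases Nat.eq_zero_or_pos m with rfl | hm
    · have := hnn 0
      simp
    obtain ⟨h1, h2, h3⟩ := hB l m hm p i j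
    rw [integral_add h1 h2] at h3
    have h4 : 0 ≤ ∫ ω, |X l p ω i j| ^ m ∂P := integral_nonneg fun ω => by positivity
    have h5 : 0 ≤ ∫ ω, |Y l p ω i j| ^ m ∂P := integral_nonneg fun ω => by positivity
    have h6 := hle l m hm
    cases b
    · simp only [entry, Bool.false_eq_true, if_false]
      linarith
    · simp only [entry, if_true]
      linarith
  · intro m
    have := hnn m
    linarith

omit [MeasurableSpace Ω] in
theorem adj_crossCov_apply (p : ℕ) (ω : Ω) (l : Fin t) (b : Bool) (i i' : Fin p) :
    adj (crossCov (X l p ω) (Y l p ω)) b i i' = (n l p : ℝ)⁻¹ *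
      ∑ q ∈ Finset.univ.filter fun q : Col n p => q.1 = l,
        entry X Y p (i, q) b ω * entry X Y p (i', q) (!b) ω := by
  have h1 : (Finset.univ.filter fun q : Col n p => q.1 = l)
      = Finset.univ.map (Function.Embedding.sigmaMk l) := by
    ext ⟨l', j⟩
    simp only [Finset.mem_filter, Finset.mem_univ, true_and, Finset.mem_map,
      Function.Embedding.sigmaMk_apply]
    constructor
    · rintro rfl
      exact ⟨j, rfl⟩
    · rintro ⟨j', hj⟩
      exact (congrArg Sigma.fst hj).symm
  rw [h1, Finset.sum_map]
  cases b
  · simp [adj, crossCov, Matrix.mul_apply, entry]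
    exact Or.inl rfl
  · simp [adj, crossCov, Matrix.mul_apply, entry, Matrix.star_apply, mul_comm]
    exact Or.inl rfl

/-- The normalized trace of the word `a` in the matrices `C_l` and their transposes. -/
def wordTrace (X Y : (l : Fin t) → (p : ℕ) → Ω → Matrix (Fin p) (Fin (n l p)) ℝ) {k : ℕ}
    (a : Fin k → Fin t × Bool) (p : ℕ) (ω : Ω) : ℝ :=
  (p : ℝ)⁻¹ * (List.ofFn fun u =>
    adj (crossCov (X (a u).1 p ω) (Y (a u).1 p ω)) (a u).2).prod.trace

variable {k : ℕ} (a : Fin k → Fin t × Bool)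

def wordScale (n : Fin t → ℕ → ℕ) (a : Fin k → Fin t × Bool) (p : ℕ) : ℝ :=
  ∏ u, (n (a u).1 p : ℝ)⁻¹

omit [MeasurableSpace Ω] in
theorem wordTrace_eq (p : ℕ) (ω : Ω) : wordTrace X Y a p ω = (p : ℝ)⁻¹ * (wordScale n a p *
    ∑ w ∈ walks (Sigma.fst : Col n p → Fin t) (Fin p) (fun u => (a u).1),
      walkTerm (entry X Y p) (fun u => (a u).2) w.1 w.2 ω) := by
  rw [wordTrace, trace_prod_eq Sigma.fst (entry X Y p) ω (fun u => (a u).1) (fun u => (a u).2)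
    (fun u => (n (a u).1 p : ℝ)⁻¹) _ fun u i i' => adj_crossCov_apply p ω _ _ i i']
  rfl

theorem wordScale_nonneg (p : ℕ) : 0 ≤ wordScale n a p :=
  Finset.prod_nonneg fun _ _ => by positivity

def totalSize (n : Fin t → ℕ → ℕ) (p : ℕ) : ℕ := p + ∑ l, n l p

theorem card_add_card (p : ℕ) :
    Fintype.card (Fin p) + Fintype.card (Col n p) = totalSize n p := by
  simp [totalSize, Fintype.card_sigma]

theorem tendsto_inv_ratio (hy : ∀ l, 0 < y l)
    (hpn : ∀ l, Tendsto (fun p : ℕ => (p : ℝ) / (n l p : ℝ)) atTop (𝓝 (y l))) (l : Fin t) :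
    Tendsto (fun p : ℕ => (n l p : ℝ) / (p : ℝ)) atTop (𝓝 (y l)⁻¹) := by
  have := (hpn l).inv₀ (hy l).ne'
  simpa using this

/-- All dimensions are proportional: `N / n_l` tends to `(1 + ∑ 1 / y_l') y_l`, where `N` is the
total size. This turns counts of order `N ^ k` into bounded quantities. -/
theorem exists_wordScale_mul_le (hy : ∀ l, 0 < y l)
    (hpn : ∀ l, Tendsto (fun p : ℕ => (p : ℝ) / (n l p : ℝ)) atTop (𝓝 (y l))) :
    ∃ K : ℝ, ∀ᶠ p in atTop, wordScale n a p * (totalSize n p : ℝ) ^ k ≤ K := by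
  have h1 : ∀ l, Tendsto (fun p : ℕ => (totalSize n p : ℝ) * (n l p : ℝ)⁻¹) atTop
      (𝓝 ((1 + ∑ l', (y l')⁻¹) * y l)) := by
    intro l
    have h2 : Tendsto (fun p : ℕ => (1 + ∑ l', (n l' p : ℝ) / p) * ((p : ℝ) / n l p)) atTop
        (𝓝 ((1 + ∑ l', (y l')⁻¹) * y l)) :=
      (tendsto_const_nhds.add (tendsto_finsetSum _ fun l' _ =>
        tendsto_inv_ratio hy hpn l')).mul (hpn l)
    refine h2.congr' ?_
    filter_upwards [eventually_gt_atTop 0] with p hp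
    have hp' : (p : ℝ) ≠ 0 := by positivity
    rw [totalSize]
    push_cast
    rw [← Finset.sum_div]
    field_simp
  have h3 : Tendsto (fun p => wordScale n a p * (totalSize n p : ℝ) ^ k) atTop
      (𝓝 (∏ u, ((1 + ∑ l', (y l')⁻¹) * y (a u).1))) := by
    have := tendsto_finsetProd (Finset.univ : Finset (Fin k)) fun u _ => h1 (a u).1
    refine this.congr fun p => ?_
    rw [Finset.prod_mul_distrib, wordScale, mul_comm]
    simp
  exact ⟨_, (h3.eventually (eventually_lt_nhds (lt_add_one _))).mono fun _ h => h.le⟩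

/-- By `card_attachedWalks` the expression factors over the blocks. A block `V` of colour `l`
contributes `(n_l / p) (p / n_l) ^ |V|` times its correlations, and a block with two colours
contributes zero, as no column has two colours. -/
theorem tendsto_card_attachedWalks (hy : ∀ l, 0 < y l)
    (hpn : ∀ l, Tendsto (fun p : ℕ => (p : ℝ) / (n l p : ℝ)) atTop (𝓝 (y l)))
    (τ : Finpartition (Finset.univ : Finset (Fin k))) :
    Tendsto (fun p : ℕ => (p : ℝ)⁻¹ * (wordScale n a p *
      ((attachedWalks (Fin p) (Sigma.fst : Col n p → Fin t) (fun u => (a u).1) τ).card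
        * weight ρ (fun u => (a u).1) (fun u => (a u).2) τ)))
      atTop (𝓝 (∏ V ∈ τ.parts, cum ρ y a V)) := by
  classical
  have hw : weight ρ (fun u => (a u).1) (fun u => (a u).2) τ
      = ∏ V ∈ τ.parts, ∏ u ∈ V, if (a u).2 = (a (nxtIn V u)).2 then ρ (a u).1 else 1 := by
    rw [weight, prod_parts τ]
    refine Finset.prod_congr rfl fun V hV => Finset.prod_congr rfl fun u hu => ?_
    rw [nxt, τ.part_eq_of_mem hV hu]
  have hone : ∀ V ∈ τ.parts, Tendsto (fun p : ℕ =>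
      ((Finset.univ.filter fun q : Col n p => ∀ u ∈ V, q.1 = (a u).1).card : ℝ) / p *
        (∏ u ∈ V, (p : ℝ) / n (a u).1 p) *
        ∏ u ∈ V, if (a u).2 = (a (nxtIn V u)).2 then ρ (a u).1 else 1) atTop
      (𝓝 (cum ρ y a V)) := by
    intro V hV
    have hne := τ.nonempty_of_mem_parts hV
    rw [cum, dif_pos hne]
    refine Tendsto.mul_const _ ?_
    split_ifs with hmono
    · set l := (a (V.min' hne)).1
      have hl : ∀ u ∈ V, (a u).1 = l := fun u hu => hmono u hu _ (Finset.min'_mem _ _)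
      have h1 : ∀ p, (Finset.univ.filter fun q : Col n p => ∀ u ∈ V, q.1 = (a u).1).card
          = n l p := by
        intro p
        have : (Finset.univ.filter fun q : Col n p => ∀ u ∈ V, q.1 = (a u).1)
            = Finset.univ.map (Function.Embedding.sigmaMk l) := by
          ext ⟨l', j⟩
          simp only [Finset.mem_filter, Finset.mem_univ, true_and, Finset.mem_map,
            Function.Embedding.sigmaMk_apply]
          constructor
          · intro h
            obtain rfl : l' = l := h _ (Finset.min'_mem _ hne)
            exact ⟨j, rfl⟩
          · rintro ⟨j', hj⟩ u hu
            rw [hl u hu]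
            exact (congrArg Sigma.fst hj).symm
        rw [this, Finset.card_map, Finset.card_univ, Fintype.card_fin]
      have h2 : ∀ p : ℕ, ∏ u ∈ V, (p : ℝ) / n (a u).1 p = ((p : ℝ) / n l p) ^ V.card := by
        intro p
        rw [Finset.prod_congr rfl fun u hu => by rw [hl u hu], Finset.prod_const]
      simp only [h1, h2, one_mul]
      have h3 := (tendsto_inv_ratio hy hpn l).mul ((hpn l).pow V.card)
      obtain ⟨c, hc⟩ : ∃ c, V.card = c + 1 := ⟨V.card - 1, by have := hne.card_pos; omega⟩
      have h4 : (y l)⁻¹ * y l ^ V.card = y l ^ (V.card - 1) := by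
        rw [hc, pow_succ, Nat.add_sub_cancel]
        field_simp [(hy l).ne']
      rwa [h4] at h3
    · have h1 : ∀ p, (Finset.univ.filter fun q : Col n p => ∀ u ∈ V, q.1 = (a u).1) = ∅ := by
        intro p
        refine Finset.filter_eq_empty_iff.2 fun q _ hq => hmono fun u hu v hv => ?_
        rw [← hq u hu, ← hq v hv]
      simp [h1]
  refine (tendsto_finsetProd τ.parts hone).congr' ?_
  filter_upwards [eventually_gt_atTop 0] with p hp
  have hp' : (p : ℝ) ≠ 0 := by positivity
  have hcard := card_attachedWalks (I := Fin p) (color := (Sigma.fst : Col n p → Fin t))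
    (fun u => (a u).1) τ
  rw [Fintype.card_fin] at hcard
  have hcard' : ((attachedWalks (Fin p) (Sigma.fst : Col n p → Fin t)
      (fun u => (a u).1) τ).card : ℝ) * (p : ℝ) ^ τ.parts.card = (p : ℝ) ^ (k + 1) *
      ∏ V ∈ τ.parts,
        ((Finset.univ.filter fun q : Col n p => ∀ u ∈ V, q.1 = (a u).1).card : ℝ) := by
    exact_mod_cast hcard
  rw [Finset.prod_mul_distrib, Finset.prod_mul_distrib, ← hw, ← prod_parts τ,
    Finset.prod_div_distrib, Finset.prod_const, Finset.prod_div_distrib, Finset.prod_const,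
    Finset.card_univ, Fintype.card_fin, wordScale, Finset.prod_inv_distrib]
  rw [← mul_assoc, ← mul_assoc]
  congr 1
  have hpk : (p : ℝ) ^ τ.parts.card ≠ 0 := pow_ne_zero _ hp'
  rw [div_mul_eq_mul_div, div_eq_iff hpk, mul_assoc, mul_assoc, hcard', pow_succ]
  field_simp

end Limits

/-! ### Convergence of the normalized traces of words -/

section Convergence

variable {Ω : Type*} [MeasurableSpace Ω] {P : Measure Ω} [IsProbabilityMeasure P]
    {t : ℕ} {n : Fin t → ℕ → ℕ}
    {X Y : (l : Fin t) → (p : ℕ) → Ω → Matrix (Fin p) (Fin (n l p)) ℝ} {ρ y : Fin t → ℝ}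
    {k : ℕ}

theorem EntryAssumptions.integral_wordTrace (h : EntryAssumptions P n X Y ρ)
    (a : Fin k → Fin t × Bool) (p : ℕ) :
    ∫ ω, wordTrace X Y a p ω ∂P = (p : ℝ)⁻¹ * (wordScale n a p *
    ∑ w ∈ walks (Sigma.fst : Col n p → Fin t) (Fin p) (fun u => (a u).1),
      ∫ ω, walkTerm (entry X Y p) (fun u => (a u).2) w.1 w.2 ω ∂P) := by
  obtain ⟨B, hB⟩ := h.exists_pairArray
  simp only [wordTrace_eq]
  have hint : ∀ w : (Fin (k + 1) → Fin p) × (Fin k → Col n p),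
      Integrable (walkTerm (entry X Y p) (fun u => (a u).2) w.1 w.2) P :=
    fun w => (hB p).integrable_monomial _ _
  rw [integral_const_mul, integral_const_mul, integral_finsetSum _ fun w _ => hint w]

/-- The attached walks give the limit; the small walks contribute a constant times `p⁻¹`. -/
theorem EntryAssumptions.tendsto_integral_wordTrace (h : EntryAssumptions P n X Y ρ)
    (hy : ∀ l, 0 < y l)
    (hpn : ∀ l, Tendsto (fun p : ℕ => (p : ℝ) / (n l p : ℝ)) atTop (𝓝 (y l)))
    (a : Fin k → Fin t × Bool) :
    Tendsto (fun p => ∫ ω, wordTrace X Y a p ω ∂P) atTop (𝓝 (mom ρ y a)) := by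
  obtain ⟨B, hB⟩ := h.exists_pairArray
  obtain ⟨K, hK⟩ := exists_wordScale_mul_le a hy hpn
  set D : ℝ := termBound B (2 * k) +
    ∑ τ : NC k, |weight ρ (fun u => (a u).1) (fun u => (a u).2) τ.1| with hD
  have hD0 : 0 ≤ D := by
    have := (hB 0).bound_nonneg (2 * k)
    refine add_nonneg ?_ (Finset.sum_nonneg fun _ _ => abs_nonneg _)
    unfold termBound
    positivity
  have hmain : Tendsto (fun p : ℕ => (p : ℝ)⁻¹ * (wordScale n a p * ∑ τ : NC k,
      ((attachedWalks (Fin p) (Sigma.fst : Col n p → Fin t) (fun u => (a u).1) τ.1).card : ℝ)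
        * weight ρ (fun u => (a u).1) (fun u => (a u).2) τ.1)) atTop (𝓝 (mom ρ y a)) := by
    simp only [Finset.mul_sum]
    exact tendsto_finsetSum _ fun τ _ => tendsto_card_attachedWalks a hy hpn τ.1
  have herr : Tendsto (fun p : ℕ => (p : ℝ)⁻¹ * (K * (k ^ (2 * k + 1) * D))) atTop (𝓝 0) := by
    have := (tendsto_inv_atTop_nhds_zero_nat (𝕜 := ℝ)).mul_const (K * (k ^ (2 * k + 1) * D))
    rwa [zero_mul] at this
  have hdiff : Tendsto (fun p : ℕ => ∫ ω, wordTrace X Y a p ω ∂P -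
      (p : ℝ)⁻¹ * (wordScale n a p * ∑ τ : NC k,
      ((attachedWalks (Fin p) (Sigma.fst : Col n p → Fin t) (fun u => (a u).1) τ.1).card : ℝ)
        * weight ρ (fun u => (a u).1) (fun u => (a u).2) τ.1)) atTop (𝓝 0) := by
    refine squeeze_zero_norm' ?_ herr
    filter_upwards [hK] with p hp
    rw [h.integral_wordTrace, ← mul_sub, ← mul_sub, Real.norm_eq_abs, abs_mul, abs_mul,
      abs_of_nonneg (wordScale_nonneg a p), abs_of_nonneg (by positivity : (0 : ℝ) ≤ (p : ℝ)⁻¹)]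
    refine mul_le_mul_of_nonneg_left ?_ (by positivity)
    have h1 := (hB p).abs_sum_walks_sub_le (fun u => (a u).1) (fun u => (a u).2)
    have h2 := card_smallWalks_le (I := Fin p) (J := Col n p) (k := k)
    rw [card_add_card] at h2
    have h3 : ((smallWalks k (Fin p) (Col n p)).card : ℝ)
        ≤ k ^ (2 * k + 1) * (totalSize n p : ℝ) ^ k := by exact_mod_cast h2
    calc _ ≤ wordScale n a p * ((smallWalks k (Fin p) (Col n p)).card * D) :=
          mul_le_mul_of_nonneg_left h1 (wordScale_nonneg a p)
      _ ≤ wordScale n a p * ((k ^ (2 * k + 1) * (totalSize n p : ℝ) ^ k) * D) := by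
          gcongr
          exact wordScale_nonneg a p
      _ = (wordScale n a p * (totalSize n p : ℝ) ^ k) * (k ^ (2 * k + 1) * D) := by ring
      _ ≤ _ := by gcongr
  have := hdiff.add hmain
  simpa using this

theorem EntryAssumptions.ae_tendsto_wordTrace (h : EntryAssumptions P n X Y ρ)
    (hy : ∀ l, 0 < y l)
    (hpn : ∀ l, Tendsto (fun p : ℕ => (p : ℝ) / (n l p : ℝ)) atTop (𝓝 (y l)))
    (a : Fin k → Fin t × Bool) :
    ∀ᵐ ω ∂P, Tendsto (fun p => wordTrace X Y a p ω) atTop (𝓝 (mom ρ y a)) := by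
  obtain ⟨B, hB⟩ := h.exists_pairArray
  obtain ⟨K, hK⟩ := exists_wordScale_mul_le a hy hpn
  have heq : ∀ p ω, wordTrace X Y a p ω - ∫ ω, wordTrace X Y a p ω ∂P =
      (p : ℝ)⁻¹ * (wordScale n a p *
        ((∑ w ∈ walks (Sigma.fst : Col n p → Fin t) (Fin p) (fun u => (a u).1),
          walkTerm (entry X Y p) (fun u => (a u).2) w.1 w.2 ω) -
        ∑ w ∈ walks (Sigma.fst : Col n p → Fin t) (Fin p) (fun u => (a u).1),
          ∫ ω, walkTerm (entry X Y p) (fun u => (a u).2) w.1 w.2 ω ∂P)) := by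
    intro p ω
    rw [h.integral_wordTrace, wordTrace_eq]
    ring
  set D : ℝ := termBound B (2 * k + 2 * k) + termBound B (2 * k) ^ 2 with hD
  have hD0 : 0 ≤ D := by
    have := (hB 0).bound_nonneg (2 * k + 2 * k)
    unfold D termBound
    positivity
  have hae : ∀ᵐ ω ∂P, Tendsto
      (fun p => wordTrace X Y a p ω - ∫ ω, wordTrace X Y a p ω ∂P) atTop (𝓝 0) := by
    refine ae_tendsto_zero_of_summable ?_ ?_ ?_
    · intro p
      simp only [heq]
      exact (((Finset.measurable_fun_sum _ fun w _ =>
        (hB p).measurable_monomial _ _).sub_const _).const_mul _).const_mul _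
    · intro p
      have h1 : ∀ w : (Fin (k + 1) → Fin p) × (Fin k → Col n p),
          MemLp (walkTerm (entry X Y p) (fun u => (a u).2) w.1 w.2) 2 P := by
        intro w
        have hm : Measurable (walkTerm (entry X Y p) (fun u => (a u).2) w.1 w.2) :=
          (hB p).measurable_monomial _ _
        rw [memLp_two_iff_integrable_sq hm.aestronglyMeasurable]
        simp only [sq, walkTerm_mul_walkTerm]
        exact (hB p).integrable_monomial _ _
      have h2 : MemLp (fun ω => wordTrace X Y a p ω - ∫ ω, wordTrace X Y a p ω ∂P) 2 P := by
        simp only [heq]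
        exact (((memLp_finsetSum _ fun w _ => h1 w).sub (memLp_const _)).const_mul _).const_mul _
      exact h2.integrable_sq
    · have hsum : Summable fun p : ℕ => 1 / (p : ℝ) ^ 2 * 
          (K ^ 2 * ((k + k : ℕ) ^ (2 * (2 * k + 1)) * D)) :=
        (Real.summable_one_div_nat_pow.2 one_lt_two).mul_right _
      -- The bound `K` on the scale holds only for large `p`, so the variances are compared with the
      -- series `∑ 1 / p ^ 2` only eventually.
      refine summable_of_isBigO_nat hsum (Asymptotics.IsBigO.of_bound 1 ?_)
      filter_upwards [hK] with p hp
      have hnn : 0 ≤ ∫ ω, (wordTrace X Y a p ω - ∫ ω, wordTrace X Y a p ω ∂P) ^ 2 ∂P :=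
        integral_nonneg fun ω => sq_nonneg _
      rw [Real.norm_of_nonneg hnn, Real.norm_of_nonneg (by positivity), one_mul]
      have h1 := (hB p).variance_sum_walks_le (color := (Sigma.fst : Col n p → Fin t))
        (fun u => (a u).1) (fun u => (a u).2)
      have h2 := card_smallPairs_le (I := Fin p) (J := Col n p) (k := k)
      rw [card_add_card] at h2
      have h3 : ((smallPairs k (Fin p) (Col n p)).card : ℝ)
          ≤ (k + k : ℕ) ^ (2 * (2 * k + 1)) * (totalSize n p : ℝ) ^ (k + k) := by exact_mod_cast h2
      have hc := wordScale_nonneg (n := n) a p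
      simp only [heq, mul_pow]
      rw [integral_const_mul, integral_const_mul]
      calc _ ≤ (p : ℝ)⁻¹ ^ 2 * (wordScale n a p ^ 2 *
              ((smallPairs k (Fin p) (Col n p)).card * D)) := by gcongr
        _ ≤ (p : ℝ)⁻¹ ^ 2 * (wordScale n a p ^ 2 *
              (((k + k : ℕ) ^ (2 * (2 * k + 1)) * (totalSize n p : ℝ) ^ (k + k)) * D)) := by
            gcongr
        _ = 1 / (p : ℝ) ^ 2 * ((wordScale n a p * (totalSize n p : ℝ) ^ k) ^ 2 *
              ((k + k : ℕ) ^ (2 * (2 * k + 1)) * D)) := by ring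
        _ ≤ _ := by gcongr
  filter_upwards [hae] with ω hω
  have := hω.add (h.tendsto_integral_wordTrace hy hpn a)
  simpa using this

end Convergence

/-! ### Moebius inversion over the non-crossing partitions -/

section Moebius

/-- Non-crossing partitions of a finite subset of a linear order. -/
def IsNCOn {α : Type*} [LinearOrder α] {S : Finset α} (π : Finpartition S) : Prop :=
  ∀ V ∈ π.parts, ∀ W ∈ π.parts, ∀ i j k l : α, i < j → j < k → k < l →
    i ∈ V → k ∈ V → j ∈ W → l ∈ W → V = W

open Classical in
-- Arbitrary finite sets are needed because expanding the moment of a block produces partitions of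
-- that block.
def ncOn {α : Type*} [LinearOrder α] (S : Finset α) : Finset (Finpartition S) :=
  Finset.univ.filter IsNCOn

theorem mem_ncOn {α : Type*} [LinearOrder α] {S : Finset α} {π : Finpartition S} :
    π ∈ ncOn S ↔ IsNCOn π := by
  simp [ncOn]

theorem sum_NC_eq {k : ℕ} {M : Type*} [AddCommMonoid M]
    (g : Finpartition (Finset.univ : Finset (Fin k)) → M) :
    ∑ π : NC k, g π.1 = ∑ π ∈ ncOn (Finset.univ : Finset (Fin k)), g π := by
  refine Finset.sum_bij (fun π _ => π.1) (fun π _ => mem_ncOn.2 π.2)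
    (fun π _ π' _ h => Subtype.ext h) (fun π hπ => ⟨⟨π, mem_ncOn.1 hπ⟩, Finset.mem_univ _, rfl⟩)
    fun _ _ => rfl

/-! ### Transport of partitions along order embeddings. -/

section Transport

variable {α β : Type*} [LinearOrder α] [LinearOrder β]

/-- The image of a partition under an order embedding. -/
def mapPartition (f : α ↪o β) {S : Finset α} (π : Finpartition S) :
    Finpartition (S.map f.toEmbedding) :=
  Finpartition.ofExistsUnique (π.parts.image fun V => V.map f.toEmbedding)
    (by
      intro W hW
      obtain ⟨V, hV, rfl⟩ := Finset.mem_image.1 hW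
      exact Finset.map_subset_map.2 (π.le hV))
    (by
      intro b hb
      obtain ⟨a, ha, rfl⟩ := Finset.mem_map.1 hb
      obtain ⟨V, ⟨hV, haV⟩, huniq⟩ := π.existsUnique_mem ha
      refine ⟨V.map f.toEmbedding, ⟨Finset.mem_image_of_mem _ hV,
        Finset.mem_map_of_mem _ haV⟩, ?_⟩
      rintro W ⟨hW, haW⟩
      obtain ⟨V', hV', rfl⟩ := Finset.mem_image.1 hW
      rw [huniq V' ⟨hV', (Finset.mem_map' _).1 haW⟩])
    (by
      intro h
      obtain ⟨V, hV, hVe⟩ := Finset.mem_image.1 h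
      rw [Finset.map_eq_empty] at hVe
      exact π.ne_empty hV hVe)

theorem mem_mapPartition {f : α ↪o β} {S : Finset α} {π : Finpartition S} {W : Finset β} :
    W ∈ (mapPartition f π).parts ↔ ∃ V ∈ π.parts, V.map f.toEmbedding = W :=
  Finset.mem_image

/-- The preimage of a partition under an order embedding. -/
def comapPartition (f : α ↪o β) {S : Finset α} (π : Finpartition (S.map f.toEmbedding)) :
    Finpartition S :=
  Finpartition.ofExistsUnique (π.parts.image fun W => S.filter fun a => f a ∈ W)
    (by
      intro V hV
      obtain ⟨W, hW, rfl⟩ := Finset.mem_image.1 hV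
      exact Finset.filter_subset _ _)
    (by
      intro a ha
      obtain ⟨W, ⟨hW, haW⟩, huniq⟩ := π.existsUnique_mem (Finset.mem_map_of_mem f.toEmbedding ha)
      refine ⟨S.filter fun a => f a ∈ W, ⟨Finset.mem_image_of_mem _ hW,
        Finset.mem_filter.2 ⟨ha, haW⟩⟩, ?_⟩
      rintro V ⟨hV, haV⟩
      obtain ⟨W', hW', rfl⟩ := Finset.mem_image.1 hV
      rw [huniq W' ⟨hW', (Finset.mem_filter.1 haV).2⟩])
    (by
      intro h
      obtain ⟨W, hW, hWe⟩ := Finset.mem_image.1 h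
      obtain ⟨b, hb⟩ := π.nonempty_of_mem_parts hW
      obtain ⟨a, ha, rfl⟩ := Finset.mem_map.1 (π.le hW hb)
      exact Finset.notMem_empty a (hWe ▸ Finset.mem_filter.2 ⟨ha, hb⟩))

theorem mapPartition_injective (f : α ↪o β) {S : Finset α} :
    Function.Injective (mapPartition f (S := S)) := by
  intro π π' h
  have hsub : ∀ {π π' : Finpartition S}, mapPartition f π = mapPartition f π' →
      π.parts ⊆ π'.parts := by
    intro π π' h V hV
    have : V.map f.toEmbedding ∈ (mapPartition f π').parts :=
      h ▸ mem_mapPartition.2 ⟨V, hV, rfl⟩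
    obtain ⟨V', hV', heq⟩ := mem_mapPartition.1 this
    rwa [← Finset.map_injective _ heq]
  exact Finpartition.ext (Finset.Subset.antisymm (hsub h) (hsub h.symm))

theorem map_comapPartition (f : α ↪o β) {S : Finset α} (π : Finpartition (S.map f.toEmbedding)) :
    mapPartition f (comapPartition f π) = π := by
  have key : ∀ W ∈ π.parts, (S.filter fun a => f a ∈ W).map f.toEmbedding = W := by
    intro W hW
    ext b
    simp only [Finset.mem_map, Finset.mem_filter]
    constructor
    · rintro ⟨a, ⟨-, ha⟩, rfl⟩
      exact ha
    · intro hb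
      obtain ⟨a, ha, rfl⟩ := Finset.mem_map.1 (π.le hW hb)
      exact ⟨a, ⟨ha, hb⟩, rfl⟩
  refine Finpartition.ext (Finset.ext fun W => ?_)
  rw [mem_mapPartition]
  constructor
  · rintro ⟨V, hV, rfl⟩
    obtain ⟨W', hW', rfl⟩ := Finset.mem_image.1 hV
    rwa [key W' hW']
  · intro hW
    exact ⟨_, Finset.mem_image_of_mem _ hW, key W hW⟩

theorem isNCOn_mapPartition (f : α ↪o β) {S : Finset α} {π : Finpartition S} :
    IsNCOn (mapPartition f π) ↔ IsNCOn π := by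
  constructor
  · intro h V hV W hW i j k l hij hjk hkl hi hk hj hl
    refine Finset.map_injective f.toEmbedding (h _ (mem_mapPartition.2 ⟨V, hV, rfl⟩) _
      (mem_mapPartition.2 ⟨W, hW, rfl⟩) (f i) (f j) (f k) (f l) (f.lt_iff_lt.2 hij)
      (f.lt_iff_lt.2 hjk) (f.lt_iff_lt.2 hkl) ?_ ?_ ?_ ?_) <;>
    exact (Finset.mem_map' _).2 (by assumption)
  · intro h V' hV' W' hW' i' j' k' l' hij hjk hkl hi' hk' hj' hl'
    obtain ⟨V, hV, rfl⟩ := mem_mapPartition.1 hV'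
    obtain ⟨W, hW, rfl⟩ := mem_mapPartition.1 hW'
    obtain ⟨i, hi, rfl⟩ := Finset.mem_map.1 hi'
    obtain ⟨j, hj, rfl⟩ := Finset.mem_map.1 hj'
    obtain ⟨k, hk, rfl⟩ := Finset.mem_map.1 hk'
    obtain ⟨l, hl, rfl⟩ := Finset.mem_map.1 hl'
    rw [h V hV W hW i j k l (f.lt_iff_lt.1 hij) (f.lt_iff_lt.1 hjk) (f.lt_iff_lt.1 hkl) hi hk hj hl]

theorem sum_ncOn_map {M : Type*} [CommSemiring M] (f : α ↪o β) (S : Finset α)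
    (g : Finset β → M) :
    ∑ π ∈ ncOn S, ∏ V ∈ π.parts, g (V.map f.toEmbedding)
      = ∑ π ∈ ncOn (S.map f.toEmbedding), ∏ W ∈ π.parts, g W := by
  refine Finset.sum_bij (fun π _ => mapPartition f π)
    (fun π hπ => mem_ncOn.2 ((isNCOn_mapPartition f).2 (mem_ncOn.1 hπ)))
    (fun π _ π' _ h => mapPartition_injective f h)
    (fun π hπ => ⟨comapPartition f π, mem_ncOn.2 ((isNCOn_mapPartition f).1 ?_),
      map_comapPartition f π⟩) ?_
  · rw [map_comapPartition]
    exact mem_ncOn.1 hπ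
  · intro π _
    exact (Finset.prod_image fun V _ V' _ h => Finset.map_injective _ h).symm

end Transport

/-! ### Refinements of a non-crossing partition, block by block. -/

section Refinement

variable {α : Type*} [LinearOrder α] {S : Finset α}

/-- The blocks of `π` inside a block `V` of a coarser partition. -/
def restrictTo {σ π : Finpartition S} (h : π ≤ σ) {V : Finset α} (hV : V ∈ σ.parts) :
    Finpartition V :=
  Finpartition.ofExistsUnique (π.parts.filter (· ⊆ V))
    (fun _ hW => (Finset.mem_filter.1 hW).2)
    (by
      intro a ha
      obtain ⟨W, ⟨hW, haW⟩, huniq⟩ := π.existsUnique_mem (σ.le hV ha)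
      obtain ⟨V', hV', hWV'⟩ := h hW
      have : V' = V := (σ.existsUnique_mem (σ.le hV ha)).unique ⟨hV', hWV' haW⟩ ⟨hV, ha⟩
      subst this
      exact ⟨W, ⟨Finset.mem_filter.2 ⟨hW, hWV'⟩, haW⟩,
        fun W' hW' => huniq W' ⟨(Finset.mem_filter.1 hW'.1).1, hW'.2⟩⟩)
    (fun h => π.ne_empty (Finset.mem_filter.1 h).1 rfl)

theorem mem_restrictTo {σ π : Finpartition S} {h : π ≤ σ} {V : Finset α} {hV : V ∈ σ.parts}
    {W : Finset α} : W ∈ (restrictTo h hV).parts ↔ W ∈ π.parts ∧ W ⊆ V :=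
  Finset.mem_filter

theorem bind_le (σ : Finpartition S) (Q : ∀ V ∈ σ.parts, Finpartition V) : σ.bind Q ≤ σ := by
  intro W hW
  obtain ⟨V, hV, hWV⟩ := Finpartition.mem_bind.1 hW
  exact ⟨V, hV, (Q V hV).le hWV⟩

theorem block_unique {σ : Finpartition S} {V V' W : Finset α} (hV : V ∈ σ.parts)
    (hV' : V' ∈ σ.parts) (hW : W.Nonempty) (h : W ⊆ V) (h' : W ⊆ V') : V = V' := by
  obtain ⟨a, ha⟩ := hW
  exact (σ.existsUnique_mem (σ.le hV (h ha))).unique ⟨hV, h ha⟩ ⟨hV', h' ha⟩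

theorem IsNCOn.bind {σ : Finpartition S} (hσ : IsNCOn σ) {Q : ∀ V ∈ σ.parts, Finpartition V}
    (hQ : ∀ V hV, IsNCOn (Q V hV)) : IsNCOn (σ.bind Q) := by
  intro V hV W hW i j k l hij hjk hkl hi hk hj hl
  obtain ⟨V', hV', hVV'⟩ := Finpartition.mem_bind.1 hV
  obtain ⟨W', hW', hWW'⟩ := Finpartition.mem_bind.1 hW
  have h1 := (Q V' hV').le hVV'
  have h2 := (Q W' hW').le hWW'
  have h3 := hσ V' hV' W' hW' i j k l hij hjk hkl (h1 hi) (h1 hk) (h2 hj) (h2 hl)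
  subst h3
  exact hQ V' hV' V hVV' W hWW' i j k l hij hjk hkl hi hk hj hl

open Classical in
-- A non-crossing refinement of `σ` amounts to a non-crossing partition of each block of `σ`:
-- `Finpartition.bind` assembles these, and `restrictTo` recovers them.
theorem prod_sum_ncOn {M : Type*} [CommSemiring M] {σ : Finpartition S} (hσ : IsNCOn σ)
    (g : Finset α → M) :
    ∏ V ∈ σ.parts, ∑ π ∈ ncOn V, ∏ W ∈ π.parts, g W
      = ∑ π ∈ (ncOn S).filter (· ≤ σ), ∏ W ∈ π.parts, g W := by
  rw [Finset.prod_sum]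
  refine Finset.sum_bij' (fun Q _ => σ.bind Q)
    (fun π hπ V hV => restrictTo (Finset.mem_filter.1 hπ).2 hV) ?_ ?_ ?_ ?_ ?_
  · intro Q hQ
    rw [Finset.mem_pi] at hQ
    exact Finset.mem_filter.2 ⟨mem_ncOn.2 (hσ.bind fun V hV => mem_ncOn.1 (hQ V hV)), bind_le σ Q⟩
  · intro π hπ
    rw [Finset.mem_pi]
    intro V hV
    have h := mem_ncOn.1 (Finset.mem_filter.1 hπ).1
    rw [mem_ncOn]
    intro A hA B hB
    exact h A (mem_restrictTo.1 hA).1 B (mem_restrictTo.1 hB).1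
  · intro Q hQ
    funext V hV
    refine Finpartition.ext (Finset.ext fun W => ?_)
    rw [mem_restrictTo, Finpartition.mem_bind]
    constructor
    · rintro ⟨⟨V', hV', hW⟩, hWV⟩
      have := block_unique hV hV' ((Q V' hV').nonempty_of_mem_parts hW) hWV ((Q V' hV').le hW)
      subst this
      exact hW
    · intro hW
      exact ⟨⟨V, hV, hW⟩, (Q V hV).le hW⟩
  · intro π hπ
    refine Finpartition.ext (Finset.ext fun W => ?_)
    rw [Finpartition.mem_bind]
    constructor
    · rintro ⟨V, hV, hW⟩
      exact (mem_restrictTo.1 hW).1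
    · intro hW
      obtain ⟨V, hV, hWV⟩ := (Finset.mem_filter.1 hπ).2 hW
      exact ⟨V, hV, mem_restrictTo.2 ⟨hW, hWV⟩⟩
  · intro Q hQ
    rw [Finpartition.bind_parts, Finset.prod_biUnion]
    rintro ⟨V, hV⟩ _ ⟨V', hV'⟩ _ hne
    rw [Function.onFun, Finset.disjoint_left]
    intro W hW hW'
    exact hne (Subtype.ext (block_unique hV hV' ((Q V hV).nonempty_of_mem_parts hW)
      ((Q V hV).le hW) ((Q V' hV').le hW')))

end Refinement

theorem cum_map {t : ℕ} (ρ y : Fin t → ℝ) {α β : Type*} [LinearOrder α] [LinearOrder β]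
    (f : α ↪o β) (a : β → Fin t × Bool) (V : Finset α) :
    cum ρ y a (V.map f.toEmbedding) = cum ρ y (fun u => a (f u)) V := by
  unfold cum
  rw [Finset.prod_map, Finset.card_map]
  congr 1
  · congr 1
    · simp
    · by_cases h : V.Nonempty
      · rw [dif_pos h, dif_pos (Finset.map_nonempty.2 h)]
        congr 3
        obtain ⟨u, hu, hu'⟩ := Finset.mem_map.1
          ((V.map f.toEmbedding).min'_mem (Finset.map_nonempty.2 h))
        rw [← hu']
        refine congrArg (fun w => a (f w)) (le_antisymm ?_ (Finset.min'_le _ _ hu))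
        have := Finset.min'_le _ _ (Finset.mem_map_of_mem f.toEmbedding (V.min'_mem h))
        rw [← hu'] at this
        exact f.le_iff_le.1 this
      · rw [dif_neg h, dif_neg (fun h' => h (Finset.map_nonempty.1 h'))]
  · refine Finset.prod_congr rfl fun u hu => ?_
    rw [show f.toEmbedding u = f u from rfl, nxtIn_map f V hu]

theorem map_sort_eq_ofFn {α M : Type*} [LinearOrder α] (V : Finset α) (z : α → M) :
    (V.sort (· ≤ ·)).map z = List.ofFn fun u => z (V.orderEmbOfFin rfl u) := by
  refine List.ext_getElem (by simp) fun m h1 h2 => ?_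
  simp [Finset.orderEmbOfFin_apply]

variable {A : Type*} [Ring A] [StarRing A] [Algebra ℂ A] {t : ℕ} {ρ y : Fin t → ℝ}

omit [StarRing A] in
-- A block moment is the moment of the subword on that block, relabelled increasingly; `cum` depends
-- only on the relative order of positions (`cum_map`), so its expansion becomes a sum over
-- partitions of the block.
theorem partitionMoment_eq (φ : A →ₗ[ℂ] ℂ) (z : Fin t × Bool → A)
    (hφ : ∀ (k : ℕ) (a : Fin k → Fin t × Bool),
      φ (List.ofFn fun u => z (a u)).prod = (mom ρ y a : ℂ))
    {k : ℕ} (a : Fin k → Fin t × Bool) (σ : NC k) [DecidablePred fun π : NC k => π ≤ σ] :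
    partitionMoment φ (fun u => z (a u)) σ
      = ∑ π ∈ Finset.univ.filter fun π : NC k => π ≤ σ,
        ∏ V ∈ π.1.parts, (cum ρ y a V : ℂ) := by
  classical
  have h1 : ∀ V : Finset (Fin k), blockMoment φ (fun u => z (a u)) V
      = ∑ π ∈ ncOn V, ∏ W ∈ π.parts, (cum ρ y a W : ℂ) := by
    intro V
    have h2 : (Finset.univ : Finset (Fin V.card)).map (V.orderEmbOfFin rfl).toEmbedding = V := by
      ext x
      simp
    rw [blockMoment, map_sort_eq_ofFn, hφ _ fun u => a (V.orderEmbOfFin rfl u), mom,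
      sum_NC_eq fun π => ∏ V ∈ π.parts, cum ρ y _ V]
    conv_rhs => rw [← h2]
    rw [← sum_ncOn_map (V.orderEmbOfFin rfl) Finset.univ fun W => (cum ρ y a W : ℂ)]
    push_cast
    simp only [cum_map]
  rw [partitionMoment]
  simp only [h1]
  rw [prod_sum_ncOn (M := ℂ) σ.2 fun W => (cum ρ y a W : ℂ)]
  symm
  refine Finset.sum_bij (fun π _ => π.1)
    (fun π hπ => Finset.mem_filter.2 ⟨mem_ncOn.2 π.2, (Finset.mem_filter.1 hπ).2⟩)
    (fun π _ π' _ h => Subtype.ext h)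
    (fun π hπ => ⟨⟨π, mem_ncOn.1 (Finset.mem_filter.1 hπ).1⟩,
      Finset.mem_filter.2 ⟨Finset.mem_univ _, (Finset.mem_filter.1 hπ).2⟩, rfl⟩)
    fun _ _ => rfl

omit [StarRing A] in
-- After the sums are exchanged, the coefficient of `π` is the sum of `μ(σ, 1)` over `π ≤ σ ≤ 1`,
-- which vanishes unless `π` is the one-block partition.
theorem freeCumulant_eq (φ : A →ₗ[ℂ] ℂ) (z : Fin t × Bool → A)
    (hφ : ∀ (k : ℕ) (a : Fin k → Fin t × Bool),
      φ (List.ofFn fun u => z (a u)).prod = (mom ρ y a : ℂ))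
    {k : ℕ} (hk : 1 ≤ k) (a : Fin k → Fin t × Bool) :
    freeCumulant φ (fun u => z (a u)) = (cum ρ y a Finset.univ : ℂ) := by
  classical
  have htop : ∀ σ : NC k, σ ≤ NC.one k := fun σ => (le_top : σ.1 ≤ ⊤)
  rw [freeCumulant]
  simp only [partitionMoment_eq φ z hφ a]
  calc _ = ∑ σ : NC k, ∑ π : NC k, if π ≤ σ then
        (∏ V ∈ π.1.parts, (cum ρ y a V : ℂ)) * IncidenceAlgebra.mu ℂ σ (NC.one k) else 0 := by
        refine Finset.sum_congr rfl fun σ _ => ?_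
        rw [Finset.sum_mul, Finset.sum_filter]
    _ = ∑ π : NC k, (∏ V ∈ π.1.parts, (cum ρ y a V : ℂ)) *
          ∑ σ ∈ Finset.Icc π (NC.one k), IncidenceAlgebra.mu ℂ σ (NC.one k) := by
        rw [Finset.sum_comm]
        refine Finset.sum_congr rfl fun π _ => ?_
        rw [← Finset.sum_filter, ← Finset.mul_sum]
        congr 1
        refine Finset.sum_congr ?_ fun _ _ => rfl
        ext σ
        simp [htop]
    _ = ∏ V ∈ (NC.one k).1.parts, (cum ρ y a V : ℂ) := by
        simp only [IncidenceAlgebra.sum_Icc_mu_left]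
        simp
    _ = _ := by
        have hne : (Finset.univ : Finset (Fin k)) ≠ ∅ :=
          Finset.Nonempty.ne_empty ⟨⟨0, hk⟩, Finset.mem_univ _⟩
        have : (NC.one k).1.parts = {Finset.univ} := by
          refine Finset.Subset.antisymm (Finpartition.parts_top_subset _) ?_
          have h1 := Finpartition.parts_top_subset (Finset.univ : Finset (Fin k))
          obtain ⟨V, hV⟩ := (⊤ : Finpartition (Finset.univ : Finset (Fin k))).parts_nonempty hne
          have h2 := Finset.mem_singleton.1 (h1 hV)
          exact Finset.singleton_subset_iff.2 (h2 ▸ hV)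
        rw [this, Finset.prod_singleton]

theorem isFreeFamily_of_mom (φ : A →ₗ[ℂ] ℂ) (c : Fin t → A)
    (hφ : ∀ (k : ℕ) (a : Fin k → Fin t × Bool),
      φ (List.ofFn fun u => adj (c (a u).1) (a u).2).prod = (mom ρ y a : ℂ)) :
    IsFreeFamily φ c := by
  rintro k α η ⟨u, v, huv⟩
  have hk : 1 ≤ k := by have := u.2; omega
  rw [freeCumulant_eq φ (fun x => adj (c x.1) x.2) hφ hk fun u => (α u, η u), cum,
    if_neg fun h => huv (h u (Finset.mem_univ u) v (Finset.mem_univ v))]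
  simp

theorem isCrossCovVariable_of_mom (φ : A →ₗ[ℂ] ℂ) (c : Fin t → A)
    (hφ : ∀ (k : ℕ) (a : Fin k → Fin t × Bool),
      φ (List.ofFn fun u => adj (c (a u).1) (a u).2).prod = (mom ρ y a : ℂ)) (l : Fin t) :
    IsCrossCovVariable φ (c l) (ρ l) (y l) := by
  intro k hk η
  rw [freeCumulant_eq φ (fun x => adj (c x.1) x.2) hφ hk fun u => (l, η u), cum,
    if_pos fun u _ v _ => rfl, dif_pos ⟨⟨0, hk⟩, Finset.mem_univ _⟩]
  have h1 : ∏ u : Fin k, (if η u = η (nxtIn Finset.univ u) then ρ l else 1)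
      = ρ l ^ cyclicAgreements η := by
    rw [cyclicAgreements, ← Finset.prod_pow_eq_pow_sum]
    refine Finset.prod_congr rfl fun u _ => ?_
    rw [nxtIn_univ_eq_finRotate]
    split_ifs <;> simp
  simp only [h1, one_mul, Finset.card_univ, Fintype.card_fin]
  push_cast
  -- With `0 ^ 0 = 1` the two cases of the definition are a single formula.
  by_cases h2 : ρ l ≠ 0
  · rw [if_pos h2]
  · rw [if_neg h2, not_not.1 h2, Complex.ofReal_zero, zero_pow_eq]

end Moebius

/-! ### Exponential growth of the moments -/

section Growth

variable {k : ℕ}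

/-- `v` is the predecessor of `u` in its block. -/
def IsPred (τ : Finpartition (Finset.univ : Finset (Fin k))) (v u : Fin k) : Prop :=
  v < u ∧ τ.part v = τ.part u ∧ ∀ x, v < x → x < u → τ.part x ≠ τ.part u

theorem exists_isPred {τ : Finpartition (Finset.univ : Finset (Fin k))} {x u : Fin k}
    (hxu : x < u) (hx : τ.part x = τ.part u) : ∃ v, x ≤ v ∧ IsPred τ v u := by
  have hne : ((τ.part u).filter (· < u)).Nonempty :=
    ⟨x, Finset.mem_filter.2 ⟨mem_part_comm.2 hx, hxu⟩⟩
  obtain ⟨h1, h2⟩ := Finset.mem_filter.1 (Finset.max'_mem _ hne)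
  refine ⟨_, Finset.le_max' _ _ (Finset.mem_filter.2 ⟨mem_part_comm.2 hx, hxu⟩), h2,
    mem_part_comm.1 h1, fun z hz hzu hzp => ?_⟩
  exact absurd (Finset.le_max' _ _ (Finset.mem_filter.2 ⟨mem_part_comm.2 hzp, hzu⟩)) (not_le.2 hz)

theorem exists_isPred_right {τ : Finpartition (Finset.univ : Finset (Fin k))} {x u : Fin k}
    (hxu : x < u) (hx : τ.part x = τ.part u) : ∃ w, IsPred τ x w := by
  obtain ⟨h1, h2⟩ := nxtIn_of_lt (V := τ.part x) (mem_part_comm.2 hx.symm) hxu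
  have h3 := mem_part_comm.1 (nxt_mem_part τ x)
  refine ⟨nxt τ x, h1, h3.symm, fun z hz hzu hzp => ?_⟩
  exact absurd (h2 z (mem_part_comm.2 (hzp.trans h3)) hz) (not_le.2 hzu)

/-- Whether the block of `u` has elements beyond `u`, and whether it has elements before `u`. -/
def code (τ : NC k) (u : Fin k) : Prop × Prop :=
  (∃ v, u < v ∧ τ.1.part u = τ.1.part v, ∃ v, v < u ∧ τ.1.part v = τ.1.part u)

/-- Suppose `v < v' < u`. By the code, `v'` also has a successor `w` in its `τ`-block. If `w < u`,
induction makes `v'` the `τ'`-predecessor of `w`, so it cannot be that of `u`; `w = u` contradicts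
the choice of `v`; and `w > u` makes the blocks cross. -/
theorem pred_le_of_code_eq {τ τ' : NC k} (h : ∀ u, code τ u = code τ' u) {u v v' : Fin k}
    (hv : IsPred τ.1 v u) (hv' : IsPred τ'.1 v' u)
    (ih : ∀ w < u, ∀ x, IsPred τ.1 x w → IsPred τ'.1 x w) : v' ≤ v := by
  by_contra hlt
  push Not at hlt
  have h1 : (code τ' v').1 := ⟨u, hv'.1, hv'.2.1⟩
  rw [← h v'] at h1
  obtain ⟨z, hz, hzp⟩ := h1
  obtain ⟨w, hw⟩ := exists_isPred_right hz hzp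
  have hnot := hv.2.2 v' hlt hv'.1
  rcases lt_trichotomy w u with hwu | rfl | huw
  · have h2 := ih w hwu v' hw
    exact hv'.2.2 w h2.1 hwu (h2.2.1.symm.trans hv'.2.1)
  · exact hnot hw.2.1
  · exact hnot ((τ.2.part_eq hlt hv'.1 huw hv.2.1 hw.2.1).symm.trans hv.2.1)

theorem isPred_of_code_eq : ∀ (u : Fin k) {τ τ' : NC k}, (∀ u, code τ u = code τ' u) → ∀ v,
    IsPred τ.1 v u → IsPred τ'.1 v u := by
  intro u
  induction u using WellFoundedLT.induction with
  | ind u ih =>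
  intro τ τ' h v hv
  have h1 : (code τ u).2 := ⟨v, hv.1, hv.2.1⟩
  rw [h u] at h1
  obtain ⟨x, hxu, hx⟩ := h1
  obtain ⟨v', -, hv'⟩ := exists_isPred hxu hx
  have h2 := pred_le_of_code_eq h hv hv' fun w hw x => ih w hw h x
  have h3 := pred_le_of_code_eq (fun u => (h u).symm) hv' hv
    fun w hw x => ih w hw (fun u => (h u).symm) x
  rwa [le_antisymm h3 h2]

/-- A non-crossing partition is recovered from its code as a bracketing is: each element with a
predecessor is linked to the nearest one still waiting for a successor. -/
theorem code_injective : Function.Injective (code (k := k)) := by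
  have key : ∀ (u : Fin k) {τ τ' : NC k}, (∀ u, code τ u = code τ' u) → ∀ v ≤ u,
      τ.1.part v = τ.1.part u → τ'.1.part v = τ'.1.part u := by
    intro u
    induction u using WellFoundedLT.induction with
    | ind u ih =>
    intro τ τ' h v hvu hv
    rcases hvu.eq_or_lt with rfl | hlt
    · rfl
    obtain ⟨x, hvx, hx⟩ := exists_isPred hlt hv
    have h1 := isPred_of_code_eq u h x hx
    exact (ih x hx.1 h v hvx (hv.trans hx.2.1.symm)).trans h1.2.1
  have key2 : ∀ {τ τ' : NC k}, (∀ u, code τ u = code τ' u) → ∀ u v,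
      τ.1.part v = τ.1.part u → τ'.1.part v = τ'.1.part u := by
    intro τ τ' h u v hv
    rcases le_total v u with hle | hle
    · exact key u h v hle hv
    · exact (key v h u hle hv.symm).symm
  intro τ τ' h
  have h : ∀ u, code τ u = code τ' u := congrFun h
  refine Subtype.ext (ext_of_part fun u => Finset.ext fun v => ?_)
  rw [mem_part_comm, mem_part_comm]
  exact ⟨key2 h u v, key2 (fun u => (h u).symm) u v⟩

theorem card_NC_le : Fintype.card (NC k) ≤ 4 ^ k := by
  classical
  have := Fintype.card_le_of_injective _ (code_injective (k := k))
  rwa [Fintype.card_fun, Fintype.card_fin, Fintype.card_prod, Fintype.card_prop] at this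

variable {t : ℕ} (ρ y : Fin t → ℝ)

/-- A growth rate for the moments. -/
def growth : ℝ := 4 * ((1 + ∑ l, |ρ l|) * (1 + ∑ l, |y l|))

theorem growth_pos : 0 < growth ρ y := by
  unfold growth
  positivity

theorem abs_cum_le (a : Fin k → Fin t × Bool) (V : Finset (Fin k)) :
    |cum ρ y a V| ≤ ((1 + ∑ l, |ρ l|) * (1 + ∑ l, |y l|)) ^ V.card := by
  have hρ : ∀ l, |ρ l| ≤ 1 + ∑ l, |ρ l| := fun l => by
    have := Finset.single_le_sum (f := fun l => |ρ l|) (fun l _ => abs_nonneg _)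
      (Finset.mem_univ l)
    linarith
  have hy : ∀ l, |y l| ≤ 1 + ∑ l, |y l| := fun l => by
    have := Finset.single_le_sum (f := fun l => |y l|) (fun l _ => abs_nonneg _)
      (Finset.mem_univ l)
    linarith
  have hρ1 : 1 ≤ 1 + ∑ l, |ρ l| := le_add_of_nonneg_right (by positivity)
  have hy1 : 1 ≤ 1 + ∑ l, |y l| := le_add_of_nonneg_right (by positivity)
  rw [cum, abs_mul, abs_mul, mul_pow, mul_comm (_ ^ _)]
  refine mul_le_mul ?_ ?_ (abs_nonneg _) (by positivity)
  · rw [← one_mul ((1 + ∑ l, |y l|) ^ V.card)]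
    refine mul_le_mul ?_ ?_ (abs_nonneg _) zero_le_one
    · split_ifs <;> simp
    · split_ifs
      · rw [abs_pow]
        exact (pow_le_pow_left₀ (abs_nonneg _) (hy _) _).trans
          (pow_le_pow_right₀ hy1 (Nat.sub_le _ _))
      · rw [abs_one]
        exact one_le_pow₀ hy1
  · rw [Finset.abs_prod, ← Finset.prod_const]
    refine Finset.prod_le_prod (fun _ _ => abs_nonneg _) fun u _ => ?_
    split_ifs
    · exact hρ _
    · rwa [abs_one]

theorem abs_mom_le (a : Fin k → Fin t × Bool) : |mom ρ y a| ≤ growth ρ y ^ k := by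
  set K := (1 + ∑ l, |ρ l|) * (1 + ∑ l, |y l|) with hK
  have hK0 : 0 ≤ K := by positivity
  have h1 : ∀ τ : NC k, |∏ V ∈ τ.1.parts, cum ρ y a V| ≤ K ^ k := by
    intro τ
    rw [Finset.abs_prod]
    refine (Finset.prod_le_prod (fun _ _ => abs_nonneg _) fun V _ => abs_cum_le ρ y a V).trans ?_
    rw [Finset.prod_pow_eq_pow_sum, τ.1.sum_card_parts, Finset.card_univ, Fintype.card_fin]
  calc |mom ρ y a| ≤ ∑ τ : NC k, |∏ V ∈ τ.1.parts, cum ρ y a V| := Finset.abs_sum_le_sum_abs _ _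
    _ ≤ ∑ _τ : NC k, K ^ k := Finset.sum_le_sum fun τ _ => h1 τ
    _ = Fintype.card (NC k) * K ^ k := by simp
    _ ≤ 4 ^ k * K ^ k := by
        refine mul_le_mul_of_nonneg_right ?_ (pow_nonneg hK0 k)
        exact_mod_cast card_NC_le
    _ = growth ρ y ^ k := by rw [growth, ← mul_pow]

end Growth

/-! ### The method of moments -/

section Moments

/-- The derivative of the remainder of order `n + 1` is `I` times the remainder of order `n`, so the
mean value inequality carries the bound upwards. -/
theorem norm_cexp_sub_sum_le_of_nonneg (n : ℕ) :
    ∀ x : ℝ, 0 ≤ x → ‖Complex.exp (x * Complex.I) -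
      ∑ k ∈ Finset.range n, (x * Complex.I) ^ k / (k.factorial : ℂ)‖ ≤ x ^ n / n.factorial := by
  induction n with
  | zero => intro x _; simp [Complex.norm_exp_ofReal_mul_I]
  | succ n ih =>
    intro x hx
    have hd : ∀ s : ℝ, HasDerivAt (fun s : ℝ => Complex.exp (s * Complex.I) -
        ∑ k ∈ Finset.range (n + 1), (s * Complex.I) ^ k / (k.factorial : ℂ))
        ((Complex.exp (s * Complex.I) -
        ∑ k ∈ Finset.range n, (s * Complex.I) ^ k / (k.factorial : ℂ)) * Complex.I) s := by
      intro s
      have h0 : HasDerivAt (fun s : ℝ => (s : ℂ) * Complex.I) (1 * Complex.I) s :=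
        (Complex.ofRealCLM.hasDerivAt (x := s)).mul_const _
      rw [one_mul] at h0
      rw [sub_mul]
      refine h0.cexp.sub ?_
      simp only [Finset.sum_range_succ']
      rw [Finset.sum_mul]
      simp only [pow_zero]
      refine HasDerivAt.add_const _ (HasDerivAt.fun_sum fun k _ => ?_)
      refine ((h0.pow (k + 1)).div_const (((k + 1).factorial : ℕ) : ℂ)).congr_deriv ?_
      rw [Nat.factorial_succ]
      have h1 : ((k : ℂ) + 1) ≠ 0 := by exact_mod_cast k.succ_ne_zero
      have h2 : (k.factorial : ℂ) ≠ 0 := by exact_mod_cast k.factorial_ne_zero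
      push_cast
      field_simp
    have hB : ∀ s : ℝ, HasDerivAt (fun s : ℝ => s ^ (n + 1) / ((n + 1).factorial : ℝ))
        (s ^ n / (n.factorial : ℝ)) s := by
      intro s
      refine ((hasDerivAt_pow (n + 1) s).div_const ((n + 1).factorial : ℝ)).congr_deriv ?_
      rw [Nat.factorial_succ]
      have h1 : ((n : ℝ) + 1) ≠ 0 := by positivity
      have h2 : (n.factorial : ℝ) ≠ 0 := by exact_mod_cast n.factorial_ne_zero
      push_cast
      field_simp
    refine image_norm_le_of_norm_deriv_right_le_deriv_boundary (a := 0) (b := x)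
      (fun s _ => (hd s).continuousAt.continuousWithinAt)
      (fun s _ => (hd s).hasDerivWithinAt) ?_ hB ?_ ⟨hx, le_rfl⟩
    · simp [Finset.sum_range_succ']
    · intro s hs
      rw [norm_mul, Complex.norm_I, mul_one]
      exact ih s hs.1

theorem norm_cexp_sub_sum_le (n : ℕ) (x : ℝ) :
    ‖Complex.exp (x * Complex.I) -
      ∑ k ∈ Finset.range n, (x * Complex.I) ^ k / (k.factorial : ℂ)‖ ≤ |x| ^ n / n.factorial := by
  rcases le_total 0 x with hx | hx
  · rw [abs_of_nonneg hx]
    exact norm_cexp_sub_sum_le_of_nonneg n x hx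
  · rw [abs_of_nonpos hx, ← Complex.norm_conj]
    convert norm_cexp_sub_sum_le_of_nonneg n (-x) (neg_nonneg.2 hx) using 2
    rw [map_sub, map_sum, ← Complex.exp_conj]
    simp

/-- The expansion stops at an even order so that the remainder is bounded by a moment rather than an
absolute moment. -/
theorem charFun_sub_sum_le (ν : ProbabilityMeasure ℝ)
    (hint : ∀ k : ℕ, Integrable (fun x : ℝ => x ^ k) (ν : Measure ℝ)) (N : ℕ) (s : ℝ) :
    ‖charFun (ν : Measure ℝ) s - ∑ k ∈ Finset.range (2 * N),
      (s * Complex.I) ^ k / (k.factorial : ℂ) * ((∫ x : ℝ, x ^ k ∂(ν : Measure ℝ) : ℝ) : ℂ)‖ ≤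
      s ^ (2 * N) / (2 * N).factorial * ∫ x : ℝ, x ^ (2 * N) ∂(ν : Measure ℝ) := by
  have hint' : ∀ k : ℕ, Integrable (fun x : ℝ => (s * Complex.I) ^ k / (k.factorial : ℂ) *
      ((x ^ k : ℝ) : ℂ)) (ν : Measure ℝ) := fun k => (hint k).ofReal.const_mul _
  have h1 : Integrable (fun x : ℝ => Complex.exp (s * x * Complex.I)) (ν : Measure ℝ) := by
    refine Integrable.of_bound (by fun_prop) 1 (ae_of_all _ fun x => ?_)
    rw [← Complex.ofReal_mul, Complex.norm_exp_ofReal_mul_I]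
  have h2 : charFun (ν : Measure ℝ) s - ∑ k ∈ Finset.range (2 * N),
      (s * Complex.I) ^ k / (k.factorial : ℂ) * ((∫ x : ℝ, x ^ k ∂(ν : Measure ℝ) : ℝ) : ℂ) =
      ∫ x : ℝ, (Complex.exp (s * x * Complex.I) - ∑ k ∈ Finset.range (2 * N),
        (s * Complex.I) ^ k / (k.factorial : ℂ) * ((x ^ k : ℝ) : ℂ)) ∂(ν : Measure ℝ) := by
    rw [integral_sub h1 (integrable_finsetSum _ fun k _ => hint' k), charFun_apply_real,
      integral_finsetSum _ fun k _ => hint' k]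
    congr 1
    refine Finset.sum_congr rfl fun k _ => ?_
    rw [integral_const_mul]
    exact congrArg _ integral_ofReal.symm
  rw [h2, ← integral_const_mul]
  refine norm_integral_le_of_norm_le ((hint _).const_mul _) (ae_of_all _ fun x => ?_)
  have h3 := norm_cexp_sub_sum_le (2 * N) (s * x)
  rw [(even_two_mul N).pow_abs, mul_pow, mul_div_right_comm] at h3
  refine le_trans (le_of_eq ?_) h3
  congr 2
  · push_cast; rfl
  · refine Finset.sum_congr rfl fun k _ => ?_
    push_cast
    ring

/-- A measure with exponentially bounded moments is determined by them, and convergence of moments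
to such a limit implies weak convergence. -/
theorem tendsto_of_tendsto_moments {R : ℝ} {ν : ℕ → ProbabilityMeasure ℝ}
    {μ : ProbabilityMeasure ℝ}
    (hint : ∀ p (k : ℕ), Integrable (fun x : ℝ => x ^ k) (ν p : Measure ℝ))
    (hμ : ∀ k : ℕ, Integrable (fun x : ℝ => x ^ k) (μ : Measure ℝ))
    (hR : ∀ k : ℕ, ∫ x : ℝ, x ^ k ∂(μ : Measure ℝ) ≤ R ^ k)
    (hlim : ∀ k : ℕ, Tendsto (fun p => ∫ x : ℝ, x ^ k ∂(ν p : Measure ℝ)) atTop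
      (𝓝 (∫ x : ℝ, x ^ k ∂(μ : Measure ℝ)))) : Tendsto ν atTop (𝓝 μ) := by
  rw [ProbabilityMeasure.tendsto_iff_tendsto_charFun]
  intro s
  rw [Metric.tendsto_atTop']
  intro ε hε
  have hN : Tendsto (fun N : ℕ => (s * R) ^ (2 * N) / ((2 * N).factorial : ℝ)) atTop (𝓝 0) :=
    (FloorSemiring.tendsto_pow_div_factorial_atTop (s * R)).comp
      (tendsto_id.const_mul_atTop' two_pos)
  -- The order `N` is fixed before `p`: it makes the remainder for `μ` smaller than `ε / 4`.
  -- Convergence of the moment of order `2N` then controls the remainders for `ν p` as well.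
  obtain ⟨N, hN⟩ := (hN.eventually_lt_const (show (0 : ℝ) < ε / 4 by positivity)).exists
  set T : ℝ := s ^ (2 * N) / ((2 * N).factorial : ℝ) with hT
  have hT0 : 0 ≤ T := by rw [hT, pow_mul]; positivity
  have hl : Tendsto (fun p => T * (∫ x : ℝ, x ^ (2 * N) ∂(ν p : Measure ℝ)) +
      ‖∑ k ∈ Finset.range (2 * N), (s * Complex.I) ^ k / (k.factorial : ℂ) *
        ((∫ x : ℝ, x ^ k ∂(ν p : Measure ℝ) : ℝ) : ℂ) - ∑ k ∈ Finset.range (2 * N),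
        (s * Complex.I) ^ k / (k.factorial : ℂ) * ((∫ x : ℝ, x ^ k ∂(μ : Measure ℝ) : ℝ) : ℂ)‖)
      atTop (𝓝 (T * (∫ x : ℝ, x ^ (2 * N) ∂(μ : Measure ℝ)) + ‖(0 : ℂ)‖)) := by
    refine ((hlim _).const_mul T).add (Tendsto.norm ?_)
    rw [← sub_self (∑ k ∈ Finset.range (2 * N), (s * Complex.I) ^ k / (k.factorial : ℂ) *
      ((∫ x : ℝ, x ^ k ∂(μ : Measure ℝ) : ℝ) : ℂ))]
    refine Tendsto.sub_const (tendsto_finsetSum _ fun k _ => Tendsto.const_mul _ ?_) _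
    exact (Complex.continuous_ofReal.tendsto _).comp (hlim k)
  have hb : T * (∫ x : ℝ, x ^ (2 * N) ∂(μ : Measure ℝ)) < ε / 4 := by
    refine (mul_le_mul_of_nonneg_left (hR _) hT0).trans_lt ?_
    rwa [hT, div_mul_eq_mul_div, ← mul_pow]
  rw [norm_zero, add_zero] at hl
  obtain ⟨p₀, hp₀⟩ := eventually_atTop.1 (hl.eventually_lt_const hb)
  refine ⟨p₀, fun p hp => ?_⟩
  have h1 := hp₀ p hp.le
  have h2 := charFun_sub_sum_le (ν p) (hint p) N s
  have h3 := charFun_sub_sum_le μ hμ N s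
  rw [← hT] at h2 h3
  rw [dist_eq_norm]
  set a := charFun (ν p : Measure ℝ) s
  set b := charFun (μ : Measure ℝ) s
  set a' := ∑ k ∈ Finset.range (2 * N), (s * Complex.I) ^ k / (k.factorial : ℂ) *
        ((∫ x : ℝ, x ^ k ∂(ν p : Measure ℝ) : ℝ) : ℂ)
  set b' := ∑ k ∈ Finset.range (2 * N), (s * Complex.I) ^ k / (k.factorial : ℂ) *
        ((∫ x : ℝ, x ^ k ∂(μ : Measure ℝ) : ℝ) : ℂ)
  have h4 : a - b = (a - a') + (a' - b') - (b - b') := by ring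
  rw [h4]
  have h5 := norm_sub_le ((a - a') + (a' - b')) (b - b')
  have h6 := norm_add_le (a - a') (a' - b')
  linarith

theorem isTight_of_second_moment {ν : ℕ → ProbabilityMeasure ℝ} {B : ℝ}
    (hint : ∀ p, Integrable (fun x : ℝ => x ^ 2) (ν p : Measure ℝ))
    (hB : ∀ p, ∫ x : ℝ, x ^ 2 ∂(ν p : Measure ℝ) ≤ B) :
    IsTightMeasureSet {((μ : ProbabilityMeasure ℝ) : Measure ℝ) | μ ∈ Set.range ν} := by
  rw [isTightMeasureSet_iff_exists_isCompact_measure_compl_le]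
  intro ε hε
  rcases eq_or_ne ε ⊤ with rfl | hε'
  · exact ⟨∅, isCompact_empty, fun _ _ => le_top⟩
  have he : 0 < ε.toReal := ENNReal.toReal_pos hε.ne' hε'
  -- As `a ≥ 1` implies `a ≤ a ^ 2`, Chebyshev's bound `B / a ^ 2` is at most `B / a`, which is at
  -- most `ε`; no square root is required.
  set a : ℝ := max 1 (B / ε.toReal) with ha
  have ha1 : 1 ≤ a := le_max_left _ _
  refine ⟨Set.Icc (-a) a, isCompact_Icc, ?_⟩
  rintro _ ⟨_, ⟨p, rfl⟩, rfl⟩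
  have h1 := mul_meas_ge_le_integral_of_nonneg (μ := (ν p : Measure ℝ))
    (ae_of_all _ fun x : ℝ => sq_nonneg x) (hint p) (a ^ 2)
  have h2 : (ν p : Measure ℝ).real (Set.Icc (-a) a)ᶜ ≤
      (ν p : Measure ℝ).real {x : ℝ | a ^ 2 ≤ x ^ 2} := by
    refine measureReal_mono fun x hx => ?_
    by_contra h
    rw [Set.mem_ofPred_eq, not_le] at h
    exact hx (abs_le.1 (abs_le_of_sq_le_sq h.le (by linarith)))
  have h3 : (ν p : Measure ℝ).real (Set.Icc (-a) a)ᶜ ≤ ε.toReal := by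
    have h4 : a * (ν p : Measure ℝ).real (Set.Icc (-a) a)ᶜ ≤ a * ε.toReal := by
      calc a * (ν p : Measure ℝ).real (Set.Icc (-a) a)ᶜ
          ≤ a ^ 2 * (ν p : Measure ℝ).real (Set.Icc (-a) a)ᶜ := by
            refine mul_le_mul_of_nonneg_right ?_ measureReal_nonneg
            nlinarith
        _ ≤ a ^ 2 * (ν p : Measure ℝ).real {x : ℝ | a ^ 2 ≤ x ^ 2} :=
            mul_le_mul_of_nonneg_left h2 (sq_nonneg a)
        _ ≤ B := h1.trans (hB p)
        _ = B / ε.toReal * ε.toReal := by field_simp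
        _ ≤ a * ε.toReal := mul_le_mul_of_nonneg_right (le_max_right _ _) he.le
    exact le_of_mul_le_mul_left h4 (by linarith)
  rw [← ENNReal.ofReal_toReal hε', ← ofReal_measureReal]
  exact ENNReal.ofReal_le_ofReal h3

variable {l : Filter ℕ} [l.NeBot] {ν : ℕ → ProbabilityMeasure ℝ} {μ : ProbabilityMeasure ℝ}
  {m : ℕ → ℝ} {R : ℝ}

/-- Integrating the assumed bound and passing to the limit gives an error of at most `C (R / (R +
1)) ^ (2N)` for all large `N`, hence zero. With `r = 0` this locates the support of `μ`; with `r =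
1` it carries unbounded moments through the weak limit. -/
theorem integral_eq_of_bounded_dist
    (hν : Tendsto ν l (𝓝 μ))
    (hint : ∀ p (k : ℕ), Integrable (fun x : ℝ => x ^ k) (ν p : Measure ℝ))
    (hlim : ∀ k : ℕ, Tendsto (fun p => ∫ x : ℝ, x ^ k ∂(ν p : Measure ℝ)) l (𝓝 (m k)))
    (hR0 : 0 ≤ R) (hR : ∀ k, m k ≤ R ^ k) (g : BoundedContinuousFunction ℝ ℝ) (k : ℕ) (r C : ℝ)
    (hg : ∀ (x : ℝ) (N : ℕ), k ≤ 2 * N → |g x - r * x ^ k| ≤ C * (x / (R + 1)) ^ (2 * N)) :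
    ∫ x, g x ∂(μ : Measure ℝ) = r * m k := by
  have hC : 0 ≤ C := by
    have := (abs_nonneg _).trans (hg (R + 1) k (by omega))
    rwa [div_self (by positivity), one_pow, mul_one] at this
  have h1 : Tendsto (fun p => |∫ x, g x ∂(ν p : Measure ℝ) -
      r * ∫ x : ℝ, x ^ k ∂(ν p : Measure ℝ)|) l
      (𝓝 |∫ x, g x ∂(μ : Measure ℝ) - r * m k|) :=
    ((ProbabilityMeasure.tendsto_iff_forall_integral_tendsto.1 hν g).sub
      ((hlim k).const_mul r)).abs
  have h2 : ∀ N : ℕ, k ≤ 2 * N → |∫ x, g x ∂(μ : Measure ℝ) - r * m k| ≤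
      C * (R / (R + 1)) ^ (2 * N) := by
    intro N hN
    have h3 : |∫ x, g x ∂(μ : Measure ℝ) - r * m k| ≤ C * (m (2 * N) / (R + 1) ^ (2 * N)) := by
      refine le_of_tendsto_of_tendsto' h1 (((hlim (2 * N)).div_const _).const_mul C) fun p => ?_
      rw [← integral_const_mul, ← integral_sub (g.integrable _) ((hint p k).const_mul r),
        ← integral_div, ← integral_const_mul, ← Real.norm_eq_abs]
      refine norm_integral_le_of_norm_le (((hint p _).div_const _).const_mul _)
        (ae_of_all _ fun x => ?_)
      rw [← div_pow]
      exact hg x N hN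
    refine h3.trans (mul_le_mul_of_nonneg_left ?_ hC)
    rw [div_pow]
    exact div_le_div_of_nonneg_right (hR _) (by positivity)
  have h3 : Tendsto (fun N : ℕ => C * (R / (R + 1)) ^ (2 * N)) atTop (𝓝 (C * 0)) := by
    refine Tendsto.const_mul C ?_
    refine (tendsto_pow_atTop_nhds_zero_of_lt_one (by positivity) ?_).comp
      (tendsto_id.const_mul_atTop' two_pos)
    rw [div_lt_one (by positivity)]
    linarith
  have h4 := ge_of_tendsto h3 (eventually_atTop.2 ⟨k, fun N hN => h2 N (by omega)⟩)
  rw [mul_zero] at h4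
  exact sub_eq_zero.1 (abs_nonpos_iff.1 h4)

theorem ae_abs_le_of_tendsto (hν : Tendsto ν l (𝓝 μ))
    (hint : ∀ p (k : ℕ), Integrable (fun x : ℝ => x ^ k) (ν p : Measure ℝ))
    (hlim : ∀ k : ℕ, Tendsto (fun p => ∫ x : ℝ, x ^ k ∂(ν p : Measure ℝ)) l (𝓝 (m k)))
    (hR0 : 0 ≤ R) (hR : ∀ k, m k ≤ R ^ k) : ∀ᵐ x ∂(μ : Measure ℝ), |x| ≤ R + 1 := by
  have hf : ∀ x : ℝ, 0 ≤ max 0 (min 1 (|x| - (R + 1))) := fun x => le_max_left _ _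
  -- A bounded continuous function that is positive exactly where `|x| > R + 1`; its integral turns
  -- out to be zero.
  let g : BoundedContinuousFunction ℝ ℝ := BoundedContinuousFunction.ofNormedAddCommGroup
    (fun x : ℝ => max 0 (min 1 (|x| - (R + 1)))) (by fun_prop) 1 fun x => by
      rw [Real.norm_eq_abs, abs_of_nonneg (hf x)]
      exact max_le zero_le_one (min_le_left _ _)
  have hg : ∀ x, g x = max 0 (min 1 (|x| - (R + 1))) := fun _ => rfl
  have h := integral_eq_of_bounded_dist hν hint hlim hR0 hR g 0 0 1 fun x N _ => by
    rw [zero_mul, sub_zero, one_mul, hg, abs_of_nonneg (hf x)]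
    rcases le_or_gt |x| (R + 1) with hx | hx
    · rw [max_eq_left ((min_le_right _ _).trans (by linarith)), pow_mul]
      positivity
    · refine (max_le zero_le_one (min_le_left _ _)).trans ?_
      rw [← (even_two_mul N).pow_abs, abs_div, abs_of_pos (show 0 < R + 1 by linarith)]
      exact one_le_pow₀ ((one_le_div (by linarith)).2 hx.le)
  rw [zero_mul, integral_eq_zero_iff_of_nonneg (f := g) (fun x => hf x) (g.integrable _)] at h
  filter_upwards [h] with x hx
  by_contra hx'
  rw [not_le] at hx'
  have : 0 < g x := by
    rw [hg]
    exact lt_max_of_lt_right (lt_min one_pos (by linarith))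
  exact this.ne' hx

theorem moment_of_tendsto (hν : Tendsto ν l (𝓝 μ))
    (hint : ∀ p (k : ℕ), Integrable (fun x : ℝ => x ^ k) (ν p : Measure ℝ))
    (hlim : ∀ k : ℕ, Tendsto (fun p => ∫ x : ℝ, x ^ k ∂(ν p : Measure ℝ)) l (𝓝 (m k)))
    (hR0 : 0 ≤ R) (hR : ∀ k, m k ≤ R ^ k) (k : ℕ) :
    Integrable (fun x : ℝ => x ^ k) (μ : Measure ℝ) ∧ ∫ x : ℝ, x ^ k ∂(μ : Measure ℝ) = m k := by
  have hae := ae_abs_le_of_tendsto hν hint hlim hR0 hR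
  have hR1 : 0 < R + 1 := by linarith
  have hcl : ∀ x : ℝ, |max (-(R + 1)) (min x (R + 1))| ≤ R + 1 := fun x =>
    abs_le.2 ⟨le_max_left _ _, max_le (by linarith) (min_le_right _ _)⟩
  -- The power is cut off at `±(R + 1)`, which changes nothing `μ`-almost everywhere.
  let g : BoundedContinuousFunction ℝ ℝ := BoundedContinuousFunction.ofNormedAddCommGroup
    (fun x : ℝ => (max (-(R + 1)) (min x (R + 1))) ^ k) (by fun_prop) ((R + 1) ^ k) fun x => by
      rw [norm_pow, Real.norm_eq_abs]
      exact pow_le_pow_left₀ (abs_nonneg _) (hcl x) k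
  have hg : ∀ x, g x = (max (-(R + 1)) (min x (R + 1))) ^ k := fun _ => rfl
  have hgx : ∀ x, |x| ≤ R + 1 → g x = x ^ k := fun x hx => by
    rw [hg, min_eq_left (abs_le.1 hx).2, max_eq_right (abs_le.1 hx).1]
  have hga : g =ᵐ[(μ : Measure ℝ)] fun x => x ^ k := by
    filter_upwards [hae] with x hx using hgx x hx
  refine ⟨(g.integrable _).congr hga, ?_⟩
  rw [← integral_congr_ae hga, ← one_mul (m k)]
  refine integral_eq_of_bounded_dist hν hint hlim hR0 hR g k 1 (2 * (R + 1) ^ k) fun x N hN => ?_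
  rw [one_mul]
  rcases le_or_gt |x| (R + 1) with hx | hx
  · rw [hgx x hx, sub_self, abs_zero, pow_mul]
    positivity
  · have h1 : |g x| ≤ (R + 1) ^ k := by
      rw [hg, abs_pow]
      exact pow_le_pow_left₀ (abs_nonneg _) (hcl x) k
    have h2 : 1 ≤ |x| / (R + 1) := (one_le_div hR1).2 hx.le
    have h3 : |x ^ k| = (R + 1) ^ k * (|x| / (R + 1)) ^ k := by
      rw [abs_pow, ← mul_pow, mul_div_cancel₀ _ hR1.ne']
    have h4 : (x / (R + 1)) ^ (2 * N) = (|x| / (R + 1)) ^ (2 * N) := by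
      rw [← (even_two_mul N).pow_abs, abs_div, abs_of_pos hR1]
    have h5 : (|x| / (R + 1)) ^ k ≤ (|x| / (R + 1)) ^ (2 * N) := pow_le_pow_right₀ h2 hN
    have h6 : 1 ≤ (|x| / (R + 1)) ^ (2 * N) := one_le_pow₀ h2
    have h7 : 0 < (R + 1) ^ k := by positivity
    rw [h4]
    refine (abs_sub _ _).trans ?_
    rw [h3]
    nlinarith [mul_le_mul_of_nonneg_left h5 h7.le, mul_le_mul_of_nonneg_left h6 h7.le]

/-- A sequence of probability measures whose moments converge to exponentially bounded limits has
a compactly supported probability measure with the limiting moments. -/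
theorem exists_law_of_tendsto_moments
    (hint : ∀ p (k : ℕ), Integrable (fun x : ℝ => x ^ k) (ν p : Measure ℝ))
    (hlim : ∀ k : ℕ, Tendsto (fun p => ∫ x : ℝ, x ^ k ∂(ν p : Measure ℝ)) atTop (𝓝 (m k)))
    (hR0 : 0 ≤ R) (hR : ∀ k, m k ≤ R ^ k) :
    ∃ μ : ProbabilityMeasure ℝ, (μ : Measure ℝ) (Set.Icc (-(R + 1)) (R + 1))ᶜ = 0 ∧
      ∀ k : ℕ, Integrable (fun x : ℝ => x ^ k) (μ : Measure ℝ) ∧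
        ∫ x : ℝ, x ^ k ∂(μ : Measure ℝ) = m k := by
  obtain ⟨B, hB⟩ := (hlim 2).bddAbove_range
  have hc := isCompact_closure_of_isTightMeasureSet (isTight_of_second_moment
    (fun p => hint p 2) fun p => hB ⟨p, rfl⟩)
  -- Tightness makes the closure compact; a limit along a free ultrafilter replaces the choice of a
  -- subsequence.
  obtain ⟨μ, -, hμ⟩ := hc.ultrafilter_le_nhds ((hyperfilter ℕ).map ν)
    (le_principal_iff.2 (Filter.mem_map.2 (univ_mem' fun p => subset_closure ⟨p, rfl⟩)))
  have hν : Tendsto ν (hyperfilter ℕ) (𝓝 μ) := hμ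
  have hl : ∀ k : ℕ, Tendsto (fun p => ∫ x : ℝ, x ^ k ∂(ν p : Measure ℝ)) (hyperfilter ℕ)
      (𝓝 (m k)) := fun k => (hlim k).mono_left Nat.hyperfilter_le_atTop
  refine ⟨μ, ?_, moment_of_tendsto hν hint hl hR0 hR⟩
  refine measure_mono_null (fun x hx => ?_) (ae_iff.1 (ae_abs_le_of_tendsto hν hint hl hR0 hR))
  exact fun h => hx (abs_le.1 h)

end Moments

/-! ### Empirical spectral distributions -/

section EmpiricalSpectralDistribution

variable {p : ℕ} {M : Matrix (Fin p) (Fin p) ℝ}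

theorem isHermitian_of_isSymm (hM : M.IsSymm) : M.IsHermitian := by
  rw [Matrix.IsHermitian, Matrix.conjTranspose_eq_transpose_of_trivial]
  exact hM

theorem trace_pow_eq_sum_eigenvalues (hM : M.IsHermitian) (k : ℕ) :
    (M ^ k).trace = ∑ i, hM.eigenvalues i ^ k := by
  conv_lhs => rw [hM.spectral_theorem]
  rw [← map_pow, Unitary.conjStarAlgAut_apply, Matrix.trace_mul_cycle, Unitary.coe_star_mul_self,
    one_mul, Matrix.diagonal_pow, Matrix.trace_diagonal]
  rfl

theorem esdMeasure_eq_sum (hM : M.IsHermitian) :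
    esdMeasure M = (p : ℝ≥0∞)⁻¹ • ∑ i, Measure.dirac (hM.eigenvalues i) := by
  rw [esdMeasure, hM.roots_charpoly_eq_eigenvalues, Multiset.map_map]
  rfl

theorem isProbabilityMeasure_esdMeasure (hM : M.IsSymm) (hp : 0 < p) :
    IsProbabilityMeasure (esdMeasure M) := by
  refine ⟨?_⟩
  rw [esdMeasure_eq_sum (isHermitian_of_isSymm hM), Measure.smul_apply, Measure.finsetSum_apply]
  simp only [measure_univ, Finset.sum_const, Finset.card_univ, Fintype.card_fin, nsmul_eq_mul,
    mul_one, smul_eq_mul]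
  exact ENNReal.inv_mul_cancel (by exact_mod_cast hp.ne') (ENNReal.natCast_ne_top p)

theorem moments_esdMeasure (hM : M.IsSymm) (hp : 0 < p) (k : ℕ) :
    Integrable (fun x : ℝ => x ^ k) (esdMeasure M) ∧
      ∫ x : ℝ, x ^ k ∂(esdMeasure M) = (p : ℝ)⁻¹ * (M ^ k).trace := by
  have hH := isHermitian_of_isSymm hM
  have hint : ∀ i, Integrable (fun x : ℝ => x ^ k) (Measure.dirac (hH.eigenvalues i)) :=
    fun i => integrable_dirac (by simp)
  rw [esdMeasure_eq_sum hH, trace_pow_eq_sum_eigenvalues hH]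
  refine ⟨Integrable.smul_measure (integrable_finsetSum_measure.2 fun i _ => hint i) ?_, ?_⟩
  · exact ENNReal.inv_ne_top.2 (by exact_mod_cast hp.ne')
  · rw [integral_smul_measure, integral_finsetSum_measure fun i _ => hint i]
    simp

variable {M : (p : ℕ) → Matrix (Fin p) (Fin p) ℝ} {m : ℕ → ℝ} {R : ℝ}

open Classical in
/-- The empirical spectral distribution as a probability measure, with a default value for the
matrices that are empty or not symmetric. -/
def esdProb (M : (p : ℕ) → Matrix (Fin p) (Fin p) ℝ) (p : ℕ) : ProbabilityMeasure ℝ :=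
  if h : (M p).IsSymm ∧ 0 < p then
    (⟨esdMeasure (M p), isProbabilityMeasure_esdMeasure h.1 h.2⟩ : ProbabilityMeasure ℝ)
  else (⟨Measure.dirac 0, inferInstance⟩ : ProbabilityMeasure ℝ)

theorem coe_esdProb (h : (M p).IsSymm ∧ 0 < p) :
    (esdProb M p : Measure ℝ) = esdMeasure (M p) := by
  have h' : esdProb M p = ⟨esdMeasure (M p), isProbabilityMeasure_esdMeasure h.1 h.2⟩ := dif_pos h
  rw [h']
  rfl

theorem integrable_esdProb (p k : ℕ) :
    Integrable (fun x : ℝ => x ^ k) (esdProb M p : Measure ℝ) := by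
  by_cases h : (M p).IsSymm ∧ 0 < p
  · rw [coe_esdProb h]
    exact (moments_esdMeasure h.1 h.2 k).1
  · have h' : esdProb M p = ⟨Measure.dirac 0, inferInstance⟩ := dif_neg h
    rw [h']
    exact integrable_dirac (by simp)

theorem eventually_symm_pos (hM : ∀ᶠ p in atTop, (M p).IsSymm) :
    ∀ᶠ p in atTop, (M p).IsSymm ∧ 0 < p :=
  hM.and (eventually_gt_atTop 0)

theorem tendsto_moments_esdProb (hM : ∀ᶠ p in atTop, (M p).IsSymm)
    (hm : ∀ k : ℕ, Tendsto (fun p : ℕ => (p : ℝ)⁻¹ * ((M p) ^ k).trace) atTop (𝓝 (m k))) (k : ℕ) :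
    Tendsto (fun p => ∫ x : ℝ, x ^ k ∂(esdProb M p : Measure ℝ)) atTop (𝓝 (m k)) := by
  refine (hm k).congr' ?_
  filter_upwards [eventually_symm_pos hM] with p hp
  rw [coe_esdProb hp, (moments_esdMeasure hp.1 hp.2 k).2]

theorem tendsto_esd {μ : ProbabilityMeasure ℝ} (hM : ∀ᶠ p in atTop, (M p).IsSymm)
    (hm : ∀ k : ℕ, Tendsto (fun p : ℕ => (p : ℝ)⁻¹ * ((M p) ^ k).trace) atTop (𝓝 (m k)))
    (hR : ∀ k, m k ≤ R ^ k)
    (hμ : ∀ k : ℕ, Integrable (fun x : ℝ => x ^ k) (μ : Measure ℝ) ∧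
      ∫ x : ℝ, x ^ k ∂(μ : Measure ℝ) = m k) :
    Tendsto (fun p => esd (M p)) atTop (𝓝 μ.toFiniteMeasure) := by
  have h : Tendsto (esdProb M) atTop (𝓝 μ) := by
    refine tendsto_of_tendsto_moments (R := R) (fun p k => integrable_esdProb p k)
      (fun k => (hμ k).1) (fun k => ?_) fun k => ?_
    · rw [(hμ k).2]
      exact hR k
    · rw [(hμ k).2]
      exact tendsto_moments_esdProb hM hm k
  rw [ProbabilityMeasure.tendsto_nhds_iff_toFiniteMeasure_tendsto_nhds] at h
  refine h.congr' ?_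
  filter_upwards [eventually_symm_pos hM] with p hp
  refine Subtype.ext ?_
  exact coe_esdProb hp

end EmpiricalSpectralDistribution

/-! ### Quotient by the kernel of a tracial state -/

section FaithfulQuotient

variable {B : Type} [Ring B] [StarRing B] [Algebra ℂ B] [StarModule ℂ B] (φ : B →ₗ[ℂ] ℂ)

/-- The congruence that identifies elements not distinguished by the functionals
`x ↦ φ (a * x)`. -/
def kernelCon (htr : IsTracial φ) : RingCon B where
  r a b := ∀ x, φ (a * x) = φ (b * x)
  iseqv := ⟨fun _ _ => rfl, fun h x => (h x).symm, fun h h' x => (h x).trans (h' x)⟩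
  add' h h' x := by rw [add_mul, add_mul, map_add, map_add, h, h']
  -- Traciality moves either factor to the front, so the left kernel is two-sided.
  mul' {a b c d} h h' x := by
    rw [mul_assoc, h, htr, mul_assoc, h', htr, mul_assoc, htr, mul_assoc]

variable {φ}

omit [StarModule ℂ B] in
theorem kernelCon_star (htr : IsTracial φ) (hs : ∀ a, φ (star a) = star (φ a)) {a b : B}
    (h : kernelCon φ htr a b) : kernelCon φ htr (star a) (star b) := by
  intro x
  have h' : φ (a * star x) = φ (b * star x) := h (star x)
  have key : ∀ c : B, φ (star c * x) = star (φ (c * star x)) := fun c => by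
    rw [← hs, star_mul, star_star, htr]
  rw [key, key, h']

/-- The `*`-ring structure on the quotient by `kernelCon`. -/
abbrev kernelStarRing (htr : IsTracial φ) (hs : ∀ a, φ (star a) = star (φ a)) :
    StarRing (kernelCon φ htr).Quotient where
  star := Quotient.map' star fun _ _ h => kernelCon_star htr hs h
  star_involutive a := by
    induction a using Quotient.inductionOn' with
    | h a => exact congrArg Quotient.mk'' (star_star a)
  star_mul a b := by
    induction a using Quotient.inductionOn' with
    | h a =>
      induction b using Quotient.inductionOn' with
      | h b => exact congrArg Quotient.mk'' (star_mul a b)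
  star_add a b := by
    induction a using Quotient.inductionOn' with
    | h a =>
      induction b using Quotient.inductionOn' with
      | h b => exact congrArg Quotient.mk'' (star_add a b)

/-- Moments alone cannot show that an element vanishes. In the quotient they can: what is orthogonal
to everything becomes zero. -/
theorem exists_faithful_quotient (hst : IsState φ) (htr : IsTracial φ)
    (hs : ∀ a, φ (star a) = star (φ a)) :
    ∃ (A : Type) (_ : Ring A) (_ : StarRing A) (_ : Algebra ℂ A) (_ : StarModule ℂ A)
      (ψ : A →ₗ[ℂ] ℂ) (π : B →ₐ[ℂ] A),
      IsState ψ ∧ IsTracial ψ ∧ (∀ b, π (star b) = star (π b)) ∧ (∀ b, ψ (π b) = φ b) ∧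
        ∀ b, (∀ x, φ (b * x) = 0) → π b = 0 := by
  let π : B →ₐ[ℂ] (kernelCon φ htr).Quotient :=
    { (kernelCon φ htr).mk' with commutes' := fun _ => rfl }
  have hπ : Function.Surjective π := (kernelCon φ htr).mk'_surjective
  let := kernelStarRing htr hs
  have hstar : ∀ b, π (star b) = star (π b) := fun _ => rfl
  let ψ : (kernelCon φ htr).Quotient →ₗ[ℂ] ℂ :=
    { toFun := Quotient.lift φ fun a b h => by
        have h' : φ (a * 1) = φ (b * 1) := h 1
        rwa [mul_one, mul_one] at h'
      map_add' := fun a b => by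
        obtain ⟨a, rfl⟩ := hπ a
        obtain ⟨b, rfl⟩ := hπ b
        exact map_add φ a b
      map_smul' := fun r a => by
        obtain ⟨a, rfl⟩ := hπ a
        exact map_smul φ r a }
  have hψ : ∀ b, ψ (π b) = φ b := fun _ => rfl
  refine ⟨(kernelCon φ htr).Quotient, inferInstance, inferInstance, inferInstance, ⟨fun r a => ?_⟩,
    ψ, π, ⟨?_, fun a => ?_⟩, fun a b => ?_, hstar, hψ, fun b hb => ?_⟩
  · obtain ⟨a, rfl⟩ := hπ a
    rw [← map_smul, ← hstar, ← hstar, star_smul, map_smul]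
  · rw [← map_one π, hψ]
    exact hst.1
  · obtain ⟨a, rfl⟩ := hπ a
    rw [← hstar, ← map_mul, hψ]
    exact hst.2 a
  · obtain ⟨a, rfl⟩ := hπ a
    obtain ⟨b, rfl⟩ := hπ b
    rw [← map_mul, ← map_mul, hψ, hψ]
    exact htr a b
  · rw [← map_zero π]
    refine (RingCon.eq _).2 fun x => ?_
    rw [hb, zero_mul, map_zero]

end FaithfulQuotient

/-! ### `*`-polynomials -/

section Polynomials

namespace StarPoly

variable {𝕜 : Type*} [CommSemiring 𝕜] {t : ℕ}

/-- The monomial with letters `a 0, …, a (k - 1)`. -/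
def word (𝕜 : Type*) [CommSemiring 𝕜] {t k : ℕ} (a : Fin k → Fin t × Bool) : StarPoly 𝕜 t :=
  (List.ofFn fun u => FreeAlgebra.ι 𝕜 (a u)).prod

theorem word_zero (a : Fin 0 → Fin t × Bool) : word 𝕜 a = 1 := by
  rw [word, List.ofFn_zero, List.prod_nil]

theorem ι_mul_word {k : ℕ} (x : Fin t × Bool) (a : Fin k → Fin t × Bool) :
    FreeAlgebra.ι 𝕜 x * word 𝕜 a = word 𝕜 (Fin.cons x a : Fin (k + 1) → Fin t × Bool) := by
  rw [word, word, List.ofFn_succ, List.prod_cons, Fin.cons_zero]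
  simp only [Fin.cons_succ]

/-- Stability under left multiplication is the form in which induction on `Q` passes through
products; at `W = 1` it says that the words span. -/
theorem mul_mem_span_word (Q : StarPoly 𝕜 t) :
    ∀ W ∈ Submodule.span 𝕜 {W : StarPoly 𝕜 t | ∃ (k : ℕ) (a : Fin k → Fin t × Bool),
      W = word 𝕜 a}, Q * W ∈ Submodule.span 𝕜 {W : StarPoly 𝕜 t |
        ∃ (k : ℕ) (a : Fin k → Fin t × Bool), W = word 𝕜 a} := by
  induction Q using FreeAlgebra.induction with
  | grade0 r =>
    intro W hW
    rw [← Algebra.smul_def]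
    exact Submodule.smul_mem _ r hW
  | grade1 x =>
    intro W hW
    induction hW using Submodule.span_induction with
    | mem W h =>
      obtain ⟨k, a, rfl⟩ := h
      exact Submodule.subset_span ⟨k + 1, _, ι_mul_word x a⟩
    | zero => rw [mul_zero]; exact Submodule.zero_mem _
    | add W W' _ _ h h' => rw [mul_add]; exact Submodule.add_mem _ h h'
    | smul r W _ h => rw [mul_smul_comm]; exact Submodule.smul_mem _ r h
  | mul Q Q' h h' =>
    intro W hW
    rw [mul_assoc]
    exact h _ (h' _ hW)
  | add Q Q' h h' =>
    intro W hW
    rw [add_mul]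
    exact Submodule.add_mem _ (h _ hW) (h' _ hW)

theorem mem_span_word (Q : StarPoly 𝕜 t) :
    Q ∈ Submodule.span 𝕜 {W : StarPoly 𝕜 t | ∃ (k : ℕ) (a : Fin k → Fin t × Bool),
      W = word 𝕜 a} := by
  rw [← mul_one Q]
  exact mul_mem_span_word Q 1 (Submodule.subset_span ⟨0, Fin.elim0, (word_zero _).symm⟩)

section Eval

variable {B : Type*} [Semiring B] [Star B] [Algebra 𝕜 B] (d : Fin t → B)

theorem eval_add (Q Q' : StarPoly 𝕜 t) : (Q + Q').eval d = Q.eval d + Q'.eval d := map_add _ _ _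

theorem eval_mul (Q Q' : StarPoly 𝕜 t) : (Q * Q').eval d = Q.eval d * Q'.eval d := map_mul _ _ _

theorem eval_pow (Q : StarPoly 𝕜 t) (k : ℕ) : (Q ^ k).eval d = (Q.eval d) ^ k := map_pow _ _ _

theorem eval_smul (r : 𝕜) (Q : StarPoly 𝕜 t) : (r • Q).eval d = r • Q.eval d := map_smul _ _ _

theorem eval_algebraMap (r : 𝕜) :
    (algebraMap 𝕜 (StarPoly 𝕜 t) r).eval d = algebraMap 𝕜 B r := AlgHom.commutes _ _

theorem eval_ι (x : Fin t × Bool) :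
    StarPoly.eval (FreeAlgebra.ι 𝕜 x) d = adj (d x.1) x.2 := FreeAlgebra.lift_ι_apply _ _

theorem eval_word {k : ℕ} (a : Fin k → Fin t × Bool) :
    (word 𝕜 a).eval d = (List.ofFn fun u => adj (d (a u).1) (a u).2).prod := by
  rw [word, StarPoly.eval, map_list_prod, List.map_ofFn]
  congr 2
  funext u
  exact eval_ι d _

end Eval

theorem eval_sub {𝕜 : Type*} [CommRing 𝕜] {B : Type*} [Ring B] [Star B] [Algebra 𝕜 B]
    (d : Fin t → B) (Q Q' : StarPoly 𝕜 t) : (Q - Q').eval d = Q.eval d - Q'.eval d :=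
  map_sub _ _ _

theorem map_eval {B D : Type*} [Semiring B] [Star B] [Algebra 𝕜 B] [Semiring D] [Star D]
    [Algebra 𝕜 D] (f : B →ₐ[𝕜] D) (hf : ∀ b, f (star b) = star (f b)) (d : Fin t → B)
    (Q : StarPoly 𝕜 t) : f (Q.eval d) = Q.eval fun l => f (d l) := by
  induction Q using FreeAlgebra.induction with
  | grade0 r => rw [eval_algebraMap, eval_algebraMap, AlgHom.commutes]
  | grade1 x =>
    rw [eval_ι, eval_ι]
    rcases x with ⟨l, b⟩
    cases b
    · rfl
    · exact hf _
  | mul Q Q' h h' => rw [eval_mul, eval_mul, map_mul, h, h']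
  | add Q Q' h h' => rw [eval_add, eval_add, map_add, h, h']

/-- Every `*`-polynomial has a formal adjoint. -/
theorem exists_star (Q : StarPoly ℂ t) : ∃ Q' : StarPoly ℂ t, ∀ (B : Type) [Ring B] [StarRing B]
    [Algebra ℂ B] [StarModule ℂ B] (d : Fin t → B), Q'.eval d = star (Q.eval d) := by
  induction Q using FreeAlgebra.induction with
  | grade0 r =>
    refine ⟨algebraMap _ _ (star r), fun B _ _ _ _ d => ?_⟩
    rw [eval_algebraMap, eval_algebraMap, algebraMap_star_comm]
  | grade1 x =>
    refine ⟨FreeAlgebra.ι ℂ (x.1, !x.2), fun B _ _ _ _ d => ?_⟩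
    rw [eval_ι, eval_ι]
    rcases x with ⟨l, b⟩
    cases b
    · rfl
    · exact (star_star _).symm
  | mul Q Q' h h' =>
    obtain ⟨S, hS⟩ := h
    obtain ⟨S', hS'⟩ := h'
    exact ⟨S' * S, fun B _ _ _ _ d => by rw [eval_mul, eval_mul, star_mul, hS, hS']⟩
  | add Q Q' h h' =>
    obtain ⟨S, hS⟩ := h
    obtain ⟨S', hS'⟩ := h'
    exact ⟨S + S', fun B _ _ _ _ d => by rw [eval_add, eval_add, star_add, hS, hS']⟩

theorem adj_map_ofReal {p : ℕ} (M : Matrix (Fin p) (Fin p) ℝ) (b : Bool) :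
    adj (M.map Complex.ofReal) b = (adj M b).map Complex.ofReal := by
  cases b
  · rfl
  · ext i j
    exact Complex.conj_ofReal _

/-- Every real `*`-polynomial can be viewed as a complex one. -/
theorem exists_complexification (Q : StarPoly ℝ t) : ∃ Q' : StarPoly ℂ t,
    (∀ (B : Type) [Ring B] [StarRing B] [Algebra ℂ B] (d : Fin t → B), Q'.eval d = Q.eval d) ∧
    ∀ (p : ℕ) (d : Fin t → Matrix (Fin p) (Fin p) ℝ),
      Q'.eval (fun l => (d l).map Complex.ofReal) = (Q.eval d).map Complex.ofReal := by
  induction Q using FreeAlgebra.induction with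
  | grade0 r =>
    refine ⟨algebraMap _ _ (r : ℂ), fun B _ _ _ d => ?_, fun p d => ?_⟩
    · rw [eval_algebraMap, eval_algebraMap]
      rfl
    · rw [eval_algebraMap, eval_algebraMap]
      ext i j
      rw [Matrix.map_apply, Matrix.algebraMap_matrix_apply, Matrix.algebraMap_matrix_apply]
      split_ifs <;> simp
  | grade1 x =>
    refine ⟨FreeAlgebra.ι ℂ x, fun B _ _ _ d => ?_, fun p d => ?_⟩
    · rw [eval_ι, eval_ι]
    · rw [eval_ι, eval_ι, adj_map_ofReal]
  | mul Q Q' h h' =>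
    obtain ⟨S, h1, h2⟩ := h
    obtain ⟨S', h1', h2'⟩ := h'
    refine ⟨S * S', fun B _ _ _ d => ?_, fun p d => ?_⟩
    · rw [eval_mul, eval_mul, h1, h1']
    · rw [eval_mul, eval_mul, h2, h2']
      exact (Matrix.map_mul (f := Complex.ofRealHom)).symm
  | add Q Q' h h' =>
    obtain ⟨S, h1, h2⟩ := h
    obtain ⟨S', h1', h2'⟩ := h'
    refine ⟨S + S', fun B _ _ _ d => ?_, fun p d => ?_⟩
    · rw [eval_add, eval_add, h1, h1']
    · rw [eval_add, eval_add, h2, h2']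
      exact (Matrix.map_add _ Complex.ofReal_add _ _).symm

/-- Exponential bounds on the words propagate to polynomials. -/
theorem exists_norm_bound {K : ℝ} (hK : 0 ≤ K) (Q : StarPoly ℂ t) : ∃ R : ℝ, 0 ≤ R ∧
    ∀ (ψ : StarPoly ℂ t →ₗ[ℂ] ℂ) (C : ℝ),
      (∀ (k : ℕ) (a : Fin k → Fin t × Bool), ‖ψ (word ℂ a)‖ ≤ C * K ^ k) →
      ∀ (k : ℕ) (a : Fin k → Fin t × Bool), ‖ψ (Q * word ℂ a)‖ ≤ C * R * K ^ k := by
  induction Q using FreeAlgebra.induction with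
  | grade0 r =>
    refine ⟨‖r‖, norm_nonneg _, fun ψ C h k a => ?_⟩
    rw [← Algebra.smul_def, map_smul, norm_smul, mul_comm C, mul_assoc]
    exact mul_le_mul_of_nonneg_left (h k a) (norm_nonneg _)
  | grade1 x =>
    refine ⟨K, hK, fun ψ C h k a => ?_⟩
    rw [ι_mul_word, mul_assoc, ← pow_succ']
    exact h _ _
  | mul Q Q' h h' =>
    obtain ⟨R, hR, h⟩ := h
    obtain ⟨R', hR', h'⟩ := h'
    refine ⟨R * R', mul_nonneg hR hR', fun ψ C hψ k a => ?_⟩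
    -- The bound quantifies over all functionals so that `ψ (Q * ·)`, with constant `C * R`, can be
    -- inserted into the bound for `Q'`.
    rw [mul_assoc Q, ← mul_assoc C]
    exact h' (ψ ∘ₗ LinearMap.mulLeft ℂ Q) (C * R) (fun k a => h ψ C hψ k a) k a
  | add Q Q' h h' =>
    obtain ⟨R, hR, h⟩ := h
    obtain ⟨R', hR', h'⟩ := h'
    refine ⟨R + R', add_nonneg hR hR', fun ψ C hψ k a => ?_⟩
    rw [add_mul, map_add, mul_add, add_mul]
    exact (norm_add_le _ _).trans (add_le_add (h ψ C hψ k a) (h' ψ C hψ k a))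

theorem exists_moment_bound {K : ℝ} (hK : 0 ≤ K) (ψ : StarPoly ℂ t →ₗ[ℂ] ℂ)
    (hψ : ∀ (k : ℕ) (a : Fin k → Fin t × Bool), ‖ψ (word ℂ a)‖ ≤ K ^ k) (Q : StarPoly ℂ t) :
    ∃ R : ℝ, 0 ≤ R ∧ ∀ k : ℕ, ‖ψ (Q ^ k)‖ ≤ R ^ k := by
  obtain ⟨R, hR, h⟩ := exists_norm_bound hK Q
  refine ⟨R, hR, fun j => ?_⟩
  have key : ∀ (j k : ℕ) (a : Fin k → Fin t × Bool), ‖ψ (Q ^ j * word ℂ a)‖ ≤ R ^ j * K ^ k := by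
    intro j
    induction j with
    | zero =>
      intro k a
      rw [pow_zero, pow_zero, one_mul, one_mul]
      exact hψ k a
    | succ j ih =>
      intro k a
      rw [pow_succ, pow_succ, mul_assoc]
      exact h (ψ ∘ₗ LinearMap.mulLeft ℂ (Q ^ j)) (R ^ j) ih k a
  have := key j 0 Fin.elim0
  rwa [word_zero, mul_one, pow_zero, mul_one] at this

theorem tendsto_of_tendsto_word {F : ℕ → StarPoly ℂ t →ₗ[ℂ] ℂ} {ψ : StarPoly ℂ t →ₗ[ℂ] ℂ}
    (h : ∀ (k : ℕ) (a : Fin k → Fin t × Bool),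
      Tendsto (fun p => F p (word ℂ a)) atTop (𝓝 (ψ (word ℂ a)))) (Q : StarPoly ℂ t) :
    Tendsto (fun p => F p Q) atTop (𝓝 (ψ Q)) := by
  induction mem_span_word Q using Submodule.span_induction with
  | mem W hW =>
    obtain ⟨k, a, rfl⟩ := hW
    exact h k a
  | zero => simp only [map_zero, tendsto_const_nhds]
  | add W W' _ _ h h' => simpa only [map_add] using h.add h'
  | smul r W _ h => simpa only [map_smul] using h.const_smul r

theorem exists_limit {F : ℕ → StarPoly ℂ t →ₗ[ℂ] ℂ}
    (h : ∀ (k : ℕ) (a : Fin k → Fin t × Bool), ∃ z : ℂ,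
      Tendsto (fun p => F p (word ℂ a)) atTop (𝓝 z)) :
    ∃ ψ : StarPoly ℂ t →ₗ[ℂ] ℂ, ∀ Q, Tendsto (fun p => F p Q) atTop (𝓝 (ψ Q)) := by
  have h' : ∀ Q, ∃ z : ℂ, Tendsto (fun p => F p Q) atTop (𝓝 z) := by
    intro Q
    induction mem_span_word Q using Submodule.span_induction with
    | mem W hW =>
      obtain ⟨k, a, rfl⟩ := hW
      exact h k a
    | zero => exact ⟨0, by simp only [map_zero, tendsto_const_nhds]⟩
    | add W W' _ _ h h' =>
      obtain ⟨z, hz⟩ := h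
      obtain ⟨z', hz'⟩ := h'
      exact ⟨z + z', by simpa only [map_add] using hz.add hz'⟩
    | smul r W _ h =>
      obtain ⟨z, hz⟩ := h
      exact ⟨r • z, by simpa only [map_smul] using hz.const_smul r⟩
  choose ψ hψ using h'
  refine ⟨⟨⟨ψ, fun Q Q' => ?_⟩, fun r Q => ?_⟩, hψ⟩
  · refine tendsto_nhds_unique (hψ _) ?_
    simpa only [map_add] using (hψ Q).add (hψ Q')
  · refine tendsto_nhds_unique (hψ _) ?_
    simpa only [map_smul, RingHom.id_apply] using (hψ Q).const_smul r

end StarPoly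

end Polynomials

/-! ### Limits of matrices in a tracial `*`-probability space -/

section Model

theorem normTrace_mul_comm {p : ℕ} (M N : Matrix (Fin p) (Fin p) ℂ) :
    normTrace (M * N) = normTrace (N * M) := by
  rw [normTrace, normTrace, Matrix.trace_mul_comm]

theorem normTrace_star {p : ℕ} (M : Matrix (Fin p) (Fin p) ℂ) :
    normTrace (star M) = star (normTrace M) := by
  rw [normTrace, normTrace, Matrix.star_eq_conjTranspose, Matrix.trace_conjTranspose, star_mul',
    star_inv₀, star_natCast]

theorem normTrace_mul_star_nonneg {p : ℕ} (M : Matrix (Fin p) (Fin p) ℂ) :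
    0 ≤ normTrace (M * star M) := by
  rw [normTrace, Matrix.star_eq_conjTranspose]
  refine mul_nonneg ?_ (Matrix.posSemidef_self_mul_conjTranspose M).trace_nonneg
  rw [← Complex.ofReal_natCast, ← Complex.ofReal_inv, Complex.zero_le_real]
  positivity

theorem normTrace_one {p : ℕ} (hp : 0 < p) : normTrace (1 : Matrix (Fin p) (Fin p) ℂ) = 1 := by
  rw [normTrace, Matrix.trace_one, Fintype.card_fin]
  exact inv_mul_cancel₀ (by exact_mod_cast hp.ne')

variable {t : ℕ}

/-- The normalized trace of a `*`-polynomial in given matrices, as a linear functional. -/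
def traceFunctional {p : ℕ} (d : Fin t → Matrix (Fin p) (Fin p) ℂ) : StarPoly ℂ t →ₗ[ℂ] ℂ where
  toFun Q := normTrace (Q.eval d)
  map_add' Q Q' := by
    rw [StarPoly.eval_add, normTrace, normTrace, normTrace, Matrix.trace_add, mul_add]
  map_smul' r Q := by
    rw [StarPoly.eval_smul, normTrace, normTrace, Matrix.trace_smul, smul_eq_mul, RingHom.id_apply,
      smul_eq_mul, mul_left_comm]

/-- The algebra of sequences of matrices that are values of a `*`-polynomial. -/
def sequenceAlgebra (c : Fin t → (p : ℕ) → Matrix (Fin p) (Fin p) ℂ) :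
    StarSubalgebra ℂ ((p : ℕ) → Matrix (Fin p) (Fin p) ℂ) where
  toSubalgebra := (FreeAlgebra.lift ℂ fun x : Fin t × Bool => adj (c x.1) x.2).range
  star_mem' := by
    rintro _ ⟨Q, rfl⟩
    obtain ⟨Q', hQ'⟩ := StarPoly.exists_star Q
    exact ⟨Q', hQ' _ c⟩

/-- Matrices whose `*`-moments converge have a limit in a tracial `*`-probability space, in which
elements not distinguished by the moments are equal. -/
theorem exists_limit_model (d : (p : ℕ) → Fin t → Matrix (Fin p) (Fin p) ℂ)
    (ψ : StarPoly ℂ t →ₗ[ℂ] ℂ)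
    (hψ : ∀ Q : StarPoly ℂ t, Tendsto (fun p => normTrace (Q.eval (d p))) atTop (𝓝 (ψ Q))) :
    ∃ (A : Type) (_ : Ring A) (_ : StarRing A) (_ : Algebra ℂ A) (_ : StarModule ℂ A)
      (φ : A →ₗ[ℂ] ℂ) (c : Fin t → A), IsState φ ∧ IsTracial φ ∧
      (∀ Q : StarPoly ℂ t, φ (Q.eval c) = ψ Q) ∧
      ∀ Q : StarPoly ℂ t, (∀ Q', ψ (Q * Q') = 0) → Q.eval c = 0 := by
  -- Sequences of matrices carry an involution, and traciality and positivity of the limit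
  -- functional hold because they hold for each `p`.
  set s : Fin t → (p : ℕ) → Matrix (Fin p) (Fin p) ℂ := fun l p => d p l with hs
  have hev : ∀ (Q : StarPoly ℂ t) (p : ℕ), Q.eval s p = Q.eval (d p) := fun Q p =>
    StarPoly.map_eval (Pi.evalAlgHom ℂ _ p) (fun _ => rfl) s Q
  have hex : ∀ b : sequenceAlgebra s, ∃ Q : StarPoly ℂ t, Q.eval s = b := fun b => b.2
  choose q hq using hex
  have hlim : ∀ b : sequenceAlgebra s,
      Tendsto (fun p => normTrace ((b : (p : ℕ) → Matrix (Fin p) (Fin p) ℂ) p)) atTop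
        (𝓝 (ψ (q b))) := by
    intro b
    have h := hψ (q b)
    simp only [← hev, hq] at h
    exact h
  -- Different polynomials may define the same sequence, but the limit of the normalized traces
  -- depends only on the sequence.
  have huniq : ∀ (b : sequenceAlgebra s) (Q : StarPoly ℂ t), Q.eval s = b → ψ (q b) = ψ Q := by
    intro b Q hQ
    refine tendsto_nhds_unique (hlim b) ?_
    have h := hψ Q
    simp only [← hev, hQ] at h
    exact h
  let φ : sequenceAlgebra s →ₗ[ℂ] ℂ :=
    { toFun := fun b => ψ (q b)
      map_add' := fun a b => by
        rw [← map_add]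
        exact huniq _ _ (by rw [StarPoly.eval_add, hq, hq]; rfl)
      map_smul' := fun r b => by
        rw [RingHom.id_apply, ← map_smul]
        exact huniq _ _ (by rw [StarPoly.eval_smul, hq]; rfl) }
  have hφ : ∀ b : sequenceAlgebra s,
      Tendsto (fun p => normTrace ((b : (p : ℕ) → Matrix (Fin p) (Fin p) ℂ) p)) atTop
        (𝓝 (φ b)) := hlim
  have htr : IsTracial φ := fun a b =>
    tendsto_nhds_unique (hφ _) ((hφ (b * a)).congr fun p => normTrace_mul_comm _ _)
  have hst : IsState φ := by
    refine ⟨tendsto_nhds_unique (hφ 1) ?_, fun a => ?_⟩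
    · refine tendsto_const_nhds.congr' ?_
      filter_upwards [eventually_gt_atTop 0] with p hp
      exact (normTrace_one hp).symm
    · exact ge_of_tendsto' (hφ (a * star a)) fun p => normTrace_mul_star_nonneg _
  have hstar : ∀ a, φ (star a) = star (φ a) := fun a => by
    refine tendsto_nhds_unique (hφ _) (((hφ a).star).congr fun p => ?_)
    exact (normTrace_star _).symm
  obtain ⟨A, _, _, _, _, φ', π, h1, h2, h3, h4, h5⟩ := exists_faithful_quotient hst htr hstar
  let e : Fin t → sequenceAlgebra s := fun l => ⟨s l, FreeAlgebra.ι ℂ (l, false),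
    StarPoly.eval_ι s (l, false)⟩
  have he : ∀ Q : StarPoly ℂ t, ((Q.eval e : sequenceAlgebra s) : (p : ℕ) → Matrix (Fin p) (Fin p) ℂ)
      = Q.eval s := fun Q =>
    StarPoly.map_eval (sequenceAlgebra s).subtype.toAlgHom (fun _ => rfl) e Q
  have hφe : ∀ Q : StarPoly ℂ t, φ (Q.eval e) = ψ Q := fun Q => huniq _ _ (he Q).symm
  have hπ : ∀ Q : StarPoly ℂ t, (Q.eval fun l => π (e l)) = π (Q.eval e) := fun Q =>
    (StarPoly.map_eval π h3 e Q).symm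
  refine ⟨A, _, _, _, ‹_›, φ', fun l => π (e l), h1, h2, fun Q => ?_, fun Q hQ => ?_⟩
  · rw [hπ, h4, hφe]
  · rw [hπ]
    refine h5 _ fun x => ?_
    have hx : x = (q x).eval e := Subtype.ext (by rw [he, hq])
    rw [hx, ← StarPoly.eval_mul, hφe, hQ]

end Model

/-! ### Convergence of `*`-polynomials in the matrices -/

section AllMoments

variable {Ω : Type*} [MeasurableSpace Ω] {P : Measure Ω}

theorem memLp_mul_of_forall {𝕜 : Type*} [NormedRing 𝕜] {f g : Ω → 𝕜}
    (hf : ∀ k : ℕ, MemLp f k P) (hg : ∀ k : ℕ, MemLp g k P) (k : ℕ) :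
    MemLp (fun ω => f ω * g ω) k P := by
  have : ENNReal.HolderTriple ((2 * k : ℕ) : ℝ≥0∞) ((2 * k : ℕ) : ℝ≥0∞) (k : ℝ≥0∞) := by
    refine ⟨?_⟩
    rw [Nat.cast_mul, Nat.cast_ofNat, ENNReal.mul_inv (Or.inl two_ne_zero)
      (Or.inl ENNReal.ofNat_ne_top), ← add_mul, ENNReal.inv_two_add_inv_two, one_mul]
  exact (hg (2 * k)).mul (hf (2 * k))

section Closure

variable {p : ℕ} {M N : Ω → Matrix (Fin p) (Fin p) ℂ}

theorem HasAllMoments.add (hM : HasAllMoments P M) (hN : HasAllMoments P N) :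
    HasAllMoments P fun ω => M ω + N ω := fun i j k => (hM i j k).add (hN i j k)

theorem HasAllMoments.mul (hM : HasAllMoments P M) (hN : HasAllMoments P N) :
    HasAllMoments P fun ω => M ω * N ω := by
  intro i j k
  simp only [Matrix.mul_apply]
  exact memLp_finsetSum _ fun x _ => memLp_mul_of_forall (hM i x) (hN x j) k

theorem HasAllMoments.const [IsFiniteMeasure P] (M : Matrix (Fin p) (Fin p) ℂ) :
    HasAllMoments P fun _ => M := fun _ _ _ => memLp_const _

theorem HasAllMoments.eval [IsFiniteMeasure P] {t : ℕ} {d : Ω → Fin t → Matrix (Fin p) (Fin p) ℂ}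
    (hd : ∀ (l : Fin t) (b : Bool), HasAllMoments P fun ω => adj (d ω l) b) (Q : StarPoly ℂ t) :
    HasAllMoments P fun ω => Q.eval (d ω) := by
  induction Q using FreeAlgebra.induction with
  | grade0 r => simpa only [StarPoly.eval_algebraMap] using HasAllMoments.const _
  | grade1 x => simpa only [StarPoly.eval_ι] using hd x.1 x.2
  | mul Q Q' h h' => simpa only [StarPoly.eval_mul] using h.mul h'
  | add Q Q' h h' => simpa only [StarPoly.eval_add] using h.add h'

theorem HasAllMoments.integrable_trace (hM : HasAllMoments P M) :
    Integrable (fun ω => (M ω).trace) P :=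
  integrable_finsetSum _ fun i _ => memLp_one_iff_integrable.1 (by simpa using hM i i 1)

end Closure

variable {t : ℕ} {n : Fin t → ℕ → ℕ}
  {X Y : (l : Fin t) → (p : ℕ) → Ω → Matrix (Fin p) (Fin (n l p)) ℝ} {ρ : Fin t → ℝ}

theorem memLp_of_integrable_abs_pow {f : Ω → ℝ} (hf : Measurable f)
    (h : ∀ k : ℕ, 1 ≤ k → Integrable (fun ω => |f ω| ^ k) P) (k : ℕ) : MemLp f k P := by
  rcases Nat.eq_zero_or_pos k with rfl | hk
  · rw [Nat.cast_zero, memLp_zero_iff_aestronglyMeasurable]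
    exact hf.aestronglyMeasurable
  · rw [← integrable_norm_rpow_iff hf.aestronglyMeasurable (by exact_mod_cast hk.ne')
      (ENNReal.natCast_ne_top k)]
    simpa using h k hk

variable [IsProbabilityMeasure P]

omit [IsProbabilityMeasure P] in
theorem EntryAssumptions.hasAllMoments_adj_crossCov (h : EntryAssumptions P n X Y ρ) (p : ℕ)
    (l : Fin t) (b : Bool) : HasAllMoments P fun ω =>
      adj ((crossCov (X l p ω) (Y l p ω)).map Complex.ofReal) b := by
  have hX : ∀ (i : Fin p) (j : Fin (n l p)) (k : ℕ), MemLp (fun ω => X l p ω i j) k P :=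
    fun i j => memLp_of_integrable_abs_pow (h.measurable_X l p i j) fun k hk =>
      ((h.moments l k hk).choose_spec p i j).1
  have hY : ∀ (i : Fin p) (j : Fin (n l p)) (k : ℕ), MemLp (fun ω => Y l p ω i j) k P :=
    fun i j => memLp_of_integrable_abs_pow (h.measurable_Y l p i j) fun k hk =>
      ((h.moments l k hk).choose_spec p i j).2.1
  have hC : ∀ (i j : Fin p) (k : ℕ), MemLp (fun ω => crossCov (X l p ω) (Y l p ω) i j) k P := by
    intro i j k
    have h1 : ∀ ω, crossCov (X l p ω) (Y l p ω) i j =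
        (n l p : ℝ)⁻¹ * ∑ x, X l p ω i x * Y l p ω j x := fun ω => by
      rw [crossCov, Matrix.smul_apply, Matrix.mul_apply, smul_eq_mul]
      rfl
    simp only [h1]
    exact (memLp_finsetSum _ fun x _ => memLp_mul_of_forall (hX i x) (hY j x) k).const_mul _
  intro i j k
  cases b
  · exact (hC i j k).ofReal
  · simp only [StarPoly.adj_map_ofReal]
    exact (hC j i k).ofReal

theorem EntryAssumptions.hasAllMoments_eval (h : EntryAssumptions P n X Y ρ) (p : ℕ)
    (Q : StarPoly ℂ t) : HasAllMoments P fun ω =>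
      Q.eval fun l => (crossCov (X l p ω) (Y l p ω)).map Complex.ofReal :=
  HasAllMoments.eval (fun l b => h.hasAllMoments_adj_crossCov p l b) Q

/-- The expected normalized trace of a `*`-polynomial in the matrices `C_l`, as a linear
functional. -/
def EntryAssumptions.expFunctional (h : EntryAssumptions P n X Y ρ) (p : ℕ) :
    StarPoly ℂ t →ₗ[ℂ] ℂ where
  toFun Q := expTrace P fun ω =>
    Q.eval fun l => (crossCov (X l p ω) (Y l p ω)).map Complex.ofReal
  map_add' Q Q' := by
    simp only [expTrace, StarPoly.eval_add, Matrix.trace_add]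
    rw [integral_add (h.hasAllMoments_eval p Q).integrable_trace
      (h.hasAllMoments_eval p Q').integrable_trace, mul_add]
  map_smul' r Q := by
    simp only [expTrace, StarPoly.eval_smul, Matrix.trace_smul, smul_eq_mul, RingHom.id_apply]
    rw [integral_const_mul, mul_left_comm]

theorem trace_map_ofReal {p : ℕ} (M : Matrix (Fin p) (Fin p) ℝ) :
    (M.map Complex.ofReal).trace = (M.trace : ℂ) := by
  rw [Matrix.trace, Matrix.trace, Complex.ofReal_sum]
  rfl

theorem normTrace_map_ofReal {p : ℕ} (M : Matrix (Fin p) (Fin p) ℝ) :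
    normTrace (M.map Complex.ofReal) = (((p : ℝ)⁻¹ * M.trace : ℝ) : ℂ) := by
  rw [normTrace, trace_map_ofReal]
  push_cast
  rfl

theorem eval_word_map_ofReal {p k : ℕ} (d : Fin t → Matrix (Fin p) (Fin p) ℝ)
    (a : Fin k → Fin t × Bool) :
    (StarPoly.word ℂ a).eval (fun l => (d l).map Complex.ofReal) =
      (List.ofFn fun u => adj (d (a u).1) (a u).2).prod.map Complex.ofReal := by
  have h := map_list_prod (Complex.ofRealHom.mapMatrix (m := Fin p))
    (List.ofFn fun u => adj (d (a u).1) (a u).2)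
  rw [List.map_ofFn] at h
  rw [StarPoly.eval_word]
  refine Eq.trans ?_ h.symm
  congr 2
  funext u
  exact StarPoly.adj_map_ofReal _ _

omit [MeasurableSpace Ω] in
theorem normTrace_eval_word {k : ℕ} (a : Fin k → Fin t × Bool) (p : ℕ) (ω : Ω) :
    normTrace ((StarPoly.word ℂ a).eval fun l =>
      (crossCov (X l p ω) (Y l p ω)).map Complex.ofReal) = (wordTrace X Y a p ω : ℂ) := by
  rw [eval_word_map_ofReal fun l => crossCov (X l p ω) (Y l p ω), normTrace_map_ofReal]
  rfl

omit [IsProbabilityMeasure P] in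
theorem expTrace_eval_word {k : ℕ} (a : Fin k → Fin t × Bool) (p : ℕ) :
    (expTrace P fun ω => (StarPoly.word ℂ a).eval fun l =>
      (crossCov (X l p ω) (Y l p ω)).map Complex.ofReal) =
      ((∫ ω, wordTrace X Y a p ω ∂P : ℝ) : ℂ) := by
  rw [expTrace, ← integral_const_mul]
  refine Eq.trans ?_ integral_ofReal
  exact integral_congr_ae (ae_of_all _ fun ω => normTrace_eval_word a p ω)

variable {y : Fin t → ℝ}

theorem EntryAssumptions.ae_forall_tendsto_wordTrace (h : EntryAssumptions P n X Y ρ)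
    (hy : ∀ l, 0 < y l)
    (hpn : ∀ l, Tendsto (fun p : ℕ => (p : ℝ) / (n l p : ℝ)) atTop (𝓝 (y l))) :
    ∀ᵐ ω ∂P, ∀ (k : ℕ) (a : Fin k → Fin t × Bool),
      Tendsto (fun p => wordTrace X Y a p ω) atTop (𝓝 (mom ρ y a)) :=
  ae_all_iff.2 fun _ => ae_all_iff.2 fun a => h.ae_tendsto_wordTrace hy hpn a

/-- The almost sure limits of the normalized traces define a linear functional on
`*`-polynomials. -/
theorem EntryAssumptions.exists_limit_functional (h : EntryAssumptions P n X Y ρ)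
    (hy : ∀ l, 0 < y l)
    (hpn : ∀ l, Tendsto (fun p : ℕ => (p : ℝ) / (n l p : ℝ)) atTop (𝓝 (y l))) :
    ∃ ψ : StarPoly ℂ t →ₗ[ℂ] ℂ,
      (∀ (k : ℕ) (a : Fin k → Fin t × Bool), ψ (StarPoly.word ℂ a) = (mom ρ y a : ℂ)) ∧
      (∀ Q : StarPoly ℂ t, Tendsto (fun p : ℕ => expTrace P fun ω =>
        Q.eval fun l => (crossCov (X l p ω) (Y l p ω)).map Complex.ofReal) atTop (𝓝 (ψ Q))) ∧
      ∀ᵐ ω ∂P, ∀ Q : StarPoly ℂ t, Tendsto (fun p : ℕ => normTrace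
        (Q.eval fun l => (crossCov (X l p ω) (Y l p ω)).map Complex.ofReal))
        atTop (𝓝 (ψ Q)) := by
  have hexp : ∀ (k : ℕ) (a : Fin k → Fin t × Bool),
      Tendsto (fun p => h.expFunctional p (StarPoly.word ℂ a)) atTop (𝓝 (mom ρ y a : ℂ)) := by
    intro k a
    refine ((Complex.continuous_ofReal.tendsto _).comp
      (h.tendsto_integral_wordTrace hy hpn a)).congr fun p => ?_
    exact (expTrace_eval_word a p).symm
  obtain ⟨ψ, hψ⟩ := StarPoly.exists_limit fun k a => ⟨_, hexp k a⟩
  have hw : ∀ (k : ℕ) (a : Fin k → Fin t × Bool), ψ (StarPoly.word ℂ a) = (mom ρ y a : ℂ) :=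
    fun k a => tendsto_nhds_unique (hψ _) (hexp k a)
  refine ⟨ψ, hw, hψ, ?_⟩
  filter_upwards [h.ae_forall_tendsto_wordTrace hy hpn] with ω hω Q
  refine StarPoly.tendsto_of_tendsto_word (F := fun p => traceFunctional fun l =>
    (crossCov (X l p ω) (Y l p ω)).map Complex.ofReal) (fun k a => ?_) Q
  rw [hw]
  refine ((Complex.continuous_ofReal.tendsto _).comp (hω k a)).congr fun p => ?_
  exact (normTrace_eval_word a p ω).symm

end AllMoments

/-! ### The spectral limit of symmetric polynomials -/

section SpectralLimit

variable {t : ℕ}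

/-- The law of a real `*`-polynomial in limits of real matrices that is eventually symmetric. -/
theorem exists_law_of_eventually_symm {A : Type} [Ring A] [StarRing A] [Algebra ℂ A]
    [StarModule ℂ A] {φ : A →ₗ[ℂ] ℂ} {c : Fin t → A} {ψ : StarPoly ℂ t →ₗ[ℂ] ℂ} {K : ℝ}
    (hK : 0 ≤ K) (hψ : ∀ (k : ℕ) (a : Fin k → Fin t × Bool), ‖ψ (StarPoly.word ℂ a)‖ ≤ K ^ k)
    (hφ : ∀ Q : StarPoly ℂ t, φ (Q.eval c) = ψ Q)
    (hfaith : ∀ Q : StarPoly ℂ t, (∀ Q', ψ (Q * Q') = 0) → Q.eval c = 0)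
    {Ω : Type*} [MeasurableSpace Ω] {P : Measure Ω} [IsProbabilityMeasure P]
    {d : Ω → (p : ℕ) → Fin t → Matrix (Fin p) (Fin p) ℝ}
    (hd : ∀ᵐ ω ∂P, ∀ Q : StarPoly ℂ t, Tendsto (fun p => normTrace
      (Q.eval fun l => (d ω p l).map Complex.ofReal)) atTop (𝓝 (ψ Q)))
    (Q : StarPoly ℝ t) (hQ : ∀ᵐ ω ∂P, ∀ᶠ p in atTop, (Q.eval (d ω p)).IsSymm) :
    ∃ μ : ProbabilityMeasure ℝ, IsLawOf φ (Q.eval c) μ ∧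
      (∃ K : Set ℝ, IsCompact K ∧ (μ : Measure ℝ) Kᶜ = 0) ∧
      ∀ᵐ ω ∂P, Tendsto (fun p => esd (Q.eval (d ω p))) atTop (𝓝 μ.toFiniteMeasure) := by
  obtain ⟨Q', hQA, hQM⟩ := Q.exists_complexification
  obtain ⟨S, hS⟩ := Q'.exists_star
  obtain ⟨R, hR0, hR⟩ := StarPoly.exists_moment_bound hK ψ hψ Q'
  set m : ℕ → ℝ := fun k => (ψ (Q' ^ k)).re with hm
  have hmR : ∀ k, m k ≤ R ^ k := fun k => (Complex.re_le_norm _).trans (hR k)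
  have hlim : ∀ ω, (∀ Q : StarPoly ℂ t, Tendsto (fun p => normTrace
      (Q.eval fun l => (d ω p l).map Complex.ofReal)) atTop (𝓝 (ψ Q))) → ∀ k : ℕ,
      Tendsto (fun p : ℕ => (((p : ℝ)⁻¹ * ((Q.eval (d ω p)) ^ k).trace : ℝ) : ℂ)) atTop
        (𝓝 (ψ (Q' ^ k))) := by
    intro ω hω k
    refine (hω (Q' ^ k)).congr fun p => ?_
    rw [StarPoly.eval_pow, hQM, ← normTrace_map_ofReal]
    exact congrArg normTrace (map_pow (Complex.ofRealHom.mapMatrix (m := Fin p)) _ k).symm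
  have hlimre : ∀ ω, (∀ Q : StarPoly ℂ t, Tendsto (fun p => normTrace
      (Q.eval fun l => (d ω p l).map Complex.ofReal)) atTop (𝓝 (ψ Q))) → ∀ k : ℕ,
      Tendsto (fun p : ℕ => (p : ℝ)⁻¹ * ((Q.eval (d ω p)) ^ k).trace) atTop (𝓝 (m k)) :=
    fun ω hω k => (Complex.continuous_re.tendsto _).comp (hlim ω hω k)
  -- Self-adjointness and the existence of the law concern only the deterministic functional `ψ`, so
  -- a single realization can witness them.
  obtain ⟨ω₀, hω₀, hsymm₀⟩ := (hd.and hQ).exists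
  have hreal : ∀ k, φ ((Q.eval c) ^ k) = (m k : ℂ) := by
    intro k
    rw [← hQA, ← StarPoly.eval_pow, hφ]
    refine tendsto_nhds_unique (hlim ω₀ hω₀ k) ?_
    exact (Complex.continuous_ofReal.tendsto _).comp (hlimre ω₀ hω₀ k)
  have hself : IsSelfAdjoint (Q.eval c) := by
    -- Along `ω₀` the matrix of `Q'` eventually equals its adjoint, so the difference is orthogonal
    -- to every polynomial in the limit and hence vanishes.
    have h0 : (Q' - S).eval c = 0 := by
      refine hfaith _ fun T => ?_
      refine tendsto_nhds_unique (hω₀ _) (tendsto_const_nhds.congr' ?_)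
      filter_upwards [hsymm₀] with p hp
      have h1 : star ((Q.eval (d ω₀ p)).map Complex.ofReal) =
          (Q.eval (d ω₀ p)).map Complex.ofReal := by
        have h2 := StarPoly.adj_map_ofReal (Q.eval (d ω₀ p)) true
        rw [adj, adj, Matrix.star_eq_conjTranspose (Q.eval _),
          Matrix.conjTranspose_eq_transpose_of_trivial, hp.eq] at h2
        exact h2
      rw [StarPoly.eval_mul, StarPoly.eval_sub, hS, hQM, h1, sub_self, zero_mul, normTrace,
        Matrix.trace_zero, mul_zero]
    rw [StarPoly.eval_sub, hS, hQA, sub_eq_zero] at h0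
    exact h0.symm
  obtain ⟨μ, hμK, hμ⟩ := exists_law_of_tendsto_moments (ν := esdProb fun p => Q.eval (d ω₀ p))
    (m := m) (fun p k => integrable_esdProb p k)
    (fun k => tendsto_moments_esdProb hsymm₀ (hlimre ω₀ hω₀) k) hR0 hmR
  refine ⟨μ, ⟨hself, fun ν => ⟨fun hν => ?_, ?_⟩⟩, ⟨_, isCompact_Icc, hμK⟩, ?_⟩
  -- A law is specified by its moments of order at least `1`; the moment of order `0` is supplied by
  -- the total mass. Uniqueness is then weak convergence of the constant sequence `ν` to `μ`.
  · have hm0 : m 0 = 1 := by simpa using (hμ 0).2.symm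
    have hν' : ∀ k : ℕ, Integrable (fun x : ℝ => x ^ k) (ν : Measure ℝ) ∧
        ∫ x : ℝ, x ^ k ∂(ν : Measure ℝ) = m k := by
      intro k
      rcases Nat.eq_zero_or_pos k with rfl | hk
      · simp [hm0]
      · refine ⟨(hν k hk).1, ?_⟩
        have := (hν k hk).2
        rw [hreal] at this
        exact_mod_cast this.symm
    refine tendsto_nhds_unique (f := fun _ : ℕ => ν) (l := atTop) tendsto_const_nhds ?_
    refine tendsto_of_tendsto_moments (R := R) (fun _ k => (hν' k).1) (fun k => (hμ k).1)
      (fun k => ?_) fun k => ?_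
    · rw [(hμ k).2]
      exact hmR k
    · rw [(hμ k).2, (hν' k).2]
      exact tendsto_const_nhds
  · rintro rfl k _
    exact ⟨(hμ k).1, by rw [hreal, (hμ k).2]⟩
  · filter_upwards [hd, hQ] with ω hω hsymm
    exact tendsto_esd hsymm (hlimre ω hω) hmR hμ

end SpectralLimit

end CrossCov

end

open CrossCov in
theorem theorem1 {Ω : Type*} [MeasurableSpace Ω] (P : Measure Ω) [IsProbabilityMeasure P]
    (t : ℕ) (n : Fin t → ℕ → ℕ)
    (X Y : (l : Fin t) → (p : ℕ) → Ω → Matrix (Fin p) (Fin (n l p)) ℝ)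
    (ρ y : Fin t → ℝ)
    (hXY : EntryAssumptions P n X Y ρ)
    (hn : ∀ l, Tendsto (n l) atTop atTop)
    (hy : ∀ l, 0 < y l)
    (hpn : ∀ l, Tendsto (fun p : ℕ => (p : ℝ) / (n l p : ℝ)) atTop (𝓝 (y l))) :
    ∃ (A : Type) (_ : Ring A) (_ : StarRing A) (_ : Algebra ℂ A) (_ : StarModule ℂ A)
      (φ : A →ₗ[ℂ] ℂ) (c : Fin t → A),
      -- (a) the limiting variables
      IsState φ ∧ IsTracial φ ∧ (∀ l, IsCrossCovVariable φ (c l) (ρ l) (y l)) ∧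
      IsFreeFamily φ c ∧
      -- (a) the matrices lie in `M_p(ℂ)` and converge jointly with respect to `φ_p`
      (∀ (Q : StarPoly ℂ t),
        (∀ p : ℕ, HasAllMoments P fun ω =>
          Q.eval fun l => (crossCov (X l p ω) (Y l p ω)).map Complex.ofReal) ∧
        Tendsto (fun p : ℕ => expTrace P fun ω =>
          Q.eval fun l => (crossCov (X l p ω) (Y l p ω)).map Complex.ofReal)
          atTop (𝓝 (φ (Q.eval c)))) ∧
      -- (a) almost sure joint convergence with respect to the normalized trace
      (∀ᵐ ω ∂P, ∀ Q : StarPoly ℂ t,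
        Tendsto (fun p : ℕ => normTrace
          (Q.eval fun l => (crossCov (X l p ω) (Y l p ω)).map Complex.ofReal))
          atTop (𝓝 (φ (Q.eval c)))) ∧
      -- (b) symmetric real polynomials
      (∀ Q : StarPoly ℝ t,
        (∀ᵐ ω ∂P, ∀ᶠ p : ℕ in atTop,
          (Q.eval fun l => crossCov (X l p ω) (Y l p ω)).IsSymm) →
        ∃ μ : ProbabilityMeasure ℝ,
          IsLawOf φ (Q.eval c) μ ∧
          (∃ K : Set ℝ, IsCompact K ∧ (μ : Measure ℝ) Kᶜ = 0) ∧
          ∀ᵐ ω ∂P, Tendsto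
            (fun p : ℕ => esd (Q.eval fun l => crossCov (X l p ω) (Y l p ω)))
            atTop (𝓝 μ.toFiniteMeasure)) := by
  obtain ⟨ψ, hword, hexp, hae⟩ := hXY.exists_limit_functional hy hpn
  -- The limit `ψ` is deterministic, so the space built from one realization serves almost every
  -- `ω`.
  obtain ⟨ω₀, hω₀⟩ := hae.exists
  obtain ⟨A, _, _, _, _, φ, c, hst, htr, hφ, hfaith⟩ := exists_limit_model
    (fun p l => (crossCov (X l p ω₀) (Y l p ω₀)).map Complex.ofReal) ψ hω₀
  have hmom : ∀ (k : ℕ) (a : Fin k → Fin t × Bool),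
      φ (List.ofFn fun u => adj (c (a u).1) (a u).2).prod = (mom ρ y a : ℂ) := fun k a => by
    rw [← StarPoly.eval_word (𝕜 := ℂ), hφ, hword]
  refine ⟨A, _, _, _, ‹_›, φ, c, hst, htr, isCrossCovVariable_of_mom φ c hmom,
    isFreeFamily_of_mom φ c hmom, fun Q => ⟨fun p => hXY.hasAllMoments_eval p Q, ?_⟩, ?_,
    fun Q hQ => ?_⟩
  · rw [hφ]
    exact hexp Q
  · filter_upwards [hae] with ω hω Q
    rw [hφ]
    exact hω Q
  · refine exists_law_of_eventually_symm (K := growth ρ y) (growth_pos ρ y).le (fun k a => ?_) hφ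
      hfaith (d := fun ω p l => crossCov (X l p ω) (Y l p ω)) hae Q hQ
    rw [hword, Complex.norm_real]
    exact abs_mom_le ρ y a
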